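/- Conventions. For a set $H$, $[H]^\omega$ is the set of countable subsets of $H$, and $S\subseteq[H]^\omega$ is stationary if for every $F:[H]^{<\omega}\to H$ some $z\in S$ is closed under $F$ (otherwise nonstationary). For sets $M,N$ having transitive intersection with $\omega_1$, $M\sqsubseteq N$ means $M\subseteq N$ and $M\cap\omega_1=N\cap\omega_1$; $M\sqsubset N$ means in addition $M\neq N$. A set $S\subseteq[H]^\omega$ is semistationary if $\{N\in[H]^\omega : \exists M\in S\ M\sqsubseteq N\}$ is stationary in $[H]^\omega$. $H_\theta$ is the set of sets whose transitive closure has size $<\theta$. Strong Chang's Conjecture (SCC) is the statement: for all sufficiently large regular $\theta$, all wellorders $\Delta$ of $H_\theta$ and all countable $M\prec(H_\theta,\in,\Delta)$ there is $M'\prec(H_\theta,\in,\Delta)$ with $M\sqsubset M'$ and $M'\cap[\sup(M\cap\omega_2),\omega_2)\neq\emptyset$. A poset $\mathbb Q$ is semiproper if for all sufficiently large regular $\theta$, every countable $M\prec(H_\theta,\in,\mathbb Q)$ and every $q\in M\cap\mathbb Q$ there is $q'\le q$ with $q'\Vdash\check M\sqsubseteq\check M[\dot G]$. It is reasonable at $[\theta]^\omega$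 if it forces $\big([\theta]^\omega\big)^V$ to be stationary in $[\theta]^\omega$, and nonreasonable at $[\theta]^\omega$ otherwise. Theorem. (1) Let $V\subseteq W$ be transitive (set or class) models of ZFC. Suppose that whenever $H,S\in V$, $\omega_1^V\subseteq H$ and $V\models$ "$S$ is a stationary subset of $[H]^\omega$", then $W\models$ "$S$ is semistationary in $[H]^\omega$"; and suppose that $\big([\omega_2]^\omega\big)^V$ is nonstationary in $[\omega_2^V]^\omega$ in $W$. Then $V\models$ SCC. (2) If there is a semiproper poset that is nonreasonable at $[\omega_2]^\omega$, then SCC holds. -/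

import Mathlib

universe u v

namespace ChangConj

/-! ### First-order formulas of set theory -/

/-- Formulas of the language `{∈}` whose free variables have been assigned elements of `X`.
A quantifier is given as a function of the bound variable.  All formulas defined below are
uniform in `X`, hence they are ordinary first-order formulas of set theory (with parameters). -/
inductive Fml (X : Type v) : Type v
  | mem (x y : X) : Fml X
  | eq (x y : X) : Fml X
  | neg (a : Fml X) : Fml X
  | and (a b : Fml X) : Fml X
  | all (f : X → Fml X) : Fml X

namespace Fml

variable {X : Type v}

infix:60 " ∈ᶠ " => Fml.mem
infix:60 " ≐ " => Fml.eq
prefix:55 "∼ᶠ" => Fml.neg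
infixr:45 " ⋏ " => Fml.and

def or (a b : Fml X) : Fml X := ∼ᶠ (∼ᶠ a ⋏ ∼ᶠ b)
infixr:40 " ⋎ " => Fml.or

def imp (a b : Fml X) : Fml X := ∼ᶠ (a ⋏ ∼ᶠ b)
infixr:35 " ⇒ᶠ " => Fml.imp

def iff (a b : Fml X) : Fml X := (a ⇒ᶠ b) ⋏ (b ⇒ᶠ a)
infix:30 " ⇔ᶠ " => Fml.iff

def ex (f : X → Fml X) : Fml X := ∼ᶠ (.all fun x => ∼ᶠ (f x))

/-- `∀ x ∈ a, f x` -/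
def allIn (a : X) (f : X → Fml X) : Fml X := .all fun x => x ∈ᶠ a ⇒ᶠ f x

/-- `∃ x ∈ a, f x` -/
def exIn (a : X) (f : X → Fml X) : Fml X := .ex fun x => x ∈ᶠ a ⋏ f x

/-! ### Set-theoretic notions as formulas -/

/-- `x ⊆ y` -/
def sub (x y : X) : Fml X := allIn x fun z => z ∈ᶠ y

/-- `z = {x, y}` -/
def isUPair (z x y : X) : Fml X := .all fun w => w ∈ᶠ z ⇔ᶠ (w ≐ x ⋎ w ≐ y)

/-- `z = (x, y) = {{x}, {x, y}}` -/
def isPair (z x y : X) : Fml X :=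
  .ex fun a => .ex fun b => isUPair a x x ⋏ isUPair b x y ⋏ isUPair z a b

/-- `(x, y) ∈ f` -/
def pairMem (x y f : X) : Fml X := .ex fun z => isPair z x y ⋏ z ∈ᶠ f

/-- `f`, restricted to `a`, is a function from `a` to `b` -/
def isMap (f a b : X) : Fml X :=
  allIn a fun x => exIn b fun y => .all fun y' => pairMem x y' f ⇔ᶠ y' ≐ y

/-- There is an injective function from `a` to `b`. -/
def injects (a b : X) : Fml X :=
  .ex fun f => isMap f a b ⋏
    allIn a fun x => allIn a fun x' => .all fun y =>
      (pairMem x y f ⋏ pairMem x' y f) ⇒ᶠ x ≐ x'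

/-- `x` is a transitive set -/
def transSet (x : X) : Fml X := allIn x fun y => sub y x

/-- `x` is an ordinal -/
def isOrd (x : X) : Fml X := transSet x ⋏ allIn x fun y => transSet y

/-- `x` is empty -/
def isEmpty (x : X) : Fml X := .all fun y => ∼ᶠ (y ∈ᶠ x)

/-- `x = y ∪ {y}` -/
def isSucc (x y : X) : Fml X := .all fun z => z ∈ᶠ x ⇔ᶠ (z ∈ᶠ y ⋎ z ≐ y)

/-- `x` is a limit ordinal (in particular it is not empty) -/
def isLimit (x : X) : Fml X :=
  isOrd x ⋏ ∼ᶠ (isEmpty x) ⋏ allIn x fun y => exIn x fun z => y ∈ᶠ z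

/-- `w = ω` -/
def isOmega (w : X) : Fml X :=
  isLimit w ⋏ allIn w fun x => isEmpty x ⋎ .ex fun y => isSucc x y

/-- `x` is countable (finite sets are countable) -/
def ctbl (x : X) : Fml X := .ex fun w => isOmega w ⋏ injects x w

/-- `x` is finite -/
def fin (x : X) : Fml X := .ex fun w => isOmega w ⋏ exIn w fun n => injects x n

/-- `w = ω₁` -/
def isOmega1 (w : X) : Fml X := isOrd w ⋏ ∼ᶠ (ctbl w) ⋏ allIn w fun x => ctbl x

/-- `w = ω₂` -/
def isOmega2 (w : X) : Fml X :=
  isOrd w ⋏ .ex fun w₁ => isOmega1 w₁ ⋏ ∼ᶠ (injects w w₁) ⋏ allIn w fun x => injects x w₁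

/-- `t` is a regular (infinite) cardinal -/
def isRegular (t : X) : Fml X :=
  isLimit t ⋏ allIn t fun a => .all fun f => isMap f a t ⇒ᶠ
    exIn t fun b => allIn a fun x => .all fun y => pairMem x y f ⇒ᶠ y ∈ᶠ b

/-- `h = H_t`, the set of all sets whose transitive closure has cardinality less than
the cardinal `t` -/
def isH (h t : X) : Fml X :=
  .all fun x => x ∈ᶠ h ⇔ᶠ
    .ex fun c => transSet c ⋏ sub x c ⋏ exIn t fun a => injects c a

/-- `d` is a (strict) wellorder of the set `h` -/
def isWellorder (d h : X) : Fml X :=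
  (allIn d fun z => exIn h fun x => exIn h fun y => isPair z x y) ⋏
  (allIn h fun x => ∼ᶠ (pairMem x x d)) ⋏
  (allIn h fun x => allIn h fun y => allIn h fun z =>
    (pairMem x y d ⋏ pairMem y z d) ⇒ᶠ pairMem x z d) ⋏
  (allIn h fun x => allIn h fun y => pairMem x y d ⋎ x ≐ y ⋎ pairMem y x d) ⋏
  (.all fun s => (sub s h ⋏ ∼ᶠ (isEmpty s)) ⇒ᶠ
    exIn s fun m => allIn s fun x => m ≐ x ⋎ pairMem m x d)

/-- `b = [h]^ω`, the set of all countable subsets of `h` -/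
def isCtblSubsets (b h : X) : Fml X := .all fun z => z ∈ᶠ b ⇔ᶠ (sub z h ⋏ ctbl z)

/-- `F` restricts to a function `[h]^{<ω} → h` -/
def isFinOp (F h : X) : Fml X :=
  .all fun e => (sub e h ⋏ fin e) ⇒ᶠ
    exIn h fun y => .all fun y' => pairMem e y' F ⇔ᶠ y' ≐ y

/-- `z` is closed under `F`: if `e` is a finite subset of `z` then `F(e) ∈ z` -/
def closedUnder (z F : X) : Fml X :=
  .all fun e => (sub e z ⋏ fin e) ⇒ᶠ .all fun y => pairMem e y F ⇒ᶠ y ∈ᶠ z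

/-- `s` is a stationary subset of `[h]^ω`: it consists of countable subsets of `h`, and for every
`F : [h]^{<ω} → h` some element of `s` is closed under `F` -/
def stationary (s h : X) : Fml X :=
  (allIn s fun z => sub z h ⋏ ctbl z) ⋏
  .all fun F => isFinOp F h ⇒ᶠ exIn s fun z => closedUnder z F

/-- `m ⊑ n`: both sets have transitive intersection with `ω₁`, `m ⊆ n`, and
`m ∩ ω₁ = n ∩ ω₁` -/
def sqsub (m n : X) : Fml X :=
  sub m n ⋏ .ex fun w => isOmega1 w ⋏
    (allIn m fun x => x ∈ᶠ w ⇒ᶠ sub x m) ⋏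
    (allIn n fun x => x ∈ᶠ w ⇒ᶠ sub x n) ⋏
    allIn w fun x => x ∈ᶠ m ⇔ᶠ x ∈ᶠ n

/-- `s ⊆ [h]^ω` is semistationary: `{n ∈ [h]^ω | ∃ m ∈ s, m ⊑ n}` is stationary in `[h]^ω` -/
def semistationary (s h : X) : Fml X :=
  (allIn s fun z => sub z h ⋏ ctbl z) ⋏
  .ex fun t =>
    (.all fun n => n ∈ᶠ t ⇔ᶠ (sub n h ⋏ ctbl n ⋏ exIn s fun m => sqsub m n)) ⋏ stationary t h

end Fml

/-- `V ⊨ a`, where `V` is a class of sets with the true membership relation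
(all parameters of `a` should be in `V`) -/
def Sat (V : Set ZFSet.{u}) : Fml ZFSet.{u} → Prop
  | .mem x y => x ∈ y
  | .eq x y => x = y
  | .neg a => ¬ Sat V a
  | .and a b => Sat V a ∧ Sat V b
  | .all f => ∀ x ∈ V, Sat V (f x)

/-! ### Transitive models of ZFC -/

/-- The relation symbols of the language `{∈}` -/
inductive MemRel : ℕ → Type
  | mem : MemRel 2

/-- The language `{∈}` -/
def memLang : FirstOrder.Language.{0, 0} := ⟨fun _ => Empty, MemRel⟩

/-- A binary relation `E` on `M`, as a structure `(M, E)` for the language `{∈}` -/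
@[reducible] def memStructure {M : Type v} (E : M → M → Prop) : memLang.Structure M where
  funMap := fun f => nomatch f
  RelMap := fun r x => match r with
    | .mem => E (x 0) (x 1)

/-- `(M, E)` is a model of ZFC.  The two axiom schemes are expressed through the subsets of `M`
and `M × M` that are first-order definable in `(M, E)` with parameters from `M`. -/
structure IsZFC (M : Type v) (E : M → M → Prop) : Prop where
  nonempty : Nonempty M
  extensionality : ∀ x y, (∀ z, E z x ↔ E z y) → x = y
  foundation : ∀ x, (∃ y, E y x) → ∃ y, E y x ∧ ∀ z, E z y → ¬ E z x
  pairing : ∀ x y, ∃ p, ∀ z, E z p ↔ z = x ∨ z = y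
  union : ∀ x, ∃ s, ∀ z, E z s ↔ ∃ y, E y x ∧ E z y
  powerset : ∀ x, ∃ p, ∀ z, E z p ↔ ∀ w, E w z → E w x
  infinity : ∃ w, (∃ e, E e w ∧ ∀ z, ¬ E z e) ∧
    ∀ x, E x w → ∃ y, E y w ∧ ∀ z, E z y ↔ E z x ∨ z = x
  separation : letI := memStructure E
    ∀ D : Set M, (Set.univ : Set M).Definable₁ memLang D →
      ∀ a, ∃ b, ∀ x, E x b ↔ E x a ∧ x ∈ D
  replacement : letI := memStructure E
    ∀ R : Set (M × M), (Set.univ : Set M).Definable₂ memLang R →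
      ∀ a, (∀ x, E x a → ∃! y, (x, y) ∈ R) →
        ∃ b, ∀ y, E y b ↔ ∃ x, E x a ∧ (x, y) ∈ R
  choice : ∀ x, (∀ y, E y x → ∃ z, E z y) →
    (∀ y y', E y x → E y' x → (∃ z, E z y ∧ E z y') → y = y') →
      ∃ c, ∀ y, E y x → ∃! z, E z c ∧ E z y

/-- `V` is a transitive class (possibly a set) such that `(V, ∈)` is a model of ZFC -/
structure IsTransitiveModel (V : Set ZFSet.{u}) : Prop where
  transitive : ∀ x ∈ V, ∀ y ∈ x, y ∈ V
  zfc : IsZFC {x : ZFSet.{u} // x ∈ V} (fun x y => x.1 ∈ y.1)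

/-! ### Elementary submodels and Strong Chang's Conjecture -/

/-- The relation symbols of the language `{∈, A}` with `A` a unary predicate -/
inductive ExpRel : ℕ → Type
  | mem : ExpRel 2
  | pred : ExpRel 1

/-- The language `{∈, A}` -/
def expLang : FirstOrder.Language.{0, 0} := ⟨fun _ => Empty, ExpRel⟩

/-- The structure `(H, ∈, A ∩ H)` -/
@[reducible] def expStructure (H : ZFSet.{u}) (A : Set ZFSet.{u}) :
    expLang.Structure {x : ZFSet.{u} // x ∈ H} where
  funMap := fun f => nomatch f
  RelMap := fun r x => match r with
    | .mem => (x 0).1 ∈ (x 1).1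
    | .pred => (x 0).1 ∈ A

/-- `M ≺ (H, ∈, A)` -/
def ElemSub (M H : ZFSet.{u}) (A : Set ZFSet.{u}) : Prop :=
  M ⊆ H ∧ letI := expStructure H A
    ∃ N : expLang.ElementarySubstructure {x : ZFSet.{u} // x ∈ H}, ∀ x, x ∈ N ↔ x.1 ∈ M

/-- `V ⊨ SCC`: for all sufficiently large regular `θ`, all wellorders `Δ` of `H_θ` and all countable
`M ≺ (H_θ, ∈, Δ)` there is `M' ≺ (H_θ, ∈, Δ)` with `M ⊏ M'` that contains an ordinal in the
interval `[sup (M ∩ ω₂), ω₂)`.  Everything is computed in the transitive model `V`, for which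
the satisfaction relation of a structure in `V` is absolute. -/
def SCC (V : Set ZFSet.{u}) : Prop :=
  ∃ θ₀ ∈ V, Sat V (.isOrd θ₀) ∧
    ∀ θ ∈ V, θ₀ ∈ θ → Sat V (.isRegular θ) →
    ∀ H ∈ V, Sat V (.isH H θ) →
    ∀ Δ ∈ V, Sat V (.isWellorder Δ H) →
    ∀ M ∈ V, Sat V (.ctbl M) → ElemSub M H {x | x ∈ Δ} →
    ∃ M' ∈ V, ElemSub M' H {x | x ∈ Δ} ∧
      Sat V (.sqsub M M') ∧ M ≠ M' ∧
      ∃ ω₂ ∈ V, Sat V (.isOmega2 ω₂) ∧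
        ∃ ζ ∈ M', ζ ∈ ω₂ ∧ ∀ β ∈ M, β ∈ ω₂ → β ∈ ζ ∨ β = ζ

/-- Every stationary set of countable models in `V` is semistationary in `W`: whenever `V` thinks
that `H ⊇ ω₁` and that `S` is a stationary subset of `[H]^ω`, then `W` thinks that `S` is
semistationary in `[H]^ω`. -/
def SemistationaryPreserving (V W : Set ZFSet.{u}) : Prop :=
  ∀ H ∈ V, ∀ S ∈ V, (∃ ω₁ ∈ V, Sat V (.isOmega1 ω₁) ∧ ω₁ ⊆ H) →
    Sat V (.stationary S H) → Sat W (.semistationary S H)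

/-- `([ω₂]^ω)^V` is nonstationary in `W` (as a subset of `[ω₂^V]^ω`) -/
def GroundModelNonstationary (V W : Set ZFSet.{u}) : Prop :=
  ∃ ω₂ ∈ V, Sat V (.isOmega2 ω₂) ∧ ∃ B ∈ V, Sat V (.isCtblSubsets B ω₂) ∧
    ¬ Sat W (.stationary B ω₂)

/-! ### Forcing over the universe of sets -/

/-- A poset (reflexive transitive relation), as a set `carrier` together with the set `rel`
of all pairs `(p, q)` with `p ≤ q` -/
structure Poset where
  carrier : ZFSet.{u}
  rel : ZFSet.{u}
  rel_subset : rel ⊆ carrier.prod carrier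
  refl : ∀ p ∈ carrier, ZFSet.pair p p ∈ rel
  trans : ∀ p q r, ZFSet.pair p q ∈ rel → ZFSet.pair q r ∈ rel → ZFSet.pair p r ∈ rel

namespace Poset

variable (Q : Poset.{u})

/-- `p` is at least as strong as `q` -/
def le (p q : ZFSet.{u}) : Prop := ZFSet.pair p q ∈ Q.rel

/-- `Q`-names: sets of pairs `(σ, p)` with `σ` a `Q`-name and `p ∈ Q` -/
inductive IsName : ZFSet.{u} → Prop
  | intro (τ : ZFSet.{u}) : (∀ z ∈ τ, ∃ σ, ∃ p ∈ Q.carrier, z = ZFSet.pair σ p) →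
      (∀ σ p, ZFSet.pair σ p ∈ τ → IsName σ) → IsName τ

end Poset

theorem rank_lt_of_pair_mem {x p y : ZFSet.{u}} (h : ZFSet.pair x p ∈ y) : x.rank < y.rank := by
  refine lt_trans ?_ (ZFSet.rank_lt_of_mem h)
  have h1 : x ∈ ({x} : ZFSet.{u}) := by simp
  have h2 : ({x} : ZFSet.{u}) ∈ ZFSet.pair x p := by simp [ZFSet.pair]
  exact lt_trans (ZFSet.rank_lt_of_mem h1) (ZFSet.rank_lt_of_mem h2)

namespace Poset

variable (Q : Poset.{u})

/-- `p ⊩ σ = τ` -/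
def ForcesEq (σ τ p : ZFSet.{u}) : Prop :=
  (∀ π s, ∀ _h : ZFSet.pair π s ∈ σ, ∀ q, Q.le q p → Q.le q s →
    ∃ r, Q.le r q ∧ ∃ ρ t, ZFSet.pair ρ t ∈ τ ∧ Q.le r t ∧ ForcesEq π ρ r) ∧
  (∀ ρ t, ZFSet.pair ρ t ∈ τ → ∀ q, Q.le q p → Q.le q t →
    ∃ r, Q.le r q ∧ ∃ π s, ∃ _h : ZFSet.pair π s ∈ σ, Q.le r s ∧ ForcesEq π ρ r)
termination_by σ.rank
decreasing_by all_goals exact rank_lt_of_pair_mem _h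

/-- `p ⊩ σ ∈ τ` -/
def ForcesMem (σ τ p : ZFSet.{u}) : Prop :=
  ∀ q, Q.le q p → ∃ r, Q.le r q ∧ ∃ ρ t, ZFSet.pair ρ t ∈ τ ∧ Q.le r t ∧ Q.ForcesEq σ ρ r

/-- The forcing relation `p ⊩ a`, for formulas `a` whose parameters are `Q`-names -/
def Forces (p : ZFSet.{u}) : Fml ZFSet.{u} → Prop
  | .mem σ τ => Q.ForcesMem σ τ p
  | .eq σ τ => Q.ForcesEq σ τ p
  | .neg a => ∀ q, Q.le q p → ¬ Forces q a
  | .and a b => Forces p a ∧ Forces p b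
  | .all f => ∀ τ, Q.IsName τ → Forces p (f τ)

/-- The canonical name `x̌ = {(y̌, p) | y ∈ x, p ∈ Q}` of the set `x` -/
noncomputable def check (x : ZFSet.{u}) : ZFSet.{u} :=
  ZFSet.range (fun z : {y : ZFSet.{u} // y ∈ x} × {p : ZFSet.{u} // p ∈ Q.carrier} =>
    ZFSet.pair (check z.1.1) z.2.1)
termination_by x.rank
decreasing_by exact ZFSet.rank_lt_of_mem z.1.2

/-- The canonical name of `M[G] = {τ_G | τ ∈ M is a Q-name}` -/
noncomputable def extName (M : ZFSet.{u}) : ZFSet.{u} :=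
  ZFSet.sep (fun z => ∃ τ p, z = ZFSet.pair τ p ∧ Q.IsName τ) (M.prod Q.carrier)

/-- `Q` is semiproper: for all sufficiently large regular `θ`, all countable `M ≺ (H_θ, ∈, Q)` and
all `q ∈ M ∩ Q` there is `q' ≤ q` with `q' ⊩ M ⊑ M[G]`.  Here `Q` is a constant of the structure,
that is, the predicate `{Q}` is added to it. -/
def Semiproper : Prop :=
  ∃ θ₀ : ZFSet.{u}, Sat Set.univ (.isOrd θ₀) ∧
    ∀ θ, θ₀ ∈ θ → Sat Set.univ (.isRegular θ) →
    ∀ H, Sat Set.univ (.isH H θ) →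
    ∀ M, Sat Set.univ (.ctbl M) → ElemSub M H {ZFSet.pair Q.carrier Q.rel} →
    ∀ q ∈ M, q ∈ Q.carrier →
      ∃ q', Q.le q' q ∧ Q.Forces q' (.sqsub (Q.check M) (Q.extName M))

/-- `Q` is reasonable at `[θ]^ω`: it preserves the stationarity of `([θ]^ω)^V`, that is, every
condition forces that the ground model set `[θ]^ω` is stationary in `[θ]^ω` -/
def ReasonableAt (θ : ZFSet.{u}) : Prop :=
  ∀ B, Sat Set.univ (.isCtblSubsets B θ) →
    ∀ p ∈ Q.carrier, Q.Forces p (.stationary (Q.check B) (Q.check θ))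

end Poset

end ChangConj

namespace ChangConj

open Fml

/-! ### Semantics of the formulas in transitive classes -/

/-! Call x ⊆ K determined if an ordinal ζ < ω₂ belongs to x as soon as f(ζ) ∈ x for every f : ω₂ →
ω₁ in x. Everything rests on one dichotomy: either SCC holds, or for some K = H_θ the determined
countable subsets of K form a stationary set (`exists_stationary_determined`).

For the dichotomy, suppose that the determined sets are nonstationary in [K]^ω, where K is an
element of a larger H_θ'. A countable M ≺ (H_θ', ∈, Δ) contains some K' and some F' witnessing a
nonstationarity of this kind. As M ∩ K' is closed under F', it is not determined, so there is ζ ∈ ω₂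
\ M with f(ζ) ∈ M for all f : ω₂ → ω₁ in M. The hull M' = {f(ζ) : f ∈ M} is elementary because Δ
provides definable least witnesses, and it has no new countable ordinals by the choice of ζ.
Moreover ζ lies above M ∩ ω₂: if ζ < β ∈ M ∩ ω₂, then an injection of β into ω₁ that lies in M would
put ζ into M. So M' is as SCC demands (`IsHier.exists_extension`).

For the first statement, let SCC fail in V, let S be the stationary set of determined sets, and let
G : [ω₂]^{<ω} → ω₂ be in W. By semistationarity there are m ∈ S and N with m ⊑ N such that N is
closed under G and under the evaluation of functions ω₂ → ω₁. If ζ ∈ N ∩ ω₂ and f ∈ m is such a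
function, then f(ζ) ∈ N ∩ ω₁ = m ∩ ω₁; hence ζ ∈ m. Thus N ∩ ω₂ = m ∩ ω₂ is an element of V closed
under G, and the ground model sets are stationary after all (`scc_of_outer_model`).

For the second statement, the role of N is played by M[G]. The stationary set is lifted to some M ≺
H_θ with M ∩ K determined and with M closed under suitable operations on names
(`StatIn.exists_elemSub`). If a condition forces M ⊑ M[G], then M ∩ ω₂ is forced to be closed under
a given name for an operation on ω₂ (`Poset.not_forces_sqsub`). The universe has no generic
extension inside itself, so the consequences of forced statements are read off in small transitive
models: a filter that decides a countable family of formulas, with witnesses, interprets the names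
correctly for that family (`Poset.exists_world`, `Poset.Interprets.holds_iff`). -/

/-- A transitive class closed under unordered pairs. -/
structure PairClosed (X : Set ZFSet.{u}) : Prop where
  trans : ∀ x ∈ X, ∀ y ∈ x, y ∈ X
  upair : ∀ x ∈ X, ∀ y ∈ X, ({x, y} : ZFSet) ∈ X

/-- `f`, restricted to `a`, is a function from `a` to `b`. -/
def MapInto (f a b : ZFSet.{u}) : Prop :=
  ∀ x ∈ a, ∃ y ∈ b, ∀ y', ZFSet.pair x y' ∈ f ↔ y' = y

/-- `f` is injective on `a`. -/
def InjectiveOn (f a : ZFSet.{u}) : Prop :=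
  ∀ x ∈ a, ∀ x' ∈ a, ∀ y, ZFSet.pair x y ∈ f → ZFSet.pair x' y ∈ f → x = x'

/-- Some element of `X` is an injection from `a` to `b`. -/
def Injects (X : Set ZFSet.{u}) (a b : ZFSet.{u}) : Prop :=
  ∃ f ∈ X, MapInto f a b ∧ InjectiveOn f a

/-- The set `ω`. -/
noncomputable def omegaSet : ZFSet.{u} := (Ordinal.omega0).toZFSet

section Sat

variable {X : Set ZFSet.{u}}

@[simp] theorem sat_mem {x y : ZFSet.{u}} : Sat X (x ∈ᶠ y) ↔ x ∈ y := Iff.rfl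
@[simp] theorem sat_eq {x y : ZFSet.{u}} : Sat X (x ≐ y) ↔ x = y := Iff.rfl
@[simp] theorem sat_neg {a : Fml ZFSet.{u}} : Sat X (∼ᶠ a) ↔ ¬ Sat X a := Iff.rfl
@[simp] theorem sat_and {a b : Fml ZFSet.{u}} : Sat X (a ⋏ b) ↔ Sat X a ∧ Sat X b := Iff.rfl
@[simp] theorem sat_all {f : ZFSet.{u} → Fml ZFSet.{u}} :
    Sat X (.all f) ↔ ∀ x ∈ X, Sat X (f x) := Iff.rfl
@[simp] theorem sat_or {a b : Fml ZFSet.{u}} : Sat X (a ⋎ b) ↔ Sat X a ∨ Sat X b := by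
  simp only [Fml.or, sat_neg, sat_and]; tauto
@[simp] theorem sat_imp {a b : Fml ZFSet.{u}} : Sat X (a ⇒ᶠ b) ↔ (Sat X a → Sat X b) := by
  simp only [Fml.imp, sat_neg, sat_and]; tauto
@[simp] theorem sat_iff {a b : Fml ZFSet.{u}} : Sat X (a ⇔ᶠ b) ↔ (Sat X a ↔ Sat X b) := by
  simp only [Fml.iff, sat_imp, sat_and]; tauto
@[simp] theorem sat_ex {f : ZFSet.{u} → Fml ZFSet.{u}} :
    Sat X (.ex f) ↔ ∃ x ∈ X, Sat X (f x) := by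
  simp [Fml.ex]

theorem PairClosed.singleton (hX : PairClosed X) {x : ZFSet.{u}} (hx : x ∈ X) :
    ({x} : ZFSet) ∈ X := by
  simpa using hX.upair x hx x hx

theorem PairClosed.pair (hX : PairClosed X) {x y : ZFSet.{u}} (hx : x ∈ X) (hy : y ∈ X) :
    ZFSet.pair x y ∈ X :=
  hX.upair _ (hX.singleton hx) _ (hX.upair x hx y hy)

theorem PairClosed.of_pair_mem (hX : PairClosed X) {x y f : ZFSet.{u}} (hf : f ∈ X)
    (h : ZFSet.pair x y ∈ f) : x ∈ X ∧ y ∈ X := by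
  have h1 := hX.trans _ hf _ h
  have h2 : ({x, y} : ZFSet) ∈ X := hX.trans _ h1 _ (by simp [ZFSet.pair])
  exact ⟨hX.trans _ h2 _ (by simp), hX.trans _ h2 _ (by simp)⟩

theorem sat_allIn (hX : PairClosed X) {a : ZFSet.{u}} (ha : a ∈ X)
    {f : ZFSet.{u} → Fml ZFSet.{u}} : Sat X (allIn a f) ↔ ∀ x ∈ a, Sat X (f x) := by
  simp only [allIn, sat_all, sat_imp, sat_mem]
  exact ⟨fun h x hx => h x (hX.trans _ ha _ hx) hx, fun h x _ hx => h x hx⟩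

theorem sat_exIn (hX : PairClosed X) {a : ZFSet.{u}} (ha : a ∈ X)
    {f : ZFSet.{u} → Fml ZFSet.{u}} : Sat X (exIn a f) ↔ ∃ x ∈ a, Sat X (f x) := by
  simp only [exIn, sat_ex, sat_and, sat_mem]
  exact ⟨fun ⟨x, _, h⟩ => ⟨x, h⟩, fun ⟨x, h⟩ => ⟨x, hX.trans _ ha _ h.1, h⟩⟩

theorem sat_sub (hX : PairClosed X) {a b : ZFSet.{u}} (ha : a ∈ X) :
    Sat X (sub a b) ↔ a ⊆ b := by
  rw [sub, sat_allIn hX ha]; rfl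

theorem PairClosed.ext (hX : PairClosed X) {a b : ZFSet.{u}} (ha : a ∈ X) (hb : b ∈ X)
    (h : ∀ w ∈ X, w ∈ a ↔ w ∈ b) : a = b := by
  ext w
  exact ⟨fun hw => (h w (hX.trans _ ha _ hw)).1 hw, fun hw => (h w (hX.trans _ hb _ hw)).2 hw⟩

theorem sat_isUPair (hX : PairClosed X) {z x y : ZFSet.{u}} (hz : z ∈ X) (hx : x ∈ X)
    (hy : y ∈ X) : Sat X (isUPair z x y) ↔ z = {x, y} := by
  simp only [isUPair, sat_all, sat_iff, sat_mem, sat_or, sat_eq]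
  constructor
  · intro h
    exact hX.ext hz (hX.upair x hx y hy) fun w hw => by rw [h w hw, ZFSet.mem_pair]
  · rintro rfl w _
    rw [ZFSet.mem_pair]

theorem sat_isPair (hX : PairClosed X) {z x y : ZFSet.{u}} (hz : z ∈ X) (hx : x ∈ X)
    (hy : y ∈ X) : Sat X (isPair z x y) ↔ z = ZFSet.pair x y := by
  simp only [isPair, sat_ex, sat_and]
  constructor
  · rintro ⟨a, ha, b, hb, h1, h2, h3⟩
    rw [sat_isUPair hX ha hx hx] at h1
    rw [sat_isUPair hX hb hx hy] at h2
    rw [sat_isUPair hX hz ha hb] at h3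
    subst h1 h2 h3
    simp [ZFSet.pair]
  · rintro rfl
    refine ⟨{x}, hX.singleton hx, {x, y}, hX.upair x hx y hy, ?_, ?_, ?_⟩
    · rw [sat_isUPair hX (hX.singleton hx) hx hx]; simp
    · rw [sat_isUPair hX (hX.upair x hx y hy) hx hy]
    · rw [sat_isUPair hX hz (hX.singleton hx) (hX.upair x hx y hy)]; rfl

theorem sat_pairMem (hX : PairClosed X) {x y f : ZFSet.{u}} (hx : x ∈ X) (hy : y ∈ X) :
    Sat X (pairMem x y f) ↔ ZFSet.pair x y ∈ f := by
  simp only [pairMem, sat_ex, sat_and, sat_mem]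
  constructor
  · rintro ⟨z, hz, h1, h2⟩
    rw [sat_isPair hX hz hx hy] at h1
    exact h1 ▸ h2
  · intro h
    exact ⟨_, hX.pair hx hy, (sat_isPair hX (hX.pair hx hy) hx hy).2 rfl, h⟩

theorem sat_isMap (hX : PairClosed X) {f a b : ZFSet.{u}} (hf : f ∈ X) (ha : a ∈ X)
    (hb : b ∈ X) : Sat X (isMap f a b) ↔ MapInto f a b := by
  rw [isMap, sat_allIn hX ha]
  refine forall₂_congr fun x hx => ?_
  rw [sat_exIn hX hb]
  refine exists_congr fun y => and_congr_right fun hy => ?_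
  simp only [sat_all, sat_iff, sat_eq]
  constructor
  · intro h y'
    -- The formula tests only `y' ∈ X`, whereas `MapInto` tests all sets. Outside `X` both sides are
    -- false, because `f` and `b` are in the transitive class `X`.
    by_cases hy' : y' ∈ X
    · rw [← h y' hy', sat_pairMem hX (hX.trans _ ha _ hx) hy']
    · exact ⟨fun h' => (hy' (hX.of_pair_mem hf h').2).elim,
        fun h' => (hy' (h' ▸ hX.trans _ hb _ hy)).elim⟩
  · intro h y' hy'
    rw [sat_pairMem hX (hX.trans _ ha _ hx) hy', h]

theorem sat_injects (hX : PairClosed X) {a b : ZFSet.{u}} (ha : a ∈ X) (hb : b ∈ X) :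
    Sat X (injects a b) ↔ Injects X a b := by
  rw [injects, sat_ex]
  refine exists_congr fun f => and_congr_right fun hf => ?_
  rw [sat_and, sat_isMap hX hf ha hb, sat_allIn hX ha]
  refine and_congr_right fun _ => ?_
  refine forall₂_congr fun x hx => ?_
  rw [sat_allIn hX ha]
  refine forall₂_congr fun x' hx' => ?_
  simp only [sat_all, sat_imp, sat_and, sat_eq]
  constructor
  · intro h y h1 h2
    have hy := (hX.of_pair_mem hf h1).2
    refine h y hy ?_
    rw [sat_pairMem hX (hX.trans _ ha _ hx) hy, sat_pairMem hX (hX.trans _ ha _ hx') hy]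
    exact ⟨h1, h2⟩
  · intro h y hy
    rw [sat_pairMem hX (hX.trans _ ha _ hx) hy, sat_pairMem hX (hX.trans _ ha _ hx') hy]
    exact fun h' => h y h'.1 h'.2

theorem sat_transSet (hX : PairClosed X) {a : ZFSet.{u}} (ha : a ∈ X) :
    Sat X (transSet a) ↔ a.IsTransitive := by
  rw [transSet, sat_allIn hX ha]
  exact forall₂_congr fun x hx => sat_sub hX (hX.trans _ ha _ hx)

theorem sat_isOrd (hX : PairClosed X) {a : ZFSet.{u}} (ha : a ∈ X) :
    Sat X (isOrd a) ↔ a.IsOrdinal := by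
  rw [isOrd, sat_and, sat_transSet hX ha, sat_allIn hX ha,
    ZFSet.isOrdinal_iff_forall_mem_isTransitive]
  exact and_congr_right fun _ =>
    forall₂_congr fun x hx => sat_transSet hX (hX.trans _ ha _ hx)

theorem sat_isEmpty (hX : PairClosed X) {a : ZFSet.{u}} (ha : a ∈ X) :
    Sat X (Fml.isEmpty a) ↔ a = ∅ := by
  simp only [Fml.isEmpty, sat_all, sat_neg, sat_mem, ZFSet.eq_empty]
  exact ⟨fun h y hy => h y (hX.trans _ ha _ hy) hy, fun h y _ => h y⟩

theorem sat_isSucc (hX : PairClosed X) {a b : ZFSet.{u}} (ha : a ∈ X) (hb : b ∈ X) :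
    Sat X (isSucc a b) ↔ a = insert b b := by
  simp only [isSucc, sat_all, sat_iff, sat_mem, sat_or, sat_eq]
  constructor
  · intro h
    ext w
    rw [ZFSet.mem_insert_iff]
    constructor
    · exact fun hw => ((h w (hX.trans _ ha _ hw)).1 hw).symm
    · rintro (rfl | hw)
      · exact (h w hb).2 (Or.inr rfl)
      · exact (h w (hX.trans _ hb _ hw)).2 (Or.inl hw)
  · rintro rfl w _
    rw [ZFSet.mem_insert_iff]; tauto

theorem sat_isLimit (hX : PairClosed X) {a : ZFSet.{u}} (ha : a ∈ X) :
    Sat X (isLimit a) ↔ a.IsOrdinal ∧ a ≠ ∅ ∧ ∀ y ∈ a, ∃ z ∈ a, y ∈ z := by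
  rw [isLimit, sat_and, sat_and, sat_isOrd hX ha, sat_neg, sat_isEmpty hX ha, sat_allIn hX ha]
  refine and_congr_right fun _ => and_congr_right fun _ => ?_
  exact forall₂_congr fun x hx => sat_exIn hX ha

theorem mem_omegaSet {x : ZFSet.{u}} : x ∈ omegaSet ↔ ∃ n : ℕ, (n : Ordinal).toZFSet = x := by
  rw [omegaSet, Ordinal.mem_toZFSet_iff]
  constructor
  · rintro ⟨a, ha, rfl⟩
    obtain ⟨n, rfl⟩ := Ordinal.lt_omega0.1 ha
    exact ⟨n, rfl⟩
  · rintro ⟨n, rfl⟩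
    exact ⟨n, Ordinal.natCast_lt_omega0 n, rfl⟩

theorem isOrdinal_omegaSet : (omegaSet : ZFSet.{u}).IsOrdinal := ZFSet.isOrdinal_toZFSet _

theorem empty_mem_omegaSet : ∅ ∈ (omegaSet : ZFSet.{u}) := mem_omegaSet.2 ⟨0, by simp⟩

theorem insert_mem_omegaSet {x : ZFSet.{u}} (hx : x ∈ (omegaSet : ZFSet.{u})) :
    insert x x ∈ (omegaSet : ZFSet.{u}) := by
  obtain ⟨n, rfl⟩ := mem_omegaSet.1 hx
  exact mem_omegaSet.2 ⟨n + 1, by push_cast; exact Ordinal.toZFSet_add_one _⟩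

theorem omegaSet_induction {p : ZFSet.{u} → Prop} (h0 : p ∅)
    (hs : ∀ x ∈ (omegaSet : ZFSet.{u}), p x → p (insert x x)) :
    ∀ x ∈ (omegaSet : ZFSet.{u}), p x := by
  intro x hx
  obtain ⟨n, rfl⟩ := mem_omegaSet.1 hx
  clear hx
  induction n with
  | zero => simpa using h0
  | succ n ih =>
    push_cast
    rw [Ordinal.toZFSet_add_one]
    exact hs _ (mem_omegaSet.2 ⟨n, rfl⟩) ih

/-- The semantic content of `isOmega`. -/
theorem eq_omegaSet_iff {w : ZFSet.{u}} : w = omegaSet ↔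
    (w.IsOrdinal ∧ w ≠ ∅ ∧ ∀ y ∈ w, ∃ z ∈ w, y ∈ z) ∧
      ∀ x ∈ w, x = ∅ ∨ ∃ y ∈ x, x = insert y y := by
  constructor
  · rintro rfl
    refine ⟨⟨isOrdinal_omegaSet, fun h => ?_, fun y hy => ⟨_, insert_mem_omegaSet hy, by simp⟩⟩, ?_⟩
    · exact ZFSet.notMem_empty _ (h ▸ empty_mem_omegaSet)
    · exact omegaSet_induction (Or.inl rfl) fun x _ _ => Or.inr ⟨x, by simp, rfl⟩
  · rintro ⟨⟨h1, h2, h3⟩, h4⟩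
    have hsub : (omegaSet : ZFSet.{u}) ⊆ w := by
      refine omegaSet_induction ?_ ?_
      · rcases h1.mem_or_subset ZFSet.isOrdinal_empty with h | h
        · exact (ZFSet.notMem_empty _ h).elim
        · rcases (ZFSet.isOrdinal_empty.subset_iff_eq_or_mem h1).1 h with h | h
          · exact (h2 h.symm).elim
          · exact h
      · intro x _ hx
        obtain ⟨z, hz, hxz⟩ := h3 x hx
        have ho := (h1.mem hx)
        have hz' := h1.mem hz
        have : insert x x ⊆ z := by
          intro t ht
          rcases ZFSet.mem_insert_iff.1 ht with rfl | ht
          · exact hxz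
          · exact hz'.mem_trans ht hxz
        exact (ZFSet.isOrdinal_succ ho).mem_of_subset_of_mem h1 this hz
    refine le_antisymm ?_ hsub
    intro x
    induction x using ZFSet.inductionOn with
    | _ x ih =>
      intro hx
      rcases h4 x hx with rfl | ⟨y, hy, rfl⟩
      · exact empty_mem_omegaSet
      · exact insert_mem_omegaSet (ih y hy (h1.mem_trans hy hx))

theorem sat_isOmega (hX : PairClosed X) {w : ZFSet.{u}} (hw : w ∈ X) :
    Sat X (isOmega w) ↔ w = omegaSet := by
  rw [isOmega, sat_and, sat_isLimit hX hw, sat_allIn hX hw, eq_omegaSet_iff]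
  refine and_congr_right fun _ => forall₂_congr fun x hx => ?_
  have hxX := hX.trans _ hw _ hx
  rw [sat_or, sat_isEmpty hX hxX, sat_ex]
  refine or_congr_right ⟨?_, ?_⟩
  · rintro ⟨y, hy, h⟩
    rw [sat_isSucc hX hxX hy] at h
    exact ⟨y, by simp [h], h⟩
  · rintro ⟨y, hy, h⟩
    have hyX := hX.trans _ hxX _ hy
    exact ⟨y, hyX, (sat_isSucc hX hxX hyX).2 h⟩

/-- Countability is not absolute: the injection itself has to be an element of `X`. This is why
`Injects` carries the class along, while ω, pairs and ordinals need no such parameter. -/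
theorem sat_ctbl (hX : PairClosed X) (hω : omegaSet ∈ X) {x : ZFSet.{u}} (hx : x ∈ X) :
    Sat X (ctbl x) ↔ Injects X x omegaSet := by
  rw [ctbl, sat_ex]
  constructor
  · rintro ⟨w, hw, h1, h2⟩
    rw [sat_isOmega hX hw] at h1
    subst h1
    exact (sat_injects hX hx hw).1 h2
  · intro h
    exact ⟨_, hω, (sat_isOmega hX hω).2 rfl, (sat_injects hX hx hω).2 h⟩

theorem sat_fin (hX : PairClosed X) (hω : omegaSet ∈ X) {x : ZFSet.{u}} (hx : x ∈ X) :
    Sat X (Fml.fin x) ↔ ∃ n ∈ (omegaSet : ZFSet.{u}), Injects X x n := by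
  rw [Fml.fin, sat_ex]
  constructor
  · rintro ⟨w, hw, h1, h2⟩
    rw [sat_isOmega hX hw] at h1
    subst h1
    rw [sat_exIn hX hw] at h2
    obtain ⟨n, hn, h⟩ := h2
    exact ⟨n, hn, (sat_injects hX hx (hX.trans _ hω _ hn)).1 h⟩
  · rintro ⟨n, hn, h⟩
    refine ⟨_, hω, (sat_isOmega hX hω).2 rfl, ?_⟩
    exact (sat_exIn hX hω).2 ⟨n, hn, (sat_injects hX hx (hX.trans _ hω _ hn)).2 h⟩

/-- `w` is the first uncountable ordinal of `X`. -/
def IsOmega1 (X : Set ZFSet.{u}) (w : ZFSet.{u}) : Prop :=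
  w.IsOrdinal ∧ ¬ Injects X w omegaSet ∧ ∀ x ∈ w, Injects X x omegaSet

/-- `w` is the second uncountable cardinal of `X`. -/
def IsOmega2 (X : Set ZFSet.{u}) (w₁ w : ZFSet.{u}) : Prop :=
  w.IsOrdinal ∧ ¬ Injects X w w₁ ∧ ∀ x ∈ w, Injects X x w₁

theorem sat_isOmega1 (hX : PairClosed X) (hω : omegaSet ∈ X) {w : ZFSet.{u}} (hw : w ∈ X) :
    Sat X (Fml.isOmega1 w) ↔ IsOmega1 X w := by
  rw [Fml.isOmega1, sat_and, sat_and, sat_isOrd hX hw, sat_neg, sat_ctbl hX hω hw,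
    sat_allIn hX hw]
  refine and_congr_right fun _ => and_congr_right fun _ => ?_
  exact forall₂_congr fun x hx => sat_ctbl hX hω (hX.trans _ hw _ hx)

theorem sat_isOmega2 (hX : PairClosed X) (hω : omegaSet ∈ X) {w : ZFSet.{u}} (hw : w ∈ X) :
    Sat X (Fml.isOmega2 w) ↔ ∃ w₁ ∈ X, IsOmega1 X w₁ ∧ IsOmega2 X w₁ w := by
  rw [Fml.isOmega2, sat_and, sat_ex, sat_isOrd hX hw]
  have : ∀ w₁ ∈ X, (Sat X (Fml.isOmega1 w₁ ⋏ ∼ᶠ (injects w w₁) ⋏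
      allIn w fun x => injects x w₁)) ↔
      IsOmega1 X w₁ ∧ ¬ Injects X w w₁ ∧ ∀ x ∈ w, Injects X x w₁ := by
    intro w₁ h₁
    rw [sat_and, sat_and, sat_isOmega1 hX hω h₁, sat_neg, sat_injects hX hw h₁, sat_allIn hX hw]
    refine and_congr_right fun _ => and_congr_right fun _ => ?_
    exact forall₂_congr fun x hx => sat_injects hX (hX.trans _ hw _ hx) h₁
  constructor
  · rintro ⟨h, w₁, h₁, h'⟩
    rw [this w₁ h₁] at h'
    exact ⟨w₁, h₁, h'.1, h, h'.2⟩
  · rintro ⟨w₁, h₁, h2, h, h'⟩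
    exact ⟨h, w₁, h₁, (this w₁ h₁).2 ⟨h2, h'⟩⟩

/-- `x` is finite in the sense of `X`. -/
def FinIn (X : Set ZFSet.{u}) (x : ZFSet.{u}) : Prop :=
  ∃ n ∈ (omegaSet : ZFSet.{u}), Injects X x n

/-- `F` is a finitary operation on `h` in the sense of `X`. -/
def FinOp (X : Set ZFSet.{u}) (F h : ZFSet.{u}) : Prop :=
  ∀ e ∈ X, e ⊆ h → FinIn X e → ∃ y ∈ h, ∀ y', ZFSet.pair e y' ∈ F ↔ y' = y

/-- `z` is closed under the finitary operation `F` in the sense of `X`. -/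
def ClosedIn (X : Set ZFSet.{u}) (z F : ZFSet.{u}) : Prop :=
  ∀ e ∈ X, e ⊆ z → FinIn X e → ∀ y, ZFSet.pair e y ∈ F → y ∈ z

theorem sat_isFinOp (hX : PairClosed X) (hω : omegaSet ∈ X) {F h : ZFSet.{u}} (hF : F ∈ X)
    (hh : h ∈ X) : Sat X (isFinOp F h) ↔ FinOp X F h := by
  rw [isFinOp, sat_all]
  refine forall₂_congr fun e he => ?_
  rw [sat_imp, sat_and, sat_sub hX he, sat_fin hX hω he, sat_exIn hX hh, and_imp]
  refine forall₂_congr fun _ _ => exists_congr fun y => and_congr_right fun hy => ?_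
  simp only [sat_all, sat_iff, sat_eq]
  constructor
  · intro h' y'
    by_cases hy' : y' ∈ X
    · rw [← h' y' hy', sat_pairMem hX he hy']
    · exact ⟨fun h' => (hy' (hX.of_pair_mem hF h').2).elim,
        fun h' => (hy' (h' ▸ hX.trans _ hh _ hy)).elim⟩
  · intro h' y' hy'
    rw [sat_pairMem hX he hy', h']

theorem sat_closedUnder (hX : PairClosed X) (hω : omegaSet ∈ X) {z F : ZFSet.{u}}
    (hF : F ∈ X) : Sat X (closedUnder z F) ↔ ClosedIn X z F := by
  rw [closedUnder, sat_all]
  refine forall₂_congr fun e he => ?_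
  rw [sat_imp, sat_and, sat_sub hX he, sat_fin hX hω he, sat_all, and_imp]
  refine forall₂_congr fun _ _ => ⟨fun h y hy => ?_, fun h y hy => ?_⟩
  · have hyX := (hX.of_pair_mem hF hy).2
    exact (sat_imp.1 (h y hyX)) ((sat_pairMem hX he hyX).2 hy)
  · rw [sat_imp, sat_pairMem hX he hy]
    exact h y

/-- `s` is stationary in `[h]^ω` in the sense of `X`. -/
def StatIn (X : Set ZFSet.{u}) (s h : ZFSet.{u}) : Prop :=
  (∀ z ∈ s, z ⊆ h ∧ Injects X z omegaSet) ∧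
    ∀ F ∈ X, FinOp X F h → ∃ z ∈ s, ClosedIn X z F

theorem sat_stationary (hX : PairClosed X) (hω : omegaSet ∈ X) {s h : ZFSet.{u}} (hs : s ∈ X)
    (hh : h ∈ X) : Sat X (stationary s h) ↔ StatIn X s h := by
  rw [stationary, sat_and, sat_allIn hX hs, sat_all]
  refine and_congr (forall₂_congr fun z hz => ?_) (forall₂_congr fun F hF => ?_)
  · have := hX.trans _ hs _ hz
    rw [sat_and, sat_sub hX this, sat_ctbl hX hω this]
  · rw [sat_imp, sat_isFinOp hX hω hF hh, sat_exIn hX hs]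
    exact imp_congr_right fun _ => exists_congr fun z => and_congr_right fun _ =>
      sat_closedUnder hX hω hF

theorem sat_sqsub (hX : PairClosed X) (hω : omegaSet ∈ X) {m n : ZFSet.{u}} (hm : m ∈ X)
    (hn : n ∈ X) : Sat X (sqsub m n) ↔ m ⊆ n ∧ ∃ w ∈ X, IsOmega1 X w ∧
      (∀ x ∈ m, x ∈ w → x ⊆ m) ∧ (∀ x ∈ n, x ∈ w → x ⊆ n) ∧ ∀ x ∈ w, x ∈ m ↔ x ∈ n := by
  rw [sqsub, sat_and, sat_sub hX hm, sat_ex]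
  refine and_congr_right fun _ => exists_congr fun w => and_congr_right fun hw => ?_
  rw [sat_and, sat_and, sat_and, sat_isOmega1 hX hω hw, sat_allIn hX hm, sat_allIn hX hn,
    sat_allIn hX hw]
  refine and_congr_right fun _ => and_congr (forall₂_congr fun x hx => ?_)
    (and_congr (forall₂_congr fun x hx => ?_) (forall₂_congr fun x hx => ?_))
  · rw [sat_imp, sat_mem, sat_sub hX (hX.trans _ hm _ hx)]
  · rw [sat_imp, sat_mem, sat_sub hX (hX.trans _ hn _ hx)]
  · rw [sat_iff, sat_mem, sat_mem]

theorem sat_isCtblSubsets (hX : PairClosed X) (hω : omegaSet ∈ X) {b h : ZFSet.{u}} (hb : b ∈ X) :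
    Sat X (isCtblSubsets b h) ↔
      ∀ z, z ∈ b ↔ z ∈ X ∧ z ⊆ h ∧ Injects X z omegaSet := by
  rw [isCtblSubsets, sat_all]
  constructor
  · intro H z
    constructor
    · intro hz
      have hzX := hX.trans _ hb _ hz
      have := (sat_iff.1 (H z hzX)).1 hz
      rw [sat_and, sat_sub hX hzX, sat_ctbl hX hω hzX] at this
      exact ⟨hzX, this⟩
    · rintro ⟨hzX, h'⟩
      refine (sat_iff.1 (H z hzX)).2 ?_
      rwa [sat_and, sat_sub hX hzX, sat_ctbl hX hω hzX]
  · intro H z hz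
    rw [sat_iff, sat_mem, H, sat_and, sat_sub hX hz, sat_ctbl hX hω hz]
    exact ⟨fun h => h.2, fun h => ⟨hz, h⟩⟩

/-- The semantic content of `isRegular`. -/
def RegularIn (X : Set ZFSet.{u}) (t : ZFSet.{u}) : Prop :=
  (t.IsOrdinal ∧ t ≠ ∅ ∧ ∀ y ∈ t, ∃ z ∈ t, y ∈ z) ∧
    ∀ a ∈ t, ∀ f ∈ X, MapInto f a t → ∃ b ∈ t, ∀ x ∈ a, ∀ y, ZFSet.pair x y ∈ f → y ∈ b

theorem sat_isRegular (hX : PairClosed X) {t : ZFSet.{u}} (ht : t ∈ X) :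
    Sat X (isRegular t) ↔ RegularIn X t := by
  rw [isRegular, sat_and, sat_isLimit hX ht, sat_allIn hX ht]
  refine and_congr_right fun _ => forall₂_congr fun a ha => ?_
  have haX := hX.trans _ ht _ ha
  rw [sat_all]
  refine forall₂_congr fun f hf => ?_
  rw [sat_imp, sat_isMap hX hf haX ht, sat_exIn hX ht]
  refine imp_congr_right fun _ => exists_congr fun b => and_congr_right fun hb => ?_
  rw [sat_allIn hX haX]
  refine forall₂_congr fun x hx => ?_
  have hxX := hX.trans _ haX _ hx
  rw [sat_all]
  refine ⟨fun h y hy => ?_, fun h y hy => ?_⟩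
  · have hyX := (hX.of_pair_mem hf hy).2
    exact (sat_imp.1 (h y hyX)) ((sat_pairMem hX hxX hyX).2 hy)
  · rw [sat_imp, sat_pairMem hX hxX hy]
    exact h y

theorem sat_isH (hX : PairClosed X) {h t : ZFSet.{u}} (hh : h ∈ X) (ht : t ∈ X) :
    Sat X (isH h t) ↔ ∀ x, x ∈ h ↔ x ∈ X ∧
      ∃ c ∈ X, c.IsTransitive ∧ x ⊆ c ∧ ∃ a ∈ t, Injects X c a := by
  have key : ∀ x ∈ X, (Sat X (.ex fun c => transSet c ⋏ sub x c ⋏ exIn t fun a => injects c a) ↔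
      ∃ c ∈ X, c.IsTransitive ∧ x ⊆ c ∧ ∃ a ∈ t, Injects X c a) := by
    intro x hx
    rw [sat_ex]
    refine exists_congr fun c => and_congr_right fun hc => ?_
    rw [sat_and, sat_and, sat_transSet hX hc, sat_sub hX hx, sat_exIn hX ht]
    refine and_congr_right fun _ => and_congr_right fun _ => exists_congr fun a =>
      and_congr_right fun ha => sat_injects hX hc (hX.trans _ ht _ ha)
  rw [isH, sat_all]
  constructor
  · intro H x
    constructor
    · intro hx
      have hxX := hX.trans _ hh _ hx
      exact ⟨hxX, (key x hxX).1 ((sat_iff.1 (H x hxX)).1 hx)⟩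
    · rintro ⟨hxX, h'⟩
      exact (sat_iff.1 (H x hxX)).2 ((key x hxX).2 h')
  · intro H x hx
    rw [sat_iff, sat_mem, H, key x hx]
    exact ⟨fun h => h.2, fun h => ⟨hx, h⟩⟩

/-- `d` wellorders `h` in the sense of `X`. -/
structure WellorderIn (X : Set ZFSet.{u}) (d h : ZFSet.{u}) : Prop where
  irrefl : ∀ x ∈ h, ZFSet.pair x x ∉ d
  trans : ∀ x ∈ h, ∀ y ∈ h, ∀ z ∈ h,
    ZFSet.pair x y ∈ d → ZFSet.pair y z ∈ d → ZFSet.pair x z ∈ d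
  total : ∀ x ∈ h, ∀ y ∈ h, ZFSet.pair x y ∈ d ∨ x = y ∨ ZFSet.pair y x ∈ d
  min : ∀ s ∈ X, s ⊆ h → s ≠ ∅ → ∃ m ∈ s, ∀ x ∈ s, m = x ∨ ZFSet.pair m x ∈ d

theorem WellorderIn.of_sat (hX : PairClosed X) {d h : ZFSet.{u}} (hh : h ∈ X)
    (H : Sat X (isWellorder d h)) : WellorderIn X d h := by
  simp only [isWellorder, sat_and] at H
  obtain ⟨-, h2, h3, h4, h5⟩ := H
  have hm := fun x hx => hX.trans _ hh x hx
  refine ⟨fun x hx => ?_, fun x hx y hy z hz h h' => ?_, fun x hx y hy => ?_,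
    fun s hs hsh hse => ?_⟩
  · have := (sat_allIn hX hh).1 h2 x hx
    rwa [sat_neg, sat_pairMem hX (hm x hx) (hm x hx)] at this
  · have := (sat_allIn hX hh).1 ((sat_allIn hX hh).1 ((sat_allIn hX hh).1 h3 x hx) y hy) z hz
    rw [sat_imp, sat_and, sat_pairMem hX (hm x hx) (hm y hy), sat_pairMem hX (hm y hy) (hm z hz),
      sat_pairMem hX (hm x hx) (hm z hz)] at this
    exact this ⟨h, h'⟩
  · have := (sat_allIn hX hh).1 ((sat_allIn hX hh).1 h4 x hx) y hy
    rwa [sat_or, sat_or, sat_pairMem hX (hm x hx) (hm y hy), sat_eq,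
      sat_pairMem hX (hm y hy) (hm x hx)] at this
  · have := h5 s hs
    rw [sat_imp, sat_and, sat_sub hX hs, sat_neg, sat_isEmpty hX hs, sat_exIn hX hs] at this
    obtain ⟨m, hms, h⟩ := this ⟨hsh, hse⟩
    rw [sat_allIn hX hs] at h
    refine ⟨m, hms, fun x hx => ?_⟩
    have := h x hx
    rwa [sat_or, sat_eq, sat_pairMem hX (hX.trans _ hs _ hms) (hX.trans _ hs _ hx)] at this

end Sat

/-! ### First-order definable predicates on a class -/

/-- A term: a variable or a parameter from `C`. -/
inductive Tm (C : Set ZFSet.{u}) {n : ℕ} : ((Fin n → ZFSet.{u}) → ZFSet.{u}) → Prop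
  | proj (i : Fin n) : Tm C (fun v => v i)
  | const (c : ZFSet.{u}) (h : c ∈ C) : Tm C (fun _ => c)

/-- Predicates given by formulas over `(U, ∈, A)` with parameters from `C`. -/
inductive StrictDfn (U A C : Set ZFSet.{u}) : ∀ {n : ℕ}, ((Fin n → ZFSet.{u}) → Prop) → Prop
  | mem {n : ℕ} {s t : (Fin n → ZFSet.{u}) → ZFSet.{u}} (hs : Tm C s) (ht : Tm C t) :
      StrictDfn U A C (fun v => s v ∈ t v)
  | eq {n : ℕ} {s t : (Fin n → ZFSet.{u}) → ZFSet.{u}} (hs : Tm C s) (ht : Tm C t) :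
      StrictDfn U A C (fun v => s v = t v)
  | pred {n : ℕ} {s : (Fin n → ZFSet.{u}) → ZFSet.{u}} (hs : Tm C s) :
      StrictDfn U A C (fun v => s v ∈ A)
  | imp {n : ℕ} {P Q : (Fin n → ZFSet.{u}) → Prop} (hP : StrictDfn U A C P)
      (hQ : StrictDfn U A C Q) : StrictDfn U A C (fun v => P v → Q v)
  | false {n : ℕ} : StrictDfn U A C (fun _ : Fin n → ZFSet.{u} => False)
  | all {n : ℕ} {P : (Fin (n + 1) → ZFSet.{u}) → Prop} (hP : StrictDfn U A C P) :
      StrictDfn U A C (fun v => ∀ x ∈ U, P (Fin.snoc v x))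

/-- Predicates that agree on `U` with one given by a formula over `(U, ∈, A)` with parameters
from `C`. -/
def Dfn (U A C : Set ZFSet.{u}) {n : ℕ} (P : (Fin n → ZFSet.{u}) → Prop) : Prop :=
  ∃ P', StrictDfn U A C P' ∧ ∀ v, (∀ i, v i ∈ U) → (P v ↔ P' v)

/-! ### From definable predicates to first-order formulas -/

section Language

open FirstOrder

/-- A definable predicate is the realization of a formula, for each language that has symbols for
`∈` and for `A`. -/
theorem StrictDfn.exists_formula {U A C : Set ZFSet.{u}} {L : FirstOrder.Language.{0, 0}}
    [inst : L.Structure {x : ZFSet.{u} // x ∈ U}] (hC : C ⊆ U) (r : L.Relations 2)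
    (hr : ∀ x y : {x : ZFSet.{u} // x ∈ U}, Language.Structure.RelMap r ![x, y] ↔ x.1 ∈ y.1)
    (hp : (∃ p : L.Relations 1, ∀ x : {x : ZFSet.{u} // x ∈ U},
      Language.Structure.RelMap p ![x] ↔ x.1 ∈ A) ∨ ∀ x ∈ U, x ∉ A)
    {n : ℕ} {P : (Fin n → ZFSet.{u}) → Prop} (h : StrictDfn U A C P) :
    ∃ φ : L.BoundedFormula {x // x ∈ C} n, ∀ xs : Fin n → {x : ZFSet.{u} // x ∈ U},
      φ.Realize (fun c => ⟨c.1, hC c.2⟩) xs ↔ P (fun i => (xs i).1) := by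
  have tm : ∀ {n : ℕ} {s : (Fin n → ZFSet.{u}) → ZFSet.{u}}, Tm C s →
      ∃ t : L.Term ({x // x ∈ C} ⊕ Fin n), ∀ xs : Fin n → {x : ZFSet.{u} // x ∈ U},
        (t.realize (Sum.elim (fun c => ⟨c.1, hC c.2⟩) xs)).1 = s (fun i => (xs i).1) := by
    intro n s hs
    cases hs with
    | proj i => exact ⟨Language.Term.var (Sum.inr i), fun xs => rfl⟩
    | const c h => exact ⟨Language.Term.var (Sum.inl ⟨c, h⟩), fun xs => rfl⟩
  induction h with
  | mem hs ht =>
    obtain ⟨s, hs⟩ := tm hs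
    obtain ⟨t, ht⟩ := tm ht
    refine ⟨r.boundedFormula₂ s t, fun xs => ?_⟩
    rw [Language.BoundedFormula.realize_rel₂, hr, hs, ht]
  | eq hs ht =>
    obtain ⟨s, hs⟩ := tm hs
    obtain ⟨t, ht⟩ := tm ht
    refine ⟨s.bdEqual t, fun xs => ?_⟩
    rw [Language.BoundedFormula.realize_bdEqual, ← Subtype.coe_inj, hs, ht]
  | @pred _ s' hs =>
    obtain ⟨s, hs⟩ := tm hs
    -- A language without a symbol for `A` is admitted when `A` misses `U`; atomic statements about
    -- `A` then become ⊥. This covers the pure language of set theory.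
    rcases hp with ⟨p, hp⟩ | hp
    · refine ⟨p.boundedFormula₁ s, fun xs => ?_⟩
      rw [Language.BoundedFormula.realize_rel₁, hp, hs]
    · refine ⟨⊥, fun xs => ?_⟩
      rw [Language.BoundedFormula.realize_bot, false_iff]
      change s' (fun i => (xs i).1) ∉ A
      rw [← hs]
      exact hp _ (Subtype.prop _)
  | imp _ _ ih1 ih2 =>
    obtain ⟨φ, h1⟩ := ih1
    obtain ⟨ψ, h2⟩ := ih2
    exact ⟨φ.imp ψ, fun xs => by rw [Language.BoundedFormula.realize_imp, h1, h2]⟩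
  | false => exact ⟨⊥, fun xs => by rw [Language.BoundedFormula.realize_bot]⟩
  | all _ ih =>
    obtain ⟨φ, h⟩ := ih
    refine ⟨φ.all, fun xs => ?_⟩
    rw [Language.BoundedFormula.realize_all]
    have key : ∀ a : {x : ZFSet.{u} // x ∈ U},
        (fun i => ((Fin.snoc xs a : Fin _ → {x : ZFSet.{u} // x ∈ U}) i).1) =
        (Fin.snoc (fun i => (xs i).1) a.1 : Fin _ → ZFSet.{u}) := by
      intro a
      funext i
      refine Fin.lastCases ?_ (fun i => ?_) i <;> simp
    constructor
    · intro H x hx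
      have := (h _).1 (H ⟨x, hx⟩)
      rwa [key] at this
    · intro H a
      rw [h, key]
      exact H _ a.2

end Language

/-! ### A calculus of definable predicates -/

section Dfn

variable {U A C : Set ZFSet.{u}} {n : ℕ}

theorem Tm.init {s : (Fin n → ZFSet.{u}) → ZFSet.{u}} (hs : Tm C s) :
    Tm C (fun v : Fin (n + 1) → ZFSet.{u} => s (Fin.init v)) := by
  cases hs with
  | proj i => exact Tm.proj (Fin.castSucc i)
  | const c h => exact Tm.const c h

theorem Tm.mem {s : (Fin n → ZFSet.{u}) → ZFSet.{u}} (hs : Tm C s) (hC : C ⊆ U)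
    {v : Fin n → ZFSet.{u}} (hv : ∀ i, v i ∈ U) : s v ∈ U := by
  cases hs with
  | proj i => exact hv i
  | const c h => exact hC h

theorem Tm.subst {m : ℕ} {s : (Fin n → ZFSet.{u}) → ZFSet.{u}} (hs : Tm C s)
    {σ : Fin n → (Fin m → ZFSet.{u}) → ZFSet.{u}} (hσ : ∀ i, Tm C (σ i)) :
    Tm C (fun v => s (fun i => σ i v)) := by
  cases hs with
  | proj i => exact hσ i
  | const c h => exact Tm.const c h

/-- Induction on the formula. At a quantifier the substitution is extended by the new last variable,
and the old terms ignore that variable by way of `Fin.init`. -/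
theorem StrictDfn.subst {P : (Fin n → ZFSet.{u}) → Prop} (h : StrictDfn U A C P) :
    ∀ {m : ℕ} {σ : Fin n → (Fin m → ZFSet.{u}) → ZFSet.{u}}, (∀ i, Tm C (σ i)) →
      StrictDfn U A C (fun v => P (fun i => σ i v)) := by
  induction h with
  | mem hs ht => exact fun hσ => .mem (hs.subst hσ) (ht.subst hσ)
  | eq hs ht => exact fun hσ => .eq (hs.subst hσ) (ht.subst hσ)
  | pred hs => exact fun hσ => .pred (hs.subst hσ)
  | imp _ _ ih1 ih2 => exact fun hσ => .imp (ih1 hσ) (ih2 hσ)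
  | false => exact fun _ => .false
  | @all k P _ ih =>
    intro m σ hσ
    have := (ih (m := m + 1) (σ := Fin.snoc (fun i v => σ i (Fin.init v))
      (fun v => v (Fin.last m))) (fun i => by
        refine Fin.lastCases ?_ (fun i => ?_) i
        · rw [Fin.snoc_last]; exact .proj _
        · rw [Fin.snoc_castSucc]; exact (hσ i).init)).all
    have e : (fun v : Fin m → ZFSet.{u} => ∀ x ∈ U, P (Fin.snoc (fun i => σ i v) x)) =
        fun v => ∀ x ∈ U, P (fun i => (Fin.snoc (fun i v => σ i (Fin.init v))
          (fun v => v (Fin.last m)) : Fin (k + 1) → (Fin (m + 1) → ZFSet.{u}) → ZFSet.{u}) i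
            (Fin.snoc v x)) := by
      funext v
      refine propext <| forall₂_congr fun x _ => ?_
      have : (Fin.snoc (fun i => σ i v) x : Fin (k + 1) → ZFSet.{u}) = fun i =>
          (Fin.snoc (fun i v => σ i (Fin.init v))
          (fun v => v (Fin.last m)) : Fin (k + 1) → (Fin (m + 1) → ZFSet.{u}) → ZFSet.{u}) i
            (Fin.snoc v x) := by
        funext i
        refine Fin.lastCases ?_ (fun i => ?_) i
        · simp
        · simp
      rw [this]
    exact e ▸ this

theorem StrictDfn.dfn {P : (Fin n → ZFSet.{u}) → Prop} (h : StrictDfn U A C P) : Dfn U A C P :=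
  ⟨P, h, fun _ _ => Iff.rfl⟩

namespace Dfn

variable {P Q : (Fin n → ZFSet.{u}) → Prop} {s t r : (Fin n → ZFSet.{u}) → ZFSet.{u}}

/-- Agreement is needed only for tuples from `U`, so absoluteness facts may be used to rewrite a
predicate into one that is visibly first-order. All later definability proofs rest on this freedom.
-/
theorem congr (h : Dfn U A C P) (H : ∀ v, (∀ i, v i ∈ U) → (Q v ↔ P v)) : Dfn U A C Q := by
  obtain ⟨P', h1, h2⟩ := h
  exact ⟨P', h1, fun v hv => (H v hv).trans (h2 v hv)⟩

theorem mem (hs : Tm C s) (ht : Tm C t) : Dfn U A C (fun v => s v ∈ t v) :=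
  (StrictDfn.mem hs ht).dfn

theorem eq (hs : Tm C s) (ht : Tm C t) : Dfn U A C (fun v => s v = t v) :=
  (StrictDfn.eq hs ht).dfn

theorem pred (hs : Tm C s) : Dfn U A C (fun v => s v ∈ A) := (StrictDfn.pred hs).dfn

theorem imp (hP : Dfn U A C P) (hQ : Dfn U A C Q) : Dfn U A C (fun v => P v → Q v) := by
  obtain ⟨P', h1, h2⟩ := hP
  obtain ⟨Q', h3, h4⟩ := hQ
  exact ⟨_, h1.imp h3, fun v hv => imp_congr (h2 v hv) (h4 v hv)⟩

theorem not (hP : Dfn U A C P) : Dfn U A C (fun v => ¬ P v) := hP.imp StrictDfn.false.dfn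

theorem and (hP : Dfn U A C P) (hQ : Dfn U A C Q) : Dfn U A C (fun v => P v ∧ Q v) :=
  (hP.imp hQ.not).not.congr fun _ _ => by tauto

theorem or (hP : Dfn U A C P) (hQ : Dfn U A C Q) : Dfn U A C (fun v => P v ∨ Q v) :=
  (hP.not.imp hQ).congr fun _ _ => by tauto

theorem iff (hP : Dfn U A C P) (hQ : Dfn U A C Q) : Dfn U A C (fun v => P v ↔ Q v) :=
  ((hP.imp hQ).and (hQ.imp hP)).congr fun _ _ => by tauto

theorem subst (hC : C ⊆ U) (hP : Dfn U A C P) {m : ℕ}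
    {σ : Fin n → (Fin m → ZFSet.{u}) → ZFSet.{u}} (hσ : ∀ i, Tm C (σ i)) :
    Dfn U A C (fun v => P (fun i => σ i v)) := by
  obtain ⟨P', h1, h2⟩ := hP
  exact ⟨_, h1.subst hσ, fun v hv => h2 _ fun i => (hσ i).mem hC hv⟩

theorem subst₂ (hC : C ⊆ U) {R : ZFSet.{u} → ZFSet.{u} → Prop}
    (hR : Dfn U A C fun v : Fin 2 → ZFSet.{u} => R (v 0) (v 1)) (hs : Tm C s) (ht : Tm C t) :
    Dfn U A C (fun v => R (s v) (t v)) :=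
  hR.subst hC (σ := ![s, t]) (fun i => by
    refine Fin.cases ?_ (fun i => ?_) i
    · exact hs
    · rw [Subsingleton.elim i 0]; exact ht)

theorem all {R : (Fin n → ZFSet.{u}) → ZFSet.{u} → Prop}
    (h : Dfn U A C fun v : Fin (n + 1) → ZFSet.{u} => R (Fin.init v) (v (Fin.last n))) :
    Dfn U A C (fun v => ∀ x ∈ U, R v x) := by
  obtain ⟨P', h1, h2⟩ := h
  refine ⟨_, h1.all, fun v hv => forall₂_congr fun x hx => ?_⟩
  have := h2 (Fin.snoc v x) (fun i => by refine Fin.lastCases ?_ (fun i => ?_) i <;> simp [hx, hv])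
  simpa using this

theorem ex {R : (Fin n → ZFSet.{u}) → ZFSet.{u} → Prop}
    (h : Dfn U A C fun v : Fin (n + 1) → ZFSet.{u} => R (Fin.init v) (v (Fin.last n))) :
    Dfn U A C (fun v => ∃ x ∈ U, R v x) :=
  (all (R := fun v x => ¬ R v x) h.not).not.congr fun v _ => by push Not; rfl

theorem allMem (hU : PairClosed U) (hC : C ⊆ U) {R : (Fin n → ZFSet.{u}) → ZFSet.{u} → Prop}
    (hs : Tm C s)
    (h : Dfn U A C fun v : Fin (n + 1) → ZFSet.{u} => R (Fin.init v) (v (Fin.last n))) :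
    Dfn U A C (fun v => ∀ x ∈ s v, R v x) :=
  (all (R := fun v x => x ∈ s v → R v x)
    ((mem (Tm.proj _) hs.init).imp h)).congr fun _ hv =>
      ⟨fun H x _ hx => H x hx, fun H x hx => H x (hU.trans _ (hs.mem hC hv) _ hx) hx⟩

theorem exMem (hU : PairClosed U) (hC : C ⊆ U) {R : (Fin n → ZFSet.{u}) → ZFSet.{u} → Prop}
    (hs : Tm C s)
    (h : Dfn U A C fun v : Fin (n + 1) → ZFSet.{u} => R (Fin.init v) (v (Fin.last n))) :
    Dfn U A C (fun v => ∃ x ∈ s v, R v x) :=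
  (ex (R := fun v x => x ∈ s v ∧ R v x)
    ((mem (Tm.proj _) hs.init).and h)).congr fun _ hv =>
      ⟨fun ⟨x, hx, H⟩ => ⟨x, hU.trans _ (hs.mem hC hv) _ hx, hx, H⟩, fun ⟨x, _, H⟩ => ⟨x, H⟩⟩

theorem isSub (hU : PairClosed U) (hC : C ⊆ U) (hs : Tm C s) (ht : Tm C t) :
    Dfn U A C (fun v => s v ⊆ t v) :=
  allMem (R := fun v x => x ∈ t v) hU hC hs (mem (Tm.proj _) ht.init)

theorem eqUPair (hU : PairClosed U) (hC : C ⊆ U) (hs : Tm C s) (ht : Tm C t) (hr : Tm C r) :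
    Dfn U A C (fun v => r v = {s v, t v}) :=
  (all (R := fun v w => w ∈ r v ↔ w = s v ∨ w = t v)
    ((mem (Tm.proj _) hr.init).iff ((eq (Tm.proj _) hs.init).or
      (eq (Tm.proj _) ht.init)))).congr fun v hv => by
      rw [← sat_isUPair hU (hr.mem hC hv) (hs.mem hC hv) (ht.mem hC hv)]
      simp [Fml.isUPair]

theorem eqPair (hU : PairClosed U) (hC : C ⊆ U) (hs : Tm C s) (ht : Tm C t) (hr : Tm C r) :
    Dfn U A C (fun v => r v = ZFSet.pair (s v) (t v)) :=
  (ex (R := fun v a => ∃ b ∈ U, a = {s v, s v} ∧ b = {s v, t v} ∧ r v = {a, b})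
    (ex (R := fun v b => v (Fin.last n) = {s (Fin.init v), s (Fin.init v)} ∧
      b = {s (Fin.init v), t (Fin.init v)} ∧ r (Fin.init v) = {v (Fin.last n), b})
    ((eqUPair hU hC hs.init.init hs.init.init (Tm.proj _).init).and
      ((eqUPair hU hC hs.init.init ht.init.init (Tm.proj _)).and
        (eqUPair hU hC (Tm.proj _).init (Tm.proj _) hr.init.init))))).congr fun v hv => by
      have hs' := hs.mem hC hv
      have ht' := ht.mem hC hv
      constructor
      · intro h
        exact ⟨{s v, s v}, hU.upair _ hs' _ hs', {s v, t v}, hU.upair _ hs' _ ht', rfl, rfl,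
          by rw [h, ZFSet.pair]; simp⟩
      · rintro ⟨a, -, b, -, rfl, rfl, h⟩
        rw [h, ZFSet.pair]; simp

theorem pairMem (hU : PairClosed U) (hC : C ⊆ U) (hs : Tm C s) (ht : Tm C t) (hr : Tm C r) :
    Dfn U A C (fun v => ZFSet.pair (s v) (t v) ∈ r v) :=
  (exMem (R := fun v z => z = ZFSet.pair (s v) (t v)) hU hC hr
    (eqPair hU hC hs.init ht.init (Tm.proj _))).congr fun v _ => by simp

/-- Used with `A` a wellorder of `U`: the structure has only a unary predicate for it, so
comparisons go through pairs, which exist in `U`. -/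
theorem pairPred (hU : PairClosed U) (hC : C ⊆ U) (hs : Tm C s) (ht : Tm C t) :
    Dfn U A C (fun v => ZFSet.pair (s v) (t v) ∈ A) :=
  (ex (R := fun v z => z = ZFSet.pair (s v) (t v) ∧ z ∈ A)
    ((eqPair hU hC hs.init ht.init (Tm.proj _)).and (pred (Tm.proj _)))).congr fun v hv => by
      have := hU.pair (hs.mem hC hv) (ht.mem hC hv)
      constructor
      · exact fun h => ⟨_, this, rfl, h⟩
      · rintro ⟨_, _, rfl, h⟩; exact h

theorem eqInsert (hU : PairClosed U) (hC : C ⊆ U) (hs : Tm C s) (ht : Tm C t) (hr : Tm C r) :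
    Dfn U A C (fun v => r v = insert (s v) (t v)) :=
  (all (R := fun v w => w ∈ r v ↔ w = s v ∨ w ∈ t v)
    ((mem (Tm.proj _) hr.init).iff ((eq (Tm.proj _) hs.init).or
      (mem (Tm.proj _) ht.init)))).congr fun v hv => by
      constructor
      · intro h w _
        rw [h, ZFSet.mem_insert_iff]
      · intro h
        ext w
        rw [ZFSet.mem_insert_iff]
        constructor
        · exact fun hw => (h w (hU.trans _ (hr.mem hC hv) _ hw)).1 hw
        · rintro (rfl | hw)
          · exact (h _ (hs.mem hC hv)).2 (Or.inl rfl)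
          · exact (h w (hU.trans _ (ht.mem hC hv) _ hw)).2 (Or.inr hw)

theorem isTransitive (hU : PairClosed U) (hC : C ⊆ U) (hs : Tm C s) :
    Dfn U A C (fun v => (s v).IsTransitive) :=
  allMem (R := fun v x => x ⊆ s v) hU hC hs (isSub hU hC (Tm.proj _) hs.init)

theorem isOrdinal (hU : PairClosed U) (hC : C ⊆ U) (hs : Tm C s) :
    Dfn U A C (fun v => (s v).IsOrdinal) :=
  ((isTransitive hU hC hs).and (allMem (R := fun _ x => x.IsTransitive) hU hC hs
    (isTransitive hU hC (Tm.proj _)))).congr fun _ _ =>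
      ZFSet.isOrdinal_iff_forall_mem_isTransitive

/-- Quantification over the second coordinates of the pairs in `r`. -/
theorem exPair (hU : PairClosed U) (hC : C ⊆ U) {R : (Fin n → ZFSet.{u}) → ZFSet.{u} → Prop}
    (hs : Tm C s) (hr : Tm C r)
    (h : Dfn U A C fun v : Fin (n + 1) → ZFSet.{u} => R (Fin.init v) (v (Fin.last n))) :
    Dfn U A C (fun v => ∃ y, ZFSet.pair (s v) y ∈ r v ∧ R v y) :=
  (ex (R := fun v y => ZFSet.pair (s v) y ∈ r v ∧ R v y)
    ((pairMem hU hC hs.init (Tm.proj _) hr.init).and h)).congr fun _ hv =>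
      ⟨fun ⟨y, hy, H⟩ => ⟨y, (hU.of_pair_mem (hr.mem hC hv) hy).2, hy, H⟩,
        fun ⟨y, _, H⟩ => ⟨y, H⟩⟩

theorem allPair (hU : PairClosed U) (hC : C ⊆ U) {R : (Fin n → ZFSet.{u}) → ZFSet.{u} → Prop}
    (hs : Tm C s) (hr : Tm C r)
    (h : Dfn U A C fun v : Fin (n + 1) → ZFSet.{u} => R (Fin.init v) (v (Fin.last n))) :
    Dfn U A C (fun v => ∀ y, ZFSet.pair (s v) y ∈ r v → R v y) :=
  (exPair (R := fun v y => ¬ R v y) hU hC hs hr h.not).not.congr fun v _ => by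
    push Not; rfl

theorem mapInto (hU : PairClosed U) (hC : C ⊆ U) (hs : Tm C s) (ht : Tm C t) (hr : Tm C r) :
    Dfn U A C (fun v => MapInto (r v) (s v) (t v)) :=
  (allMem (R := fun v x => ∃ y ∈ t v, ZFSet.pair x y ∈ r v ∧
      ∀ y', ZFSet.pair x y' ∈ r v → y' = y) hU hC hs
    (exMem (R := fun v y => ZFSet.pair (v (Fin.last n)) y ∈ r (Fin.init v) ∧
      ∀ y', ZFSet.pair (v (Fin.last n)) y' ∈ r (Fin.init v) → y' = y) hU hC ht.init
    ((pairMem hU hC (Tm.proj _).init (Tm.proj _) hr.init.init).and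
    (allPair (R := fun v y' => y' = v (Fin.last _)) hU hC (Tm.proj _).init hr.init.init
      (eq (Tm.proj _) (Tm.proj _).init))))).congr fun v _ => by
      refine forall₂_congr fun x hx => exists_congr fun y => and_congr_right fun _ => ?_
      exact ⟨fun h => ⟨(h y).2 rfl, fun y' => (h y').1⟩,
        fun h y' => ⟨h.2 y', fun e => e ▸ h.1⟩⟩

theorem injectiveOn (hU : PairClosed U) (hC : C ⊆ U) (hs : Tm C s) (hr : Tm C r) :
    Dfn U A C (fun v => InjectiveOn (r v) (s v)) :=
  allMem (R := fun v x => ∀ x' ∈ s v, ∀ y, ZFSet.pair x y ∈ r v → ZFSet.pair x' y ∈ r v → x = x')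
    hU hC hs
    (allMem (R := fun v x' => ∀ y, ZFSet.pair (v (Fin.last n)) y ∈ r (Fin.init v) →
      ZFSet.pair x' y ∈ r (Fin.init v) → v (Fin.last n) = x') hU hC hs.init
      (allPair (R := fun v y => ZFSet.pair (v (Fin.last _)) y ∈ r (Fin.init (Fin.init v)) →
          Fin.init v (Fin.last n) = v (Fin.last _))
        hU hC (Tm.proj _).init hr.init.init
        ((pairMem hU hC (Tm.proj _).init (Tm.proj _) hr.init.init.init).imp
          (eq (Tm.proj _).init.init (Tm.proj _).init))))

theorem injects (hU : PairClosed U) (hC : C ⊆ U) (hs : Tm C s) (ht : Tm C t) :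
    Dfn U A C (fun v => Injects U (s v) (t v)) :=
  ex (R := fun v f => MapInto f (s v) (t v) ∧ InjectiveOn f (s v))
    ((mapInto hU hC hs.init ht.init (Tm.proj _)).and (injectiveOn hU hC hs.init (Tm.proj _)))

end Dfn

end Dfn

/-! ### Closure properties of transitive models -/

-- The bridge to the separation and replacement schemes, which speak of subsets definable in `(V,
-- ∈)`. Elements of `V` serve as parameters.
open FirstOrder in
theorem Dfn.definable {V : Set ZFSet.{u}} {n : ℕ} {P : (Fin n → ZFSet.{u}) → Prop}
    (h : Dfn V ∅ V P) :
    letI := memStructure (fun x y : {x : ZFSet.{u} // x ∈ V} => x.1 ∈ y.1)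
    (Set.univ : Set {x : ZFSet.{u} // x ∈ V}).Definable memLang
      {v : Fin n → {x : ZFSet.{u} // x ∈ V} | P (fun i => (v i).1)} := by
  let := memStructure (fun x y : {x : ZFSet.{u} // x ∈ V} => x.1 ∈ y.1)
  obtain ⟨P', h1, h2⟩ := h
  obtain ⟨φ, hφ⟩ := h1.exists_formula (L := memLang) (subset_refl V) MemRel.mem
    (fun x y => Iff.rfl) (Or.inr fun _ _ => id)
  rw [Set.definable_iff_exists_formula_sum]
  refine ⟨φ.toFormula.relabel (Sum.map (fun c => ⟨c, trivial⟩) id), ?_⟩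
  ext v
  rw [Set.mem_ofPred_eq, Set.mem_ofPred_eq, h2 _ fun i => (v i).2, ← hφ,
    Language.Formula.realize_relabel, Language.BoundedFormula.realize_toFormula]
  rfl

namespace IsTransitiveModel

variable {V : Set ZFSet.{u}}

theorem pairClosed (hV : IsTransitiveModel V) : PairClosed V := by
  refine ⟨hV.transitive, fun x hx y hy => ?_⟩
  obtain ⟨p, hp⟩ := hV.zfc.pairing ⟨x, hx⟩ ⟨y, hy⟩
  have : p.1 = {x, y} := by
    ext z
    rw [ZFSet.mem_pair]
    constructor
    · intro hz
      simpa [Subtype.ext_iff] using (hp ⟨z, hV.transitive _ p.2 _ hz⟩).1 hz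
    · rintro (rfl | rfl)
      · exact (hp ⟨_, hx⟩).2 (Or.inl rfl)
      · exact (hp ⟨_, hy⟩).2 (Or.inr rfl)
  exact this ▸ p.2

theorem sep (hV : IsTransitiveModel V) {P : ZFSet.{u} → Prop} {a : ZFSet.{u}} (ha : a ∈ V)
    (hP : Dfn V ∅ V fun v : Fin 1 → ZFSet.{u} => P (v 0)) : ZFSet.sep P a ∈ V := by
  obtain ⟨b, hb⟩ := hV.zfc.separation {x | P x.1} hP.definable ⟨a, ha⟩
  have : b.1 = ZFSet.sep P a := by
    ext z
    rw [ZFSet.mem_sep]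
    constructor
    · intro hz
      simpa using (hb ⟨z, hV.transitive _ b.2 _ hz⟩).1 hz
    · intro hz
      exact (hb ⟨z, hV.transitive _ ha _ hz.1⟩).2 hz
  exact this ▸ b.2

theorem exists_powerset (hV : IsTransitiveModel V) {a : ZFSet.{u}} (ha : a ∈ V) :
    ∃ p ∈ V, ∀ z, z ∈ p ↔ z ∈ V ∧ z ⊆ a := by
  obtain ⟨p, hp⟩ := hV.zfc.powerset ⟨a, ha⟩
  refine ⟨p.1, p.2, fun z => ⟨fun hz => ?_, fun ⟨hz, hza⟩ => ?_⟩⟩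
  · have hzV := hV.transitive _ p.2 _ hz
    exact ⟨hzV, fun w hw => (hp ⟨z, hzV⟩).1 hz ⟨w, hV.transitive _ hzV _ hw⟩ hw⟩
  · exact (hp ⟨z, hz⟩).2 fun w hw => hza hw

theorem sUnion (hV : IsTransitiveModel V) {a : ZFSet.{u}} (ha : a ∈ V) :
    (ZFSet.sUnion a) ∈ V := by
  obtain ⟨s, hs⟩ := hV.zfc.union ⟨a, ha⟩
  have : s.1 = ZFSet.sUnion a := by
    ext z
    rw [ZFSet.mem_sUnion]
    constructor
    · intro hz
      obtain ⟨y, h⟩ := (hs ⟨z, hV.transitive _ s.2 _ hz⟩).1 hz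
      exact ⟨y.1, h⟩
    · rintro ⟨y, hy, hz⟩
      have hyV := hV.transitive _ ha _ hy
      exact (hs ⟨z, hV.transitive _ hyV _ hz⟩).2 ⟨⟨y, hyV⟩, hy, hz⟩
  exact this ▸ s.2

theorem union (hV : IsTransitiveModel V) {a b : ZFSet.{u}} (ha : a ∈ V) (hb : b ∈ V) :
    a ∪ b ∈ V := by
  rw [← ZFSet.sUnion_pair]
  exact hV.sUnion (hV.pairClosed.upair a ha b hb)

theorem insert (hV : IsTransitiveModel V) {a b : ZFSet.{u}} (ha : a ∈ V) (hb : b ∈ V) :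
    Insert.insert a b ∈ V := by
  rw [ZFSet.insert_eq]
  exact hV.union (hV.pairClosed.singleton ha) hb

theorem replacement (hV : IsTransitiveModel V) {R : ZFSet.{u} → ZFSet.{u} → Prop} {a : ZFSet.{u}}
    (ha : a ∈ V) (hR : Dfn V ∅ V fun v : Fin 2 → ZFSet.{u} => R (v 0) (v 1))
    (h : ∀ x ∈ a, ∃ y ∈ V, R x y ∧ ∀ y' ∈ V, R x y' → y' = y) :
    ∃ b ∈ V, ∀ y, y ∈ b ↔ y ∈ V ∧ ∃ x ∈ a, R x y := by
  obtain ⟨b, hb⟩ := hV.zfc.replacement {p | R p.1.1 p.2.1} hR.definable ⟨a, ha⟩ (by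
    rintro ⟨x, hx⟩ hxa
    obtain ⟨y, hy, h1, h2⟩ := h x hxa
    exact ⟨⟨y, hy⟩, h1, fun y' h' => Subtype.ext (h2 _ y'.2 h')⟩)
  refine ⟨b.1, b.2, fun y => ⟨fun hy => ?_, fun ⟨hy, x, hx, h'⟩ => ?_⟩⟩
  · have hyV := hV.transitive _ b.2 _ hy
    obtain ⟨x, h1, h2⟩ := (hb ⟨y, hyV⟩).1 hy
    exact ⟨hyV, x.1, h1, h2⟩
  · exact (hb ⟨y, hy⟩).2 ⟨⟨x, hV.transitive _ ha _ hx⟩, hx, h'⟩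

theorem empty_mem (hV : IsTransitiveModel V) : ∅ ∈ V := by
  obtain ⟨w, ⟨e, _, he⟩, _⟩ := hV.zfc.infinity
  have : e.1 = ∅ := (ZFSet.eq_empty _).2 fun y hy => he ⟨y, hV.transitive _ e.2 _ hy⟩ hy
  exact this ▸ e.2

theorem prod (hV : IsTransitiveModel V) {a b : ZFSet.{u}} (ha : a ∈ V) (hb : b ∈ V) :
    ZFSet.prod a b ∈ V := by
  -- Kuratowski pairs of elements of `a ∪ b` lie in the double power set of `a ∪ b` as computed in
  -- `V`; the product is separated from it.
  obtain ⟨p, hp, hp'⟩ := hV.exists_powerset (hV.union ha hb)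
  obtain ⟨q, hq, hq'⟩ := hV.exists_powerset hp
  have hX := hV.pairClosed
  have : ZFSet.prod a b = ZFSet.sep (fun z => ∃ x ∈ a, ∃ y ∈ b, z = ZFSet.pair x y) q := by
    ext z
    rw [ZFSet.mem_prod, ZFSet.mem_sep]
    refine ⟨fun h => ⟨?_, h⟩, fun h => h.2⟩
    obtain ⟨x, hx, y, hy, rfl⟩ := h
    have hx' := hV.transitive _ ha _ hx
    have hy' := hV.transitive _ hb _ hy
    refine (hq' _).2 ⟨hX.pair hx' hy', fun t ht => (hp' _).2 ⟨hX.trans _ (hX.pair hx' hy') _ ht, ?_⟩⟩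
    rw [ZFSet.pair, ZFSet.mem_pair] at ht
    rcases ht with rfl | rfl
    · intro s hs
      rw [ZFSet.mem_singleton] at hs
      subst hs
      exact ZFSet.mem_union.2 (Or.inl hx)
    · intro s hs
      rcases ZFSet.mem_pair.1 hs with rfl | rfl
      · exact ZFSet.mem_union.2 (Or.inl hx)
      · exact ZFSet.mem_union.2 (Or.inr hy)
  rw [this]
  refine hV.sep hq ?_
  refine .exMem hX le_rfl (.const a ha) ?_
  refine .exMem hX le_rfl (.const b hb) ?_
  exact .eqPair hX le_rfl (.proj _) (.proj _) (.proj 0)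

/-- The axiom of infinity provides some inductive set containing ω. Inside it, ω is cut out by a
bounded formula: the ordinals that, together with all their elements, are zero or a successor. -/
theorem omegaSet_mem (hV : IsTransitiveModel V) : omegaSet ∈ V := by
  have hX := hV.pairClosed
  obtain ⟨w, ⟨e, hew, he⟩, hw⟩ := hV.zfc.infinity
  have he' : e.1 = ∅ := (ZFSet.eq_empty _).2 fun y hy => he ⟨y, hV.transitive _ e.2 _ hy⟩ hy
  have hsucc : ∀ x ∈ w.1, Insert.insert x x ∈ w.1 := by
    intro x hx
    have hxV := hV.transitive _ w.2 _ hx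
    obtain ⟨y, hy, h⟩ := hw ⟨x, hxV⟩ hx
    have : y.1 = Insert.insert x x := by
      ext z
      rw [ZFSet.mem_insert_iff]
      constructor
      · intro hz
        simpa [Subtype.ext_iff, or_comm] using (h ⟨z, hV.transitive _ y.2 _ hz⟩).1 hz
      · rintro (rfl | hz)
        · exact (h ⟨_, hxV⟩).2 (Or.inr rfl)
        · exact (h ⟨_, hV.transitive _ hxV _ hz⟩).2 (Or.inl hz)
    exact this ▸ hy
  have hsub : ∀ x ∈ (omegaSet : ZFSet.{u}), x ∈ w.1 :=
    omegaSet_induction (he' ▸ hew) fun x _ hx => hsucc x hx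
  have : (omegaSet : ZFSet.{u}) = ZFSet.sep (fun x => x.IsOrdinal ∧
      (x = ∅ ∨ ∃ y ∈ x, x = Insert.insert y y) ∧
        ∀ z ∈ x, z = ∅ ∨ ∃ y ∈ z, z = Insert.insert y y) w.1 := by
    ext x
    rw [ZFSet.mem_sep]
    constructor
    · intro h
      have hp := (eq_omegaSet_iff.1 (Eq.refl (omegaSet : ZFSet.{u}))).2
      exact ⟨hsub x h, isOrdinal_omegaSet.mem h, hp x h, fun z hz =>
        hp z (isOrdinal_omegaSet.mem_trans hz h)⟩
    · rintro ⟨-, h1, h2, h3⟩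
      have : ∀ z, z ∈ x → z ∈ (omegaSet : ZFSet.{u}) := by
        intro z
        induction z using ZFSet.inductionOn with
        | _ z ih =>
          intro hz
          rcases h3 z hz with rfl | ⟨y, hy, rfl⟩
          · exact empty_mem_omegaSet
          · exact insert_mem_omegaSet (ih y hy (h1.mem_trans hy hz))
      rcases h2 with rfl | ⟨y, hy, rfl⟩
      · exact empty_mem_omegaSet
      · exact insert_mem_omegaSet (this y hy)
  rw [this]
  refine hV.sep w.2 ?_
  have hZ : ∀ {n : ℕ} {s : (Fin n → ZFSet.{u}) → ZFSet.{u}}, Tm V s →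
      Dfn V ∅ V fun v => s v = ∅ ∨ ∃ y ∈ s v, s v = Insert.insert y y := fun hs =>
    (Dfn.eq hs (.const ∅ hV.empty_mem)).or
      (.exMem hX le_rfl hs (.eqInsert hX le_rfl (.proj _) (.proj _) hs.init))
  exact (Dfn.isOrdinal hX le_rfl (.proj 0)).and ((hZ (.proj 0)).and
    (.allMem hX le_rfl (.proj 0) (hZ (.proj _))))

end IsTransitiveModel

/-! ### Enumerating wellordered sets by ordinals -/

/-- `h` enumerates, along an ordinal, an initial segment of the set `C` wellordered by `d`. -/
def Enumerates (V : Set ZFSet.{u}) (d C h : ZFSet.{u}) : Prop :=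
  ∀ γ ∈ V, ∀ y ∈ V, ZFSet.pair γ y ∈ h → γ.IsOrdinal ∧ (∀ β ∈ γ, ∃ y' ∈ V, ZFSet.pair β y' ∈ h) ∧
    y ∈ C ∧ (∀ β ∈ γ, ZFSet.pair β y ∉ h) ∧
    ∀ y' ∈ C, (∀ β ∈ γ, ZFSet.pair β y' ∉ h) → y' = y ∨ ZFSet.pair y y' ∈ d

theorem WellorderIn.asymm {V : Set ZFSet.{u}} {d H x y : ZFSet.{u}} (hd : WellorderIn V d H)
    (hx : x ∈ H) (hy : y ∈ H) (h : ZFSet.pair x y ∈ d) : ZFSet.pair y x ∉ d :=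
  fun h' => hd.irrefl x hx (hd.trans x hx y hy x hx h h')

/-- By ∈-induction on the index: both enumerations agree below γ, and each one takes at γ the
`d`-least element of `C` that has not yet occurred. -/
theorem Enumerates.unique {V : Set ZFSet.{u}} (hX : PairClosed V) {d H C h h' : ZFSet.{u}}
    (hd : WellorderIn V d H) (hCH : C ⊆ H) (hh : h ∈ V) (hh' : h' ∈ V)
    (h1 : Enumerates V d C h) (h2 : Enumerates V d C h') {γ : ZFSet.{u}} :
    ∀ {y y' : ZFSet.{u}}, ZFSet.pair γ y ∈ h → ZFSet.pair γ y' ∈ h' → y = y' := by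
  induction γ using ZFSet.inductionOn with
  | _ γ ih =>
    intro y y' hy hy'
    obtain ⟨hγ, hyV⟩ := hX.of_pair_mem hh hy
    have hyV' := (hX.of_pair_mem hh' hy').2
    obtain ⟨-, a2, a3, a4, a5⟩ := h1 γ hγ y hyV hy
    obtain ⟨-, b2, b3, b4, b5⟩ := h2 γ hγ y' hyV' hy'
    have key : ∀ β ∈ γ, ∀ z, ZFSet.pair β z ∈ h ↔ ZFSet.pair β z ∈ h' := by
      intro β hβ z
      constructor
      · intro hz
        obtain ⟨z', -, hz'⟩ := b2 β hβ
        rwa [ih β hβ hz hz']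
      · intro hz
        obtain ⟨z', -, hz'⟩ := a2 β hβ
        rwa [← ih β hβ hz' hz]
    have c1 := b5 y a3 fun β hβ => by rw [← key β hβ]; exact a4 β hβ
    have c2 := a5 y' b3 fun β hβ => by rw [key β hβ]; exact b4 β hβ
    rcases c1 with c1 | c1
    · exact c1
    rcases c2 with c2 | c2
    · exact c2.symm
    exact (hd.asymm (hCH a3) (hCH b3) c2 c1).elim

theorem dfn_enumerates {V : Set ZFSet.{u}} (hX : PairClosed V) {d C : ZFSet.{u}} (hd : d ∈ V)
    (hC : C ∈ V) {n : ℕ} {s : (Fin n → ZFSet.{u}) → ZFSet.{u}} (hs : Tm V s) :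
    Dfn V ∅ V fun v => Enumerates V d C (s v) := by
  have hp : ∀ {n : ℕ} {s t : (Fin n → ZFSet.{u}) → ZFSet.{u}}, Tm V s → Tm V t →
      ∀ {r : (Fin n → ZFSet.{u}) → ZFSet.{u}}, Tm V r →
      Dfn V ∅ V fun v => ∀ β ∈ s v, ZFSet.pair β (t v) ∉ r v := fun hs ht _ hr =>
    .allMem hX le_rfl hs (.not (.pairMem hX le_rfl (.proj _) ht.init hr.init))
  refine .all (.all ?_)
  refine .imp (.pairMem hX le_rfl (Tm.proj _).init (.proj _) hs.init.init) ?_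
  refine .and (.isOrdinal hX le_rfl (Tm.proj _).init) (.and ?_ (.and ?_ (.and ?_ ?_)))
  · exact .allMem hX le_rfl (Tm.proj _).init
      (.ex (.pairMem hX le_rfl (Tm.proj _).init (.proj _) hs.init.init.init.init))
  · exact .mem (.proj _) (.const C hC)
  · exact hp (Tm.proj _).init (.proj _) hs.init.init
  · refine .allMem hX le_rfl (.const C hC) (.imp (hp (Tm.proj _).init.init (.proj _)
      hs.init.init.init) (.or (.eq (.proj _) (Tm.proj _).init)
        (.pairMem hX le_rfl (Tm.proj _).init (.proj _) (.const d hd))))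

/-- Transfinite recursion inside `V`. The union of all partial enumerations is a class function, and
its index set `b` is an ordinal. If some element of `C` were missed, attaching the least such
element at position `b` would be another partial enumeration, so that b ∈ b. -/
theorem IsTransitiveModel.exists_enumeration {V : Set ZFSet.{u}} (hV : IsTransitiveModel V)
    {d H C : ZFSet.{u}} (hd : WellorderIn V d H) (hdV : d ∈ V) (hC : C ∈ V) (hCH : C ⊆ H) :
    ∃ b ∈ V, ∃ e ∈ V, b.IsOrdinal ∧ MapInto e b C ∧ InjectiveOn e b ∧
      ∀ y ∈ C, ∃ γ ∈ b, ZFSet.pair γ y ∈ e := by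
  have hX := hV.pairClosed
  set U : ZFSet.{u} → ZFSet.{u} → Prop := fun γ y =>
    ∃ h ∈ V, Enumerates V d C h ∧ ZFSet.pair γ y ∈ h with hU
  have uniq : ∀ {γ y y'}, U γ y → U γ y' → y = y' := by
    rintro γ y y' ⟨h, hh, h1, h2⟩ ⟨h', hh', h1', h2'⟩
    exact Enumerates.unique hX hd hCH hh hh' h1 h1' h2 h2'
  have memV : ∀ {γ y}, U γ y → γ ∈ V ∧ y ∈ V := by
    rintro γ y ⟨h, hh, -, h2⟩
    exact hX.of_pair_mem hh h2
  have spec : ∀ {γ y}, U γ y → γ.IsOrdinal ∧ (∀ β ∈ γ, ∃ y', U β y') ∧ y ∈ C ∧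
      (∀ β ∈ γ, ¬ U β y) ∧ ∀ y' ∈ C, (∀ β ∈ γ, ¬ U β y') → y' = y ∨ ZFSet.pair y y' ∈ d := by
    intro γ y hγ
    obtain ⟨h, hh, h1, h2⟩ := hγ
    obtain ⟨hγV, hyV⟩ := hX.of_pair_mem hh h2
    obtain ⟨a1, a2, a3, a4, a5⟩ := h1 γ hγV y hyV h2
    have key : ∀ β ∈ γ, ∀ z, U β z ↔ ZFSet.pair β z ∈ h := by
      intro β hβ z
      refine ⟨fun hz => ?_, fun hz => ⟨h, hh, h1, hz⟩⟩
      obtain ⟨z', -, hz'⟩ := a2 β hβ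
      rwa [uniq hz ⟨h, hh, h1, hz'⟩]
    refine ⟨a1, fun β hβ => ?_, a3, fun β hβ => ?_, fun y' hy' h' => ?_⟩
    · obtain ⟨z', -, hz'⟩ := a2 β hβ
      exact ⟨z', h, hh, h1, hz'⟩
    · rw [key β hβ]; exact a4 β hβ
    · exact a5 y' hy' fun β hβ => by rw [← key β hβ]; exact h' β hβ
  have inj : ∀ {γ γ' y}, U γ y → U γ' y → γ = γ' := by
    intro γ γ' y h h'
    rcases (spec h).1.mem_trichotomous (spec h').1 with h1 | h1 | h1
    · exact ((spec h').2.2.2.1 _ h1 h).elim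
    · exact h1
    · exact ((spec h).2.2.2.1 _ h1 h').elim
  have hUd : ∀ {n : ℕ} {s t : (Fin n → ZFSet.{u}) → ZFSet.{u}}, Tm V s → Tm V t →
      Dfn V ∅ V fun v => U (s v) (t v) := fun hs ht =>
    .ex (.and (dfn_enumerates hX hdV hC (.proj _))
      (.pairMem hX le_rfl hs.init ht.init (.proj _)))
  have hC' : ZFSet.sep (fun y => ∃ γ ∈ V, U γ y) C ∈ V :=
    hV.sep hC (.ex (hUd (.proj _) (Tm.proj 0).init))
  -- Replacement is applied from values to indices: the enumerated elements form a subset of `C`,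
  -- hence a set, and each has only one index.
  obtain ⟨b, hb, hb'⟩ := hV.replacement (R := fun y γ => U γ y) hC' (hUd (.proj 1) (.proj 0)) (by
    intro y hy
    obtain ⟨-, γ, hγ, h⟩ := ZFSet.mem_sep.1 hy
    exact ⟨γ, hγ, h, fun γ' _ h' => inj h' h⟩)
  have hb'' : ∀ γ, γ ∈ b ↔ ∃ y, U γ y := by
    intro γ
    rw [hb']
    constructor
    · rintro ⟨-, y, -, h⟩; exact ⟨y, h⟩
    · rintro ⟨y, h⟩
      exact ⟨(memV h).1, y, ZFSet.mem_sep.2 ⟨(spec h).2.2.1, γ, (memV h).1, h⟩, h⟩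
  have hbo : b.IsOrdinal := by
    rw [ZFSet.isOrdinal_iff_forall_mem_isTransitive]
    refine ⟨fun γ hγ β hβ => ?_, fun γ hγ => ?_⟩
    · obtain ⟨y, h⟩ := (hb'' γ).1 hγ
      exact (hb'' β).2 ((spec h).2.1 β hβ)
    · obtain ⟨y, h⟩ := (hb'' γ).1 hγ
      exact (spec h).1.isTransitive
  set e := ZFSet.sep (fun p => ∃ γ ∈ b, ∃ y ∈ C, p = ZFSet.pair γ y ∧ U γ y) (ZFSet.prod b C)
    with he_def
  have heV : e ∈ V := by
    refine hV.sep (hV.prod hb hC) (.exMem hX le_rfl (.const b hb) (.exMem hX le_rfl (.const C hC)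
      (.and (.eqPair hX le_rfl (Tm.proj _).init (.proj _) (Tm.proj 0).init.init)
        (hUd (Tm.proj _).init (.proj _)))))
  have he : ∀ γ y, ZFSet.pair γ y ∈ e ↔ U γ y := by
    intro γ y
    rw [he_def, ZFSet.mem_sep]
    constructor
    · rintro ⟨-, γ', -, y', -, h, h'⟩
      obtain ⟨rfl, rfl⟩ := ZFSet.pair_inj.1 h
      exact h'
    · intro h
      have h1 := (hb'' γ).2 ⟨y, h⟩
      have h2 := (spec h).2.2.1
      exact ⟨ZFSet.pair_mem_prod.2 ⟨h1, h2⟩, γ, h1, y, h2, rfl, h⟩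
  refine ⟨b, hb, e, heV, hbo, fun γ hγ => ?_, fun γ _ γ' _ y h h' => ?_, ?_⟩
  · obtain ⟨y, h⟩ := (hb'' γ).1 hγ
    exact ⟨y, (spec h).2.2.1, fun y' => by
      rw [he]; exact ⟨fun h' => uniq h' h, fun h' => h' ▸ h⟩⟩
  · rw [he] at h h'
    exact inj h h'
  · by_contra hcon
    have hs : ZFSet.sep (fun y => ∀ γ ∈ b, ZFSet.pair γ y ∉ e) C ∈ V :=
      hV.sep hC (.allMem hX le_rfl (.const b hb)
        (.not (.pairMem hX le_rfl (.proj _) (Tm.proj 0).init (.const e heV))))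
    obtain ⟨m, hm, hmin⟩ := hd.min _ hs (fun y hy => hCH (ZFSet.mem_sep.1 hy).1) (by
      push Not at hcon
      obtain ⟨y, hy, h⟩ := hcon
      intro h0
      exact ZFSet.notMem_empty y (h0 ▸ ZFSet.mem_sep.2 ⟨hy, h⟩))
    obtain ⟨hmC, hm'⟩ := ZFSet.mem_sep.1 hm
    have hmV := hV.transitive _ hC _ hmC
    -- The enumeration that is longer by one step, with the least missing element at position `b`.
    have he' : Insert.insert (ZFSet.pair b m) e ∈ V := hV.insert (hX.pair hb hmV) heV
    have hin : ∀ γ y, ZFSet.pair γ y ∈ Insert.insert (ZFSet.pair b m) e ↔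
        (γ = b ∧ y = m) ∨ U γ y := by
      intro γ y
      rw [ZFSet.mem_insert_iff, ZFSet.pair_inj, he]
    have hlt : ∀ {γ β y}, (γ = b ∨ ∃ z, U γ z) → β ∈ γ →
        (ZFSet.pair β y ∈ Insert.insert (ZFSet.pair b m) e ↔ U β y) := by
      intro γ β y h hβ
      rw [hin]
      refine or_iff_right ?_
      rintro ⟨rfl, -⟩
      rcases h with rfl | h
      · exact ZFSet.mem_irrefl _ hβ
      · exact ZFSet.mem_irrefl β (hbo.mem_trans hβ ((hb'' γ).2 h))
    have hen : Enumerates V d C (Insert.insert (ZFSet.pair b m) e) := by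
      intro γ hγ y hy hp
      rcases (hin γ y).1 hp with ⟨rfl, rfl⟩ | h
      · refine ⟨hbo, fun β hβ => ?_, hmC, fun β hβ => ?_, fun y' hy' h' => ?_⟩
        · obtain ⟨y', h⟩ := (hb'' β).1 hβ
          exact ⟨y', (memV h).2, (hlt (Or.inl rfl) hβ).2 h⟩
        · rw [hlt (Or.inl rfl) hβ, ← he]
          exact hm' β hβ
        · refine (hmin y' (ZFSet.mem_sep.2 ⟨hy', fun β hβ => ?_⟩)).imp_left Eq.symm
          rw [he, ← hlt (Or.inl rfl) hβ]
          exact h' β hβ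
      · obtain ⟨a1, a2, a3, a4, a5⟩ := spec h
        refine ⟨a1, fun β hβ => ?_, a3, fun β hβ => ?_, fun y' hy' h' => ?_⟩
        · obtain ⟨y', h'⟩ := a2 β hβ
          exact ⟨y', (memV h').2, (hlt (Or.inr ⟨_, h⟩) hβ).2 h'⟩
        · rw [hlt (Or.inr ⟨_, h⟩) hβ]
          exact a4 β hβ
        · refine a5 y' hy' fun β hβ => ?_
          rw [← hlt (Or.inr ⟨_, h⟩) hβ]
          exact h' β hβ
    have : U b m := ⟨_, he', hen, (hin _ _).2 (Or.inl ⟨rfl, rfl⟩)⟩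
    exact ZFSet.mem_irrefl b ((hb'' b).2 ⟨m, this⟩)

/-! ### The sets `H_θ` -/

/-! ### Graphs and injections inside a model -/

section Graph

variable {V : Set ZFSet.{u}}

theorem IsTransitiveModel.exists_graph (hV : IsTransitiveModel V) {a b : ZFSet.{u}} (ha : a ∈ V)
    (hb : b ∈ V) {R : ZFSet.{u} → ZFSet.{u} → Prop}
    (hR : Dfn V ∅ V fun v : Fin 2 → ZFSet.{u} => R (v 0) (v 1)) :
    ∃ f ∈ V, f ⊆ ZFSet.prod a b ∧ ∀ x y, ZFSet.pair x y ∈ f ↔ x ∈ a ∧ y ∈ b ∧ R x y := by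
  have hX := hV.pairClosed
  have hp := hV.prod ha hb
  refine ⟨ZFSet.sep (fun p => ∃ x ∈ V, ∃ y ∈ V, p = ZFSet.pair x y ∧ R x y) (ZFSet.prod a b),
    ?_, ?_, ?_⟩
  · refine hV.sep hp ?_
    refine .ex (.ex (.and (.eqPair hX le_rfl (Tm.proj _).init (.proj _) (Tm.proj 0).init.init) ?_))
    exact .subst₂ le_rfl hR (Tm.proj _).init (.proj _)
  · intro p hp
    exact (ZFSet.mem_sep.1 hp).1
  · intro x y
    rw [ZFSet.mem_sep, ZFSet.pair_mem_prod]
    constructor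
    · rintro ⟨⟨hx, hy⟩, x', -, y', -, h, h'⟩
      obtain ⟨rfl, rfl⟩ := ZFSet.pair_inj.1 h
      exact ⟨hx, hy, h'⟩
    · rintro ⟨hx, hy, h⟩
      exact ⟨⟨hx, hy⟩, x, hV.transitive _ ha _ hx, y, hV.transitive _ hb _ hy, rfl, h⟩

theorem IsTransitiveModel.injects (hV : IsTransitiveModel V) {a b : ZFSet.{u}} (ha : a ∈ V)
    (hb : b ∈ V) {R : ZFSet.{u} → ZFSet.{u} → Prop}
    (hR : Dfn V ∅ V fun v : Fin 2 → ZFSet.{u} => R (v 0) (v 1))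
    (h1 : ∀ x ∈ a, ∃ y ∈ b, R x y ∧ ∀ y' ∈ b, R x y' → y' = y)
    (h2 : ∀ x ∈ a, ∀ x' ∈ a, ∀ y ∈ b, R x y → R x' y → x = x') : Injects V a b := by
  obtain ⟨f, hf, -, hf'⟩ := hV.exists_graph ha hb hR
  refine ⟨f, hf, fun x hx => ?_, fun x hx x' hx' y hy hy' => ?_⟩
  · obtain ⟨y, hy, h, h'⟩ := h1 x hx
    refine ⟨y, hy, fun y' => ?_⟩
    rw [hf']
    exact ⟨fun H => h' y' H.2.1 H.2.2, fun H => H ▸ ⟨hx, hy, h⟩⟩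
  · rw [hf'] at hy hy'
    exact h2 x hx x' hx' y hy.2.1 hy.2.2 hy'.2.2

theorem MapInto.mono {f a b a' b' : ZFSet.{u}} (h : MapInto f a b) (ha : a' ⊆ a) (hb : b ⊆ b') :
    MapInto f a' b' := fun x hx => by
  obtain ⟨y, hy, h'⟩ := h x (ha hx)
  exact ⟨y, hb hy, h'⟩

theorem MapInto.mem {f a b x y : ZFSet.{u}} (h : MapInto f a b) (hx : x ∈ a)
    (hxy : ZFSet.pair x y ∈ f) : y ∈ b := by
  obtain ⟨z, hz, h'⟩ := h x hx
  rwa [(h' y).1 hxy]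

theorem MapInto.unique {f a b x y y' : ZFSet.{u}} (h : MapInto f a b) (hx : x ∈ a)
    (hxy : ZFSet.pair x y ∈ f) (hxy' : ZFSet.pair x y' ∈ f) : y = y' := by
  obtain ⟨z, hz, h'⟩ := h x hx
  rw [(h' y).1 hxy, (h' y').1 hxy']

theorem MapInto.exists {f a b x : ZFSet.{u}} (h : MapInto f a b) (hx : x ∈ a) :
    ∃ y ∈ b, ZFSet.pair x y ∈ f := by
  obtain ⟨z, hz, h'⟩ := h x hx
  exact ⟨z, hz, (h' z).2 rfl⟩

theorem Injects.mono {a b a' b' : ZFSet.{u}} (h : Injects V a b) (ha : a' ⊆ a) (hb : b ⊆ b') :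
    Injects V a' b' := by
  obtain ⟨f, hf, h1, h2⟩ := h
  exact ⟨f, hf, h1.mono ha hb, fun x hx x' hx' => h2 x (ha hx) x' (ha hx')⟩

theorem Injects.mono_class {W : Set ZFSet.{u}} {a b : ZFSet.{u}} (h : Injects V a b)
    (hVW : V ⊆ W) : Injects W a b := by
  obtain ⟨f, hf, h⟩ := h
  exact ⟨f, hVW hf, h⟩

end Graph

/-! ### Closure properties of H_θ -/

/-- `H = H_θ` in the sense of the transitive model `V`, where `θ > ω` is regular, and `d` is a
wellorder of `H` in `V`. -/
structure IsHier (V : Set ZFSet.{u}) (θ H d : ZFSet.{u}) : Prop where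
  model : IsTransitiveModel V
  theta_mem : θ ∈ V
  hier_mem : H ∈ V
  order_mem : d ∈ V
  omega_mem : omegaSet ∈ θ
  regular : RegularIn V θ
  mem_iff : ∀ x, x ∈ H ↔ x ∈ V ∧ ∃ c ∈ V, c.IsTransitive ∧ x ⊆ c ∧ ∃ a ∈ θ, Injects V c a
  wellorder : WellorderIn V d H

namespace IsHier

variable {V : Set ZFSet.{u}} {θ H d : ZFSet.{u}}

theorem isTransitive (h : IsHier V θ H d) : H.IsTransitive := by
  intro x hx y hy
  obtain ⟨hxV, c, hc, hct, hxc, hca⟩ := (h.mem_iff x).1 hx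
  exact (h.mem_iff y).2 ⟨h.model.transitive _ hxV _ hy, c, hc, hct, hct y (hxc hy), hca⟩

theorem subset_mem (h : IsHier V θ H d) {x y : ZFSet.{u}} (hx : x ∈ H) (hy : y ∈ V)
    (hyx : y ⊆ x) : y ∈ H := by
  obtain ⟨hxV, c, hc, hct, hxc, hca⟩ := (h.mem_iff x).1 hx
  exact (h.mem_iff y).2 ⟨hy, c, hc, hct, fun z hz => hxc (hyx hz), hca⟩

theorem mem_class (h : IsHier V θ H d) {x : ZFSet.{u}} (hx : x ∈ H) : x ∈ V :=
  h.model.transitive _ h.hier_mem _ hx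

theorem empty_mem_theta (h : IsHier V θ H d) : ∅ ∈ θ :=
  h.regular.1.1.mem_trans empty_mem_omegaSet h.omega_mem

theorem succ_mem_theta (h : IsHier V θ H d) {a : ZFSet.{u}} (ha : a ∈ θ) : insert a a ∈ θ := by
  have ho := h.regular.1.1
  obtain ⟨z, hz, haz⟩ := h.regular.1.2.2 a ha
  refine (ZFSet.isOrdinal_succ (ho.mem ha)).mem_of_subset_of_mem ho (fun t ht => ?_) hz
  rcases ZFSet.mem_insert_iff.1 ht with rfl | ht
  · exact haz
  · exact (ho.mem hz).mem_trans ht haz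

theorem theta_subset (h : IsHier V θ H d) {a : ZFSet.{u}} (ha : a ∈ θ) : a ∈ H := by
  have haV := h.model.transitive _ h.theta_mem _ ha
  refine (h.mem_iff a).2 ⟨haV, a, haV, (h.regular.1.1.mem ha).isTransitive, fun _ => id, a, ha, ?_⟩
  refine h.model.injects haV haV (R := fun x y => x = y) (.eq (.proj 0) (.proj 1)) ?_ ?_
  · exact fun x hx => ⟨x, hx, rfl, fun _ _ => Eq.symm⟩
  · rintro x _ x' _ y _ rfl rfl; rfl

/-- Regularity speaks of total functions on elements of θ. A definable partial function on a small
set is turned into one of these by moving its domain into some `b ∈ θ` along an injection. -/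
theorem bounded (h : IsHier V θ H d) {X : ZFSet.{u}} (hX : X ∈ V)
    (hsm : ∃ b ∈ θ, Injects V X b) {R : ZFSet.{u} → ZFSet.{u} → Prop}
    (hR : Dfn V ∅ V fun v : Fin 2 → ZFSet.{u} => R (v 0) (v 1))
    (hf : ∀ x ∈ X, ∀ γ ∈ θ, ∀ γ' ∈ θ, R x γ → R x γ' → γ = γ') :
    ∃ b ∈ θ, ∀ x ∈ X, ∀ γ ∈ θ, R x γ → γ ∈ b := by
  have hP := h.model.pairClosed
  obtain ⟨b, hb, k, hk, k1, k2⟩ := hsm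
  have hbV := h.model.transitive _ h.theta_mem _ hb
  have hT : ∀ {n : ℕ} {s t : (Fin n → ZFSet.{u}) → ZFSet.{u}}, Tm V s → Tm V t →
      Dfn V ∅ V fun v => ∃ x ∈ X, ZFSet.pair x (s v) ∈ k ∧ R x (t v) := fun hs ht =>
    .exMem hP le_rfl (.const X hX) (.and (.pairMem hP le_rfl (.proj _) hs.init (.const k hk))
      (.subst₂ le_rfl hR (.proj _) ht.init))
  obtain ⟨f, hfV, -, hf'⟩ := h.model.exists_graph hbV h.theta_mem
    -- Indices to which no value is assigned get the default value ∅, which makes the function total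
    -- and is harmless for bounds.
    (R := fun β γ => (∃ x ∈ X, ZFSet.pair x β ∈ k ∧ R x γ) ∨
      ((∀ γ' ∈ θ, ¬ ∃ x ∈ X, ZFSet.pair x β ∈ k ∧ R x γ') ∧ γ = ∅))
    (.or (hT (.proj 0) (.proj 1)) (.and
      (.allMem hP le_rfl (.const θ h.theta_mem) (.not (hT (Tm.proj 0).init (.proj _))))
        (.eq (.proj 1) (.const ∅ h.model.empty_mem))))
  obtain ⟨c, hc, hc'⟩ := h.regular.2 b hb f hfV (by
    intro β hβ
    by_cases H : ∃ γ ∈ θ, ∃ x ∈ X, ZFSet.pair x β ∈ k ∧ R x γ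
    · obtain ⟨γ, hγ, x, hx, hxk, hxR⟩ := H
      refine ⟨γ, hγ, fun γ' => ?_⟩
      rw [hf']
      constructor
      · rintro ⟨-, hγ', ⟨x', hx', hxk', hxR'⟩ | ⟨h1, -⟩⟩
        · obtain rfl := k2 x hx x' hx' β hxk hxk'
          exact hf x hx γ' hγ' γ hγ hxR' hxR
        · exact (h1 γ hγ ⟨x, hx, hxk, hxR⟩).elim
      · rintro rfl
        exact ⟨hβ, hγ, Or.inl ⟨x, hx, hxk, hxR⟩⟩
    · push Not at H
      refine ⟨∅, h.empty_mem_theta, fun γ' => ?_⟩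
      rw [hf']
      constructor
      · rintro ⟨-, hγ', ⟨x', hx', hxk', hxR'⟩ | ⟨-, h1⟩⟩
        · exact (H γ' hγ' x' hx' hxk' hxR').elim
        · exact h1
      · rintro rfl
        exact ⟨hβ, h.empty_mem_theta, Or.inr ⟨fun γ' hγ' ⟨x, hx, hx', hx''⟩ =>
          H γ' hγ' x hx hx' hx'', rfl⟩⟩)
  refine ⟨c, hc, fun x hx γ hγ hxγ => ?_⟩
  obtain ⟨β, hβ, hxβ⟩ := k1.exists hx
  exact hc' β hβ γ ((hf' _ _).2 ⟨hβ, hγ, Or.inl ⟨x, hx, hxβ, hxγ⟩⟩)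

/-- By definition `x` is a subset of a small transitive set. Adding the point `x` to it preserves
transitivity and costs one more ordinal, and θ is a limit. -/
theorem exists_transitive_mem (h : IsHier V θ H d) {x : ZFSet.{u}} (hx : x ∈ H) :
    ∃ c ∈ V, c.IsTransitive ∧ x ∈ c ∧ ∃ a ∈ θ, Injects V c a := by
  have hP := h.model.pairClosed
  obtain ⟨hxV, c, hc, hct, hxc, a, ha, k, hk, k1, k2⟩ := (h.mem_iff x).1 hx
  have haV := h.model.transitive _ h.theta_mem _ ha
  have hcV := h.model.insert hxV hc
  refine ⟨insert x c, hcV, ?_, by simp, insert a a, h.succ_mem_theta ha, ?_⟩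
  · intro y hy z hz
    rcases ZFSet.mem_insert_iff.1 hy with rfl | hy
    · exact ZFSet.mem_insert_iff.2 (Or.inr (hxc hz))
    · exact ZFSet.mem_insert_iff.2 (Or.inr (hct y hy hz))
  · refine h.model.injects hcV (h.model.insert haV haV)
      (R := fun y β => (y ∈ c ∧ ZFSet.pair y β ∈ k) ∨ (y ∉ c ∧ β = a))
      (.or (.and (.mem (.proj 0) (.const c hc))
        (.pairMem hP le_rfl (.proj 0) (.proj 1) (.const k hk)))
        (.and (.not (.mem (.proj 0) (.const c hc))) (.eq (.proj 1) (.const a haV)))) ?_ ?_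
    · intro y hy
      by_cases hyc : y ∈ c
      · obtain ⟨β, hβ, hyβ⟩ := k1.exists hyc
        refine ⟨β, ZFSet.mem_insert_of_mem _ hβ, Or.inl ⟨hyc, hyβ⟩, ?_⟩
        rintro β' - (⟨-, h'⟩ | ⟨h', -⟩)
        · exact k1.unique hyc h' hyβ
        · exact (h' hyc).elim
      · refine ⟨a, ZFSet.mem_insert _ _, Or.inr ⟨hyc, rfl⟩, ?_⟩
        rintro β' - (⟨h', -⟩ | ⟨-, h'⟩)
        · exact (hyc h').elim
        · exact h'
    · rintro y hy y' hy' β - (⟨h1, h2⟩ | ⟨h1, h2⟩) (⟨h3, h4⟩ | ⟨h3, h4⟩)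
      · exact k2 y h1 y' h3 β h2 h4
      · exact (ZFSet.mem_irrefl a (h4 ▸ k1.mem h1 h2)).elim
      · exact (ZFSet.mem_irrefl a (h2 ▸ k1.mem h3 h4)).elim
      · have e1 := (ZFSet.mem_insert_iff.1 hy).resolve_right h1
        have e2 := (ZFSet.mem_insert_iff.1 hy').resolve_right h3
        rw [e1, e2]

/-- The transitive closure of `X` is separated from `H` and enumerated by an ordinal. If that
ordinal is below θ, the closure is small. If not, regularity is used twice to bound all indices
below θ by a single ordinal below θ, which is impossible. -/
theorem mem_of_small (h : IsHier V θ H d) {X : ZFSet.{u}} (hX : X ∈ V) (hXH : X ⊆ H)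
    (hsm : ∃ b ∈ θ, Injects V X b) : X ∈ H := by
  have hP := h.model.pairClosed
  have ho := h.regular.1.1
  -- `T x z` says that `z` is in the transitive closure of `{x}`
  set T : ZFSet.{u} → ZFSet.{u} → Prop := fun x z => ∀ t ∈ V, t.IsTransitive → x ∈ t → z ∈ t
    with hT
  have hTd : ∀ {n : ℕ} {s t : (Fin n → ZFSet.{u}) → ZFSet.{u}}, Tm V s → Tm V t →
      Dfn V ∅ V fun v => T (s v) (t v) := fun hs ht =>
    .all (.imp (.isTransitive hP le_rfl (.proj _)) (.imp (.mem hs.init (.proj _))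
      (.mem ht.init (.proj _))))
  have hCV : ZFSet.sep (fun z => ∃ x ∈ X, T x z) H ∈ V :=
    h.model.sep h.hier_mem (.exMem hP le_rfl (.const X hX) (hTd (.proj _) (Tm.proj 0).init))
  have hCt : (ZFSet.sep (fun z => ∃ x ∈ X, T x z) H).IsTransitive := by
    intro z hz w hw
    obtain ⟨hzH, x, hx, hxz⟩ := ZFSet.mem_sep.1 hz
    exact ZFSet.mem_sep.2 ⟨h.isTransitive z hzH hw, x, hx, fun t ht htt hxt =>
      htt z (hxz t ht htt hxt) hw⟩
  have hXC : X ⊆ ZFSet.sep (fun z => ∃ x ∈ X, T x z) H := fun x hx =>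
    ZFSet.mem_sep.2 ⟨hXH hx, x, hx, fun t _ _ h => h⟩
  obtain ⟨b, hb, e, he, hbo, e1, e2, e3⟩ := h.model.exists_enumeration h.wellorder h.order_mem
    hCV (fun z hz => (ZFSet.mem_sep.1 hz).1)
  rcases hbo.mem_or_subset ho with hbθ | hθb
  · refine (h.mem_iff X).2 ⟨hX, _, hCV, hCt, hXC, b, hbθ, ?_⟩
    refine h.model.injects hCV hb (R := fun y γ => ZFSet.pair γ y ∈ e)
      (.pairMem hP le_rfl (.proj 1) (.proj 0) (.const e he)) ?_ ?_
    · intro y hy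
      obtain ⟨γ, hγ, hγy⟩ := e3 y hy
      exact ⟨γ, hγ, hγy, fun γ' hγ' h' => e2 γ' hγ' γ hγ y h' hγy⟩
    · intro x hx x' hx' y hy h1 h2
      exact e1.unique hy h1 h2
  -- `S x c` says that `c` bounds the indices below θ of the elements in the transitive closure of
  -- {x}. Each `x` has a least such bound below θ, as its closure is small, and these least bounds
  -- are bounded in turn because `X` is small.
  · exfalso
    set S : ZFSet.{u} → ZFSet.{u} → Prop := fun x c =>
      ∀ γ ∈ θ, ∀ z, ZFSet.pair γ z ∈ e → T x z → γ ∈ c with hS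
    have hSd : ∀ {n : ℕ} {s t : (Fin n → ZFSet.{u}) → ZFSet.{u}}, Tm V s → Tm V t →
        Dfn V ∅ V fun v => S (s v) (t v) := fun hs ht =>
      .allMem hP le_rfl (.const θ h.theta_mem) (.allPair hP le_rfl (.proj _) (.const e he)
        (.imp (hTd hs.init.init (.proj _)) (.mem (Tm.proj _).init ht.init.init)))
    have hSex : ∀ x ∈ X, ∃ c ∈ θ, S x c ∧ ∀ c' ∈ c, ¬ S x c' := by
      intro x hx
      obtain ⟨t, ht, htt, hxt, hts⟩ := h.exists_transitive_mem (hXH hx)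
      obtain ⟨c, hc, hc'⟩ := h.bounded ht hts (R := fun z γ => ZFSet.pair γ z ∈ e)
        (.pairMem hP le_rfl (.proj 1) (.proj 0) (.const e he))
        fun z _ γ hγ γ' hγ' h1 h2 => e2 γ (hθb hγ) γ' (hθb hγ') z h1 h2
      have hSc : S x c := fun γ hγ z hz hxz => hc' z (hxz t ht htt hxt) γ hγ hz
      clear hc'
      induction c using ZFSet.inductionOn with
      | _ c ih =>
        by_cases H : ∃ c' ∈ c, S x c'
        · obtain ⟨c', hc', h'⟩ := H
          exact ih c' hc' (ho.mem_trans hc' hc) h'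
        · push Not at H
          exact ⟨c, hc, hSc, H⟩
    obtain ⟨c, hc, hc'⟩ := h.bounded hX hsm (R := fun x c => S x c ∧ ∀ c' ∈ c, ¬ S x c')
      (.and (hSd (.proj 0) (.proj 1)) (.allMem hP le_rfl (.proj 1)
        (.not (hSd (Tm.proj 0).init (.proj _))))) (by
      rintro x _ γ hγ γ' hγ' ⟨h1, h2⟩ ⟨h3, h4⟩
      rcases (ho.mem hγ).mem_trichotomous (ho.mem hγ') with h5 | h5 | h5
      · exact (h4 γ h5 h1).elim
      · exact h5
      · exact (h2 γ' h5 h3).elim)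
    -- The element with index `c` is in the closure of some {x}; so `c` is below the least bound for
    -- `x`, which is itself below `c`.
    obtain ⟨z, hz, hcz⟩ := e1.exists (hθb hc)
    obtain ⟨-, x, hx, hxz⟩ := ZFSet.mem_sep.1 hz
    obtain ⟨b', hb', hSb, hmin⟩ := hSex x hx
    have h1 := hc' x hx b' hb' ⟨hSb, hmin⟩
    have h2 := hSb c hc z hcz hxz
    exact ZFSet.mem_asymm h1 h2

theorem small_of_mem (h : IsHier V θ H d) {x : ZFSet.{u}} (hx : x ∈ H) :
    ∃ b ∈ θ, Injects V x b := by
  obtain ⟨hxV, c, hc, hct, hxc, a, ha, hca⟩ := (h.mem_iff x).1 hx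
  exact ⟨a, ha, hca.mono hxc (fun _ => id)⟩

theorem finite_mem (h : IsHier V θ H d) {x : ZFSet.{u}} (hx : x ∈ V) (hxH : x ⊆ H)
    (hf : FinIn V x) : x ∈ H := by
  obtain ⟨n, hn, hxn⟩ := hf
  exact h.mem_of_small hx hxH ⟨n, h.regular.1.1.mem_trans hn h.omega_mem, hxn⟩

theorem finIn_upair (hV : IsTransitiveModel V) {x y : ZFSet.{u}} (hx : x ∈ V) (hy : y ∈ V) :
    FinIn V {x, y} := by
  have h0 := hV.empty_mem
  have h1 := hV.insert h0 h0
  have h01 : ∅ ≠ (insert ∅ ∅ : ZFSet.{u}) := fun h =>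
    ZFSet.notMem_empty ∅ (by have := ZFSet.mem_insert (∅ : ZFSet.{u}) ∅; rwa [← h] at this)
  refine ⟨insert (insert ∅ ∅) (insert ∅ ∅), insert_mem_omegaSet (insert_mem_omegaSet
    empty_mem_omegaSet), ?_⟩
  refine hV.injects (hV.pairClosed.upair x hx y hy) (hV.insert h1 h1)
    (R := fun z β => (z = x ∧ β = ∅) ∨ (z ≠ x ∧ β = insert ∅ ∅))
    (.or (.and (.eq (.proj 0) (.const x hx)) (.eq (.proj 1) (.const ∅ h0)))
      (.and (.not (.eq (.proj 0) (.const x hx))) (.eq (.proj 1) (.const _ h1)))) ?_ ?_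
  · intro z hz
    by_cases hzx : z = x
    · refine ⟨∅, by simp, Or.inl ⟨hzx, rfl⟩, ?_⟩
      rintro y' - (⟨-, h⟩ | ⟨h, -⟩)
      · exact h
      · exact (h hzx).elim
    · refine ⟨insert ∅ ∅, by simp, Or.inr ⟨hzx, rfl⟩, ?_⟩
      rintro y' - (⟨h, -⟩ | ⟨-, h⟩)
      · exact (hzx h).elim
      · exact h
  · rintro z hz z' hz' β - (⟨h1, h2⟩ | ⟨h1, h2⟩) (⟨h3, h4⟩ | ⟨h3, h4⟩)
    · rw [h1, h3]
    · exact (h01 (h2.symm.trans h4)).elim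
    · exact (h01 (h4.symm.trans h2)).elim
    · rw [(ZFSet.mem_pair.1 hz).resolve_left h1, (ZFSet.mem_pair.1 hz').resolve_left h3]

theorem pairClosed (h : IsHier V θ H d) : PairClosed {x | x ∈ H} := by
  refine ⟨fun x hx y hy => h.isTransitive x hx hy, fun x hx y hy => ?_⟩
  have hx' := h.mem_class hx
  have hy' := h.mem_class hy
  refine h.finite_mem (h.model.pairClosed.upair x hx' y hy') ?_ (finIn_upair h.model hx' hy')
  intro z hz
  rcases ZFSet.mem_pair.1 hz with rfl | rfl
  · exact hx
  · exact hy

/-- A function is no larger than its domain: a pair in it is determined by its first coordinate. -/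
theorem function_mem (h : IsHier V θ H d) {a b f : ZFSet.{u}} (ha : a ∈ H) (hb : b ⊆ H)
    (hbV : b ∈ V) (hf : f ∈ V) (hfs : f ⊆ ZFSet.prod a b)
    (hfu : ∀ x ∈ a, ∀ y y', ZFSet.pair x y ∈ f → ZFSet.pair x y' ∈ f → y = y') : f ∈ H := by
  have hP := h.model.pairClosed
  obtain ⟨c, hc, k, hk, k1, k2⟩ := h.small_of_mem ha
  have haV := h.mem_class ha
  refine h.mem_of_small hf ?_ ⟨c, hc, ?_⟩
  · intro p hp
    obtain ⟨x, hx, y, hy, rfl⟩ := ZFSet.mem_prod.1 (hfs hp)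
    exact h.pairClosed.pair (h.isTransitive a ha hx) (hb hy)
  · refine h.model.injects hf (h.model.transitive _ h.theta_mem _ hc)
      (R := fun p β => ∃ x ∈ a, ∃ y ∈ b, p = ZFSet.pair x y ∧ ZFSet.pair x β ∈ k)
      (.exMem hP le_rfl (.const a haV) (.exMem hP le_rfl (.const b hbV)
        (.and (.eqPair hP le_rfl (Tm.proj _).init (.proj _) (Tm.proj 0).init.init)
          (.pairMem hP le_rfl (Tm.proj _).init (Tm.proj 1).init.init (.const k hk))))) ?_ ?_
    · intro p hp
      obtain ⟨x, hx, y, hy, rfl⟩ := ZFSet.mem_prod.1 (hfs hp)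
      obtain ⟨β, hβ, hxβ⟩ := k1.exists hx
      refine ⟨β, hβ, ⟨x, hx, y, hy, rfl, hxβ⟩, ?_⟩
      rintro β' - ⟨x', _, y', _, he, h'⟩
      obtain ⟨rfl, rfl⟩ := ZFSet.pair_inj.1 he
      exact k1.unique hx h' hxβ
    · rintro p hp p' hp' β - ⟨x, hx, y, hy, rfl, h1⟩ ⟨x', hx', y', hy', rfl, h2⟩
      obtain rfl := k2 x hx x' hx' β h1 h2
      rw [hfu x hx y y' hp hp']

/-- An injection in `V` may contain irrelevant elements that keep it out of `H`; its restriction to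
a × b is small and hence in `H`. This makes ω₁, ω₂, finiteness and countability absolute between `H`
and `V`. -/
theorem injects_iff (h : IsHier V θ H d) {a b : ZFSet.{u}} (ha : a ∈ H) (hb : b ∈ H) :
    Injects {x | x ∈ H} a b ↔ Injects V a b := by
  have hP := h.model.pairClosed
  refine ⟨fun h' => h'.mono_class fun x hx => h.mem_class hx, ?_⟩
  rintro ⟨f, hf, f1, f2⟩
  have haV := h.mem_class ha
  have hbV := h.mem_class hb
  obtain ⟨g, hg, hgs, hg'⟩ := h.model.exists_graph haV hbV
    (R := fun x y => ZFSet.pair x y ∈ f) (.pairMem hP le_rfl (.proj 0) (.proj 1) (.const f hf))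
  refine ⟨g, ?_, ?_, ?_⟩
  · refine h.function_mem ha (h.isTransitive b hb) hbV hg hgs fun x hx y y' h1 h2 => ?_
    exact f1.unique hx ((hg' _ _).1 h1).2.2 ((hg' _ _).1 h2).2.2
  · intro x hx
    obtain ⟨y, hy, hxy⟩ := f1 x hx
    refine ⟨y, hy, fun y' => ?_⟩
    rw [hg', ← hxy]
    exact ⟨fun h => h.2.2, fun h => ⟨hx, f1.mem hx h, h⟩⟩
  · intro x hx x' hx' y h1 h2
    exact f2 x hx x' hx' y ((hg' _ _).1 h1).2.2 ((hg' _ _).1 h2).2.2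

end IsHier

/-! ### Elementary submodels of `H_θ` -/

section Elementary

open FirstOrder

/-- The form in which elementarity is used throughout: a nonempty class definable over `H` with
parameters in `M` has an element in `M`. -/
theorem ElemSub.exists {M H : ZFSet.{u}} {A : Set ZFSet.{u}} (h : ElemSub M H A)
    {P : ZFSet.{u} → Prop}
    (hP : Dfn {x | x ∈ H} A {x | x ∈ M} fun v : Fin 1 → ZFSet.{u} => P (v 0))
    (hx : ∃ x ∈ H, P x) : ∃ x ∈ M, P x := by
  obtain ⟨hMH, N, hN⟩ := h
  let := expStructure H A
  obtain ⟨P', h1, h2⟩ := hP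
  obtain ⟨φ, hφ⟩ := StrictDfn.exists_formula (L := expLang) (inst := expStructure H A)
    (U := {x | x ∈ H}) (fun x hx => hMH hx)
    ExpRel.mem (fun x y => Iff.rfl) (Or.inl ⟨ExpRel.pred, fun x => Iff.rfl⟩) h1
  let w : {x // x ∈ {x | x ∈ M}} → N := fun c => ⟨⟨c.1, hMH c.2⟩, (hN _).2 c.2⟩
  obtain ⟨x, hxH, hxP⟩ := hx
  have e1 : φ.ex.Realize (N.subtype ∘ w) (N.subtype ∘ (default : Fin 0 → N)) := by
    rw [Language.BoundedFormula.realize_ex]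
    refine ⟨⟨x, hxH⟩, ?_⟩
    have : ∀ xs : Fin 1 → {x : ZFSet.{u} // x ∈ H}, xs 0 = ⟨x, hxH⟩ →
        φ.Realize (N.subtype ∘ w) xs := by
      intro xs hxs
      refine (hφ xs).2 ((h2 _ fun i => (xs i).2).1 ?_)
      change P (xs 0).1
      rw [hxs]; exact hxP
    exact this _ (by simp [Fin.snoc])
  rw [N.subtype.map_boundedFormula, Language.BoundedFormula.realize_ex] at e1
  obtain ⟨a, ha⟩ := e1
  rw [← N.subtype.map_boundedFormula] at ha
  refine ⟨a.1.1, (hN _).1 a.2, ?_⟩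
  have := (h2 _ (fun i => Subtype.prop _)).2 ((hφ _).1 ha)
  simpa [Fin.snoc] using this

/-- The converse translation, from formulas to definable predicates. The language has no function
symbols, so every term is a variable. -/
theorem exists_strictDfn {H : ZFSet.{u}} {A : Set ZFSet.{u}} {n : ℕ}
    (φ : expLang.BoundedFormula Empty n) :
    letI := expStructure H A
    ∃ P : (Fin n → ZFSet.{u}) → Prop, StrictDfn {x | x ∈ H} A ∅ P ∧
      ∀ xs : Fin n → {x : ZFSet.{u} // x ∈ H},
        φ.Realize default xs ↔ P (fun i => (xs i).1) := by
  let := expStructure H A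
  have tm : ∀ {n : ℕ} (t : expLang.Term (Empty ⊕ Fin n)), ∃ i, t = Language.Term.var (Sum.inr i) := by
    intro n t
    cases t with
    | var x =>
      rcases x with x | i
      · exact x.elim
      · exact ⟨i, rfl⟩
    | func f _ => exact nomatch f
  induction φ with
  | falsum => exact ⟨_, .false, fun xs => Iff.rfl⟩
  | equal t s =>
    obtain ⟨i, rfl⟩ := tm t
    obtain ⟨j, rfl⟩ := tm s
    refine ⟨_, .eq (.proj i) (.proj j), fun xs => ?_⟩
    exact Subtype.ext_iff
  | rel R ts =>
    cases R with
    | mem =>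
      obtain ⟨i, hi⟩ := tm (ts 0)
      obtain ⟨j, hj⟩ := tm (ts 1)
      refine ⟨_, .mem (.proj i) (.proj j), fun xs => ?_⟩
      have e : ts = ![Language.Term.var (Sum.inr i), Language.Term.var (Sum.inr j)] := by
        funext k
        match k with
        | 0 => exact hi
        | 1 => exact hj
      subst e
      exact Iff.rfl
    | pred =>
      obtain ⟨i, hi⟩ := tm (ts 0)
      refine ⟨_, .pred (.proj i), fun xs => ?_⟩
      have e : ts = ![Language.Term.var (Sum.inr i)] := by
        funext k
        match k with
        | 0 => exact hi
      subst e
      exact Iff.rfl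
  | imp _ _ ih1 ih2 =>
    obtain ⟨P, hP, hP'⟩ := ih1
    obtain ⟨Q, hQ, hQ'⟩ := ih2
    exact ⟨_, hP.imp hQ, fun xs => imp_congr (hP' xs) (hQ' xs)⟩
  | all _ ih =>
    obtain ⟨P, hP, hP'⟩ := ih
    refine ⟨_, hP.all, fun xs => ?_⟩
    rw [Language.BoundedFormula.realize_all]
    have key : ∀ a : {x : ZFSet.{u} // x ∈ H},
        (fun i => ((Fin.snoc xs a : Fin _ → {x : ZFSet.{u} // x ∈ H}) i).1) =
        (Fin.snoc (fun i => (xs i).1) a.1 : Fin _ → ZFSet.{u}) := by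
      intro a
      funext i
      refine Fin.lastCases ?_ (fun i => ?_) i <;> simp
    constructor
    · intro h x hx
      have := (hP' _).1 (h ⟨x, hx⟩)
      rwa [key] at this
    · intro h a
      rw [hP', key]
      exact h _ a.2

/-- The Tarski–Vaught criterion. -/
theorem ElemSub.of_exists {M H : ZFSet.{u}} {A : Set ZFSet.{u}} (hMH : M ⊆ H)
    (h : ∀ (n : ℕ) (P : (Fin (n + 1) → ZFSet.{u}) → Prop), StrictDfn {x | x ∈ H} A ∅ P →
      ∀ a : Fin n → ZFSet.{u}, (∀ i, a i ∈ M) → (∃ y ∈ H, P (Fin.snoc a y)) →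
        ∃ y ∈ M, P (Fin.snoc a y)) : ElemSub M H A := by
  refine ⟨hMH, ?_⟩
  let := expStructure H A
  let S : expLang.Substructure {x : ZFSet.{u} // x ∈ H} :=
    ⟨{x | x.1 ∈ M}, fun f => nomatch f⟩
  refine ⟨S.toElementarySubstructure ?_, fun x => Iff.rfl⟩
  intro n φ x a hφ
  obtain ⟨P, hP, hP'⟩ := exists_strictDfn (H := H) (A := A) φ
  have key : ∀ a : {x : ZFSet.{u} // x ∈ H},
      (fun i => ((Fin.snoc ((↑) ∘ x) a : Fin _ → {x : ZFSet.{u} // x ∈ H}) i).1) =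
      (Fin.snoc (fun i => (x i).1.1) a.1 : Fin _ → ZFSet.{u}) := by
    intro a
    funext i
    refine Fin.lastCases ?_ (fun i => ?_) i <;> simp
  rw [hP', key] at hφ
  obtain ⟨y, hy, h'⟩ := h n P hP (fun i => (x i).1.1) (fun i => (x i).2) ⟨a.1, a.2, hφ⟩
  refine ⟨⟨⟨y, hMH hy⟩, hy⟩, ?_⟩
  rw [hP', key]
  exact h'

end Elementary

/-- Bounding all quantifiers by the parameter `H` and replacing the predicate by membership in `d`
turns a formula over the set structure into one over `V`, so that separation in `V` applies to it.
-/
theorem StrictDfn.relativize {V : Set ZFSet.{u}} {H d : ZFSet.{u}} {C : Set ZFSet.{u}}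
    (hH : H ∈ V) (hd : d ∈ V) (hC : C ⊆ V) {n : ℕ} {P : (Fin n → ZFSet.{u}) → Prop}
    (hV : ∀ x ∈ H, x ∈ V) (h : StrictDfn {x | x ∈ H} {x | x ∈ d} C P) : Dfn V ∅ V P := by
  have tm : ∀ {n : ℕ} {s : (Fin n → ZFSet.{u}) → ZFSet.{u}}, Tm C s → Tm V s := by
    intro n s hs
    cases hs with
    | proj i => exact .proj i
    | const c h => exact .const c (hC h)
  induction h with
  | mem hs ht => exact .mem (tm hs) (tm ht)
  | eq hs ht => exact .eq (tm hs) (tm ht)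
  | pred hs => exact .mem (tm hs) (.const d hd)
  | imp _ _ ih1 ih2 => exact ih1.imp ih2
  | false => exact StrictDfn.false.dfn
  | @all n P _ ih =>
    refine (Dfn.all (R := fun v x => x ∈ H → P (Fin.snoc v x)) (.imp (.mem (.proj _) (.const H hH))
      ?_)).congr fun v _ => ⟨fun h x _ hx => h x hx, fun h x hx => h x (hV x hx) hx⟩
    simpa using ih

namespace Dfn

variable {U A C : Set ZFSet.{u}}

/-- Existential quantification over the values of finitely many functions. -/
theorem exVec (hU : PairClosed U) (hC : C ⊆ U) {k : ℕ} {s : (Fin k → ZFSet.{u}) → ZFSet.{u}}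
    (hs : Tm C s) : ∀ {n : ℕ} {f : Fin n → ZFSet.{u}}, (∀ i, f i ∈ C) →
    ∀ {Q : (Fin k → ZFSet.{u}) → (Fin n → ZFSet.{u}) → Prop},
    (Dfn U A C fun w : Fin (k + n) → ZFSet.{u} =>
      Q (fun i => w (Fin.castAdd n i)) (fun j => w (Fin.natAdd k j))) →
    Dfn U A C fun v => ∃ z : Fin n → ZFSet.{u}, (∀ i, ZFSet.pair (s v) (z i) ∈ f i) ∧ Q v z := by
  intro n
  induction n with
  | zero =>
    intro f _ Q hQ
    refine hQ.congr fun v _ => ⟨?_, fun h => ⟨_, fun i => i.elim0, h⟩⟩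
    rintro ⟨z, -, h⟩
    have : z = fun j => v (Fin.natAdd k j) := funext fun j => j.elim0
    rw [this] at h
    exact h
  | succ n ih =>
    intro f hf Q hQ
    refine (ih (f := fun i => f i.castSucc) (fun i => hf _)
      (Q := fun v z => ∃ y, ZFSet.pair (s v) y ∈ f (Fin.last n) ∧ Q v (Fin.snoc z y)) ?_).congr
      fun v _ => ?_
    · refine .exPair hU hC (s := fun w => s (fun i => w (Fin.castAdd n i)))
        (hs.subst fun i => .proj _) (.const _ (hf _)) ?_
      refine hQ.congr fun w _ => ?_
      refine iff_of_eq (congrArg₂ Q rfl ?_)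
      funext j
      refine Fin.lastCases ?_ (fun j => ?_) j
      · rw [Fin.snoc_last]; rfl
      · rw [Fin.snoc_castSucc]; rfl
    · constructor
      · rintro ⟨z, hz, h⟩
        refine ⟨fun i => z i.castSucc, fun i => hz _, z (Fin.last n), hz _, ?_⟩
        convert h using 1
        funext j
        refine Fin.lastCases ?_ (fun j => ?_) j
        · rw [Fin.snoc_last]
        · rw [Fin.snoc_castSucc]
      · rintro ⟨z, hz, y, hy, h⟩
        refine ⟨Fin.snoc z y, fun i => ?_, h⟩
        refine Fin.lastCases ?_ (fun j => ?_) i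
        · rw [Fin.snoc_last]; exact hy
        · rw [Fin.snoc_castSucc]; exact hz j

theorem mono {C' : Set ZFSet.{u}} (hCC : C ⊆ C') {n : ℕ} {P : (Fin n → ZFSet.{u}) → Prop}
    (h : Dfn U A C P) : Dfn U A C' P := by
  obtain ⟨P', h1, h2⟩ := h
  refine ⟨P', ?_, h2⟩
  have tm : ∀ {n : ℕ} {s : (Fin n → ZFSet.{u}) → ZFSet.{u}}, Tm C s → Tm C' s := by
    intro n s hs
    cases hs with
    | proj i => exact .proj i
    | const c h => exact .const c (hCC h)
  clear h2
  clear P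
  induction h1 with
  | mem hs ht => exact .mem (tm hs) (tm ht)
  | eq hs ht => exact .eq (tm hs) (tm ht)
  | pred hs => exact .pred (tm hs)
  | imp _ _ ih1 ih2 => exact ih1.imp ih2
  | false => exact .false
  | all _ ih => exact ih.all

theorem isEmpty (hU : PairClosed U) (hC : C ⊆ U) {n : ℕ} {s : (Fin n → ZFSet.{u}) → ZFSet.{u}}
    (hs : Tm C s) : Dfn U A C fun v => s v = ∅ :=
  (allMem (R := fun _ _ => False) hU hC hs StrictDfn.false.dfn).congr fun v _ => by
    rw [ZFSet.eq_empty]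

theorem eqOmega (hU : PairClosed U) (hC : C ⊆ U) {n : ℕ} {s : (Fin n → ZFSet.{u}) → ZFSet.{u}}
    (hs : Tm C s) : Dfn U A C fun v => s v = omegaSet := by
  refine Dfn.congr (.and (.and (.isOrdinal hU hC hs) (.and (.not (.isEmpty hU hC hs))
    (.allMem hU hC hs (.exMem hU hC hs.init (.mem (Tm.proj _).init (.proj _))))))
    (.allMem hU hC hs (.or (.isEmpty hU hC (.proj _)) (.exMem hU hC (.proj _)
      (.eqInsert hU hC (.proj _) (.proj _) (Tm.proj _).init))))) fun v _ => eq_omegaSet_iff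

end Dfn

/-! ### Functions from ω₂ to ω₁ and determined sets -/

/-- `f` is (exactly) a function from `a` to `b`. -/
def IsFun (f a b : ZFSet.{u}) : Prop :=
  (∀ p ∈ f, ∃ x ∈ a, ∃ y ∈ b, p = ZFSet.pair x y) ∧ MapInto f a b

theorem Dfn.isFun {U A C : Set ZFSet.{u}} (hU : PairClosed U) (hC : C ⊆ U) {n : ℕ}
    {s t r : (Fin n → ZFSet.{u}) → ZFSet.{u}} (hs : Tm C s) (ht : Tm C t) (hr : Tm C r) :
    Dfn U A C fun v => IsFun (r v) (s v) (t v) :=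
  .and (.allMem hU hC hr (.exMem hU hC hs.init (.exMem hU hC ht.init.init
    (.eqPair hU hC (Tm.proj _).init (.proj _) (Tm.proj _).init.init)))) (.mapInto hU hC hs ht hr)

theorem Dfn.finIn {U A C : Set ZFSet.{u}} (hU : PairClosed U) (hC : C ⊆ U) {n : ℕ}
    {s : (Fin n → ZFSet.{u}) → ZFSet.{u}} (hω : omegaSet ∈ C) (hs : Tm C s) :
    Dfn U A C fun v => FinIn U (s v) :=
  .exMem hU hC (.const _ hω) (.injects hU hC hs.init (.proj _))

/-- Any ordinal below `ω₂` all of whose values under functions `ω₂ → ω₁` in `x` are in `x`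
is itself in `x`. -/
def Determined (w₁ w₂ x : ZFSet.{u}) : Prop :=
  ∀ ζ ∈ w₂, (∀ f ∈ x, IsFun f w₂ w₁ → ∀ y, ZFSet.pair ζ y ∈ f → y ∈ x) → ζ ∈ x

theorem Dfn.determined {U A C : Set ZFSet.{u}} (hU : PairClosed U) (hC : C ⊆ U) {n : ℕ}
    {s : (Fin n → ZFSet.{u}) → ZFSet.{u}} {w₁ w₂ : ZFSet.{u}} (h₁ : w₁ ∈ C) (h₂ : w₂ ∈ C)
    (hs : Tm C s) : Dfn U A C fun v => Determined w₁ w₂ (s v) :=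
  .allMem hU hC (.const _ h₂) (.imp (.allMem hU hC hs.init (.imp
    (.isFun hU hC (.const _ h₂) (.const _ h₁) (.proj _))
    (.allPair hU hC (Tm.proj _).init (.proj _) (.mem (.proj _) hs.init.init.init))))
    (.mem (.proj _) hs.init))

/-! ### End extensions of countable elementary submodels -/

theorem IsOmega1.unique {V : Set ZFSet.{u}} {w w' : ZFSet.{u}} (h : IsOmega1 V w)
    (h' : IsOmega1 V w') : w = w' := by
  rcases h.1.mem_trichotomous h'.1 with h1 | h1 | h1
  · exact (h.2.1 (h'.2.2 _ h1)).elim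
  · exact h1
  · exact (h'.2.1 (h.2.2 _ h1)).elim

theorem IsOmega2.unique {V : Set ZFSet.{u}} {w₁ w w' : ZFSet.{u}} (h : IsOmega2 V w₁ w)
    (h' : IsOmega2 V w₁ w') : w = w' := by
  rcases h.1.mem_trichotomous h'.1 with h1 | h1 | h1
  · exact (h.2.1 (h'.2.2 _ h1)).elim
  · exact h1
  · exact (h'.2.1 (h.2.2 _ h1)).elim

/-- A set of `V` that is finite in the sense of `V` is finite. -/
theorem FinIn.finite {V : Set ZFSet.{u}} {x : ZFSet.{u}} (h : FinIn V x) :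
    {y | y ∈ x}.Finite := by
  obtain ⟨n, hn, f, -, f1, f2⟩ := h
  have hfin : ∀ n ∈ (omegaSet : ZFSet.{u}), {y | y ∈ n}.Finite := by
    refine omegaSet_induction ?_ ?_
    · simp
    · intro n _ ih
      have : {y | y ∈ insert n n} = insert n {y | y ∈ n} := by
        ext y; simp
      rw [this]
      exact ih.insert n
  choose! g hg hg' using fun y (hy : y ∈ x) => f1.exists hy
  refine Set.Finite.of_finite_image (f := g) ((hfin n hn).subset ?_) ?_
  · rintro _ ⟨y, hy, rfl⟩
    exact hg y hy
  · intro y hy y' hy' hyy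
    exact f2 y hy y' hy' (g y) (hg' y hy) (hyy ▸ hg' y' hy')

/-- Induction on the number of elements. It shows that an elementary submodel of `H` contains its
finite subsets as elements, so it can evaluate finitary operations at them. -/
theorem mem_of_finite_subset {M : Set ZFSet.{u}} (h0 : ∅ ∈ M)
    (hi : ∀ x ∈ M, ∀ y ∈ M, insert x y ∈ M) {x : ZFSet.{u}} (hx : {y | y ∈ x}.Finite)
    (hxM : ∀ y ∈ x, y ∈ M) : x ∈ M := by
  have key : ∀ s : Set ZFSet.{u}, s.Finite → s ⊆ M → ∃ x ∈ M, ∀ y, y ∈ x ↔ y ∈ s := by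
    intro s hs
    induction s, hs using Set.Finite.induction_on with
    | empty => exact fun _ => ⟨∅, h0, fun y => by simp⟩
    | @insert a s _ _ ih =>
      intro hsM
      obtain ⟨x, hx, hxs⟩ := ih fun y hy => hsM (Set.mem_insert_of_mem _ hy)
      exact ⟨insert a x, hi a (hsM (Set.mem_insert _ _)) x hx, fun y => by
        rw [ZFSet.mem_insert_iff, Set.mem_insert_iff, hxs]⟩
  obtain ⟨z, hz, hzx⟩ := key _ hx hxM
  have : z = x := ZFSet.ext hzx
  exact this ▸ hz

/-! ### The hull {f(ζ) : f ∈ M} -/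

section Hull

variable {V : Set ZFSet.{u}} {θ H d M : ZFSet.{u}}

/-- Functions definable over `H` from parameters in an elementary submodel belong to it. -/
theorem IsHier.exists_function (h : IsHier V θ H d) (hM : ElemSub M H {x | x ∈ d})
    {a : ZFSet.{u}} (ha : a ∈ M) {P : ZFSet.{u} → ZFSet.{u} → Prop}
    (hP : Dfn {x | x ∈ H} {x | x ∈ d} {x | x ∈ M} fun v : Fin 2 → ZFSet.{u} => P (v 0) (v 1))
    (hu : ∀ α ∈ a, ∃ y ∈ H, P α y ∧ ∀ y' ∈ H, P α y' → y' = y) :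
    ∃ g ∈ M, IsFun g a H ∧ ∀ α ∈ a, ∀ y ∈ H, ZFSet.pair α y ∈ g ↔ P α y := by
  have hMH : M ⊆ H := hM.1
  have hU := h.pairClosed
  have hC : {x | x ∈ M} ⊆ {x | x ∈ H} := fun x hx => hMH hx
  have haH := hMH ha
  have haV := h.mem_class haH
  obtain ⟨g, hgM, hg1, hg2⟩ : ∃ g ∈ M, (∀ p ∈ g, ∃ α ∈ a, ∃ y ∈ {x | x ∈ H}, p = ZFSet.pair α y) ∧
      ∀ α ∈ a, ∀ y ∈ {x | x ∈ H}, ZFSet.pair α y ∈ g ↔ P α y := by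
    refine hM.exists ?_ ?_
    · refine .and (.allMem hU hC (.proj 0) (.exMem hU hC (.const a ha) (.ex
        (.eqPair hU hC (Tm.proj _).init (.proj _) (Tm.proj _).init.init)))) ?_
      exact .allMem hU hC (.const a ha) (.all (.iff (.pairMem hU hC (Tm.proj _).init (.proj _)
        (Tm.proj 0).init.init) (.subst₂ hC hP (Tm.proj _).init (.proj _))))
    -- Existence of the function in `H`: its graph is separated in `V` after relativization, and it
    -- is in `H` since its domain is. Elementarity has moved the choice of the function into `M`.
    · obtain ⟨P', hP1, hP2⟩ := hP
      have hrel := hP1.relativize h.hier_mem h.order_mem (fun x hx => h.mem_class (hMH hx))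
        fun x => h.mem_class
      obtain ⟨g, hg, hgs, hg'⟩ := h.model.exists_graph haV h.hier_mem
        (R := fun x y => P' ![x, y]) (hrel.congr fun v _ => iff_of_eq <| congrArg _ <| by
          funext i
          match i with
          | 0 => rfl
          | 1 => rfl)
      have hPP : ∀ α ∈ a, ∀ y ∈ H, P α y ↔ P' ![α, y] := fun α hα y hy =>
        hP2 ![α, y] fun i => by
          match i with
          | 0 => exact h.isTransitive a haH hα
          | 1 => exact hy
      refine ⟨g, h.function_mem haH (fun _ => id) h.hier_mem hg hgs ?_, ?_, ?_⟩
      · intro α hα y y' h1 h2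
        obtain ⟨-, hy, h1⟩ := (hg' _ _).1 h1
        obtain ⟨-, hy', h2⟩ := (hg' _ _).1 h2
        obtain ⟨z, hz, -, hz'⟩ := hu α hα
        rw [hz' y hy ((hPP α hα y hy).2 h1), hz' y' hy' ((hPP α hα y' hy').2 h2)]
      · intro p hp
        exact ZFSet.mem_prod.1 (hgs hp)
      · intro α hα y hy
        rw [hg', hPP α hα y hy]
        exact ⟨fun h => h.2.2, fun h => ⟨hα, hy, h⟩⟩
  refine ⟨g, hgM, ⟨hg1, fun α hα => ?_⟩, hg2⟩
  obtain ⟨y, hy, hPy, hy'⟩ := hu α hα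
  refine ⟨y, hy, fun y' => ⟨fun hp => ?_, fun e => e ▸ (hg2 α hα y hy).2 hPy⟩⟩
  have hy'H := (hU.of_pair_mem (hMH hgM) hp).2
  exact hy' y' hy'H ((hg2 α hα y' hy'H).1 hp)

/-- The set of values at `ζ` of the functions in `M` with domain `a`. -/
noncomputable def valuesAt (H M a ζ : ZFSet.{u}) : ZFSet.{u} :=
  ZFSet.sep (fun y => ∃ f ∈ M, MapInto f a H ∧ ZFSet.pair ζ y ∈ f) H

theorem mem_valuesAt {H M a ζ y : ZFSet.{u}} :
    y ∈ valuesAt H M a ζ ↔ y ∈ H ∧ ∃ f ∈ M, MapInto f a H ∧ ZFSet.pair ζ y ∈ f :=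
  ZFSet.mem_sep

theorem IsHier.valuesAt_mem_class (h : IsHier V θ H d) (hM : M ∈ V) {a ζ : ZFSet.{u}}
    (ha : a ∈ V) (hζ : ζ ∈ V) : valuesAt H M a ζ ∈ V := by
  have hX := h.model.pairClosed
  exact h.model.sep h.hier_mem (.exMem hX le_rfl (.const M hM) (.and
    (.mapInto hX le_rfl (.const a ha) (.const H h.hier_mem) (.proj _))
    (.pairMem hX le_rfl (.const ζ hζ) (Tm.proj _).init (.proj _))))

/-- Constant functions with value in `M` belong to `M`. -/
theorem IsHier.subset_valuesAt (h : IsHier V θ H d) (hM : ElemSub M H {x | x ∈ d})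
    {a ζ : ZFSet.{u}} (ha : a ∈ M) (hζ : ζ ∈ a) : M ⊆ valuesAt H M a ζ := by
  intro x hx
  obtain ⟨g, hg, hgf, hg'⟩ := h.exists_function hM ha (P := fun _ y => y = x)
    (.eq (.proj 1) (.const x hx)) fun α _ => ⟨x, hM.1 hx, rfl, fun _ _ => id⟩
  exact mem_valuesAt.2 ⟨hM.1 hx, g, hg, hgf.2, (hg' ζ hζ x (hM.1 hx)).2 rfl⟩

/-- The identity function on `a` belongs to `M`. -/
theorem IsHier.mem_valuesAt_self (h : IsHier V θ H d) (hM : ElemSub M H {x | x ∈ d})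
    {a ζ : ZFSet.{u}} (ha : a ∈ M) (hζ : ζ ∈ a) : ζ ∈ valuesAt H M a ζ := by
  have haH := h.isTransitive a (hM.1 ha)
  obtain ⟨g, hg, hgf, hg'⟩ := h.exists_function hM ha (P := fun α y => y = α)
    (.eq (.proj 1) (.proj 0)) fun α hα => ⟨α, haH hα, rfl, fun _ _ => id⟩
  exact mem_valuesAt.2 ⟨haH hζ, g, hg, hgf.2, (hg' ζ hζ ζ (haH hζ)).2 rfl⟩

/-- The Tarski–Vaught test. Given parameters f₁(ζ), …, fₙ(ζ), the map sending α to the `d`-least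
witness for f₁(α), …, fₙ(α) is definable from parameters in `M`, so it is in `M`, and its value at ζ
is a witness in the hull. -/
theorem IsHier.elemSub_valuesAt (h : IsHier V θ H d) (hM : ElemSub M H {x | x ∈ d})
    {a ζ : ZFSet.{u}} (ha : a ∈ M) (hζ : ζ ∈ a) (h0 : ∅ ∈ H) :
    ElemSub (valuesAt H M a ζ) H {x | x ∈ d} := by
  have hMH : M ⊆ H := hM.1
  have hU := h.pairClosed
  have hC : {x | x ∈ M} ⊆ {x | x ∈ H} := fun x hx => hMH hx
  refine ElemSub.of_exists (fun y hy => (mem_valuesAt.1 hy).1) ?_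
  intro n P hP b hb hex
  choose hbH f hfM hfun hfb using fun i => mem_valuesAt.1 (hb i)
  set S : ZFSet.{u} → ZFSet.{u} → Prop := fun α y =>
    ∃ z : Fin n → ZFSet.{u}, (∀ i, ZFSet.pair α (z i) ∈ f i) ∧ P (Fin.snoc z y) with hS
  have hSd : Dfn {x | x ∈ H} {x | x ∈ d} {x | x ∈ M}
      fun v : Fin 2 → ZFSet.{u} => S (v 0) (v 1) := by
    refine .exVec hU hC (.proj 0) hfM (Q := fun v z => P (Fin.snoc z (v 1))) ?_
    have := (hP.dfn.mono (Set.empty_subset {x | x ∈ M})).subst hC (m := 2 + n)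
      (σ := Fin.snoc (fun j w => w (Fin.natAdd 2 j)) (fun w => w (Fin.castAdd n 1))) (fun i => by
        refine Fin.lastCases ?_ (fun i => ?_) i
        · rw [Fin.snoc_last]; exact .proj _
        · rw [Fin.snoc_castSucc]; exact .proj _)
    refine this.congr fun w _ => iff_of_eq (congrArg P ?_)
    funext i
    refine Fin.lastCases ?_ (fun i => ?_) i
    · rw [Fin.snoc_last, Fin.snoc_last]
    · rw [Fin.snoc_castSucc, Fin.snoc_castSucc]
  have hle : ∀ α ∈ a, (∃ y ∈ H, S α y) →
      ∃ y ∈ H, S α y ∧ ∀ y' ∈ H, S α y' → y = y' ∨ ZFSet.pair y y' ∈ d := by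
    rintro α hα ⟨y0, hy0, hSy0⟩
    have hαH := h.isTransitive a (hMH ha) hα
    obtain ⟨S', hS1, hS2⟩ := hSd
    have hrel := hS1.relativize h.hier_mem h.order_mem (fun x hx => h.mem_class (hMH hx))
      fun x => h.mem_class
    have hSS : ∀ y ∈ H, S α y ↔ S' ![α, y] := fun y hy =>
      hS2 ![α, y] fun i => by
        match i with
        | 0 => exact hαH
        | 1 => exact hy
    have hsV : ZFSet.sep (fun y => S' ![α, y]) H ∈ V := by
      refine h.model.sep h.hier_mem ?_
      refine Dfn.congr (hrel.subst le_rfl (m := 1) (σ := ![fun _ => α, fun v => v 0]) ?_) ?_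
      · intro i
        match i with
        | 0 => exact .const α (h.mem_class hαH)
        | 1 => exact .proj 0
      · intro v _
        refine iff_of_eq (congrArg S' ?_)
        funext i
        match i with
        | 0 => rfl
        | 1 => rfl
    obtain ⟨m, hm, hm'⟩ := h.wellorder.min _ hsV (fun y hy => (ZFSet.mem_sep.1 hy).1)
      (fun e => ZFSet.notMem_empty y0 (e ▸ ZFSet.mem_sep.2 ⟨hy0, (hSS y0 hy0).1 hSy0⟩))
    obtain ⟨hmH, hSm⟩ := ZFSet.mem_sep.1 hm
    exact ⟨m, hmH, (hSS m hmH).2 hSm, fun y' hy' hSy' =>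
      hm' y' (ZFSet.mem_sep.2 ⟨hy', (hSS y' hy').1 hSy'⟩)⟩
  -- Where no witness exists the function takes the value ∅, so that it is total on `a`.
  obtain ⟨g, hg, hgf, hg'⟩ := h.exists_function hM ha
    (P := fun α y => (S α y ∧ ∀ y' ∈ {x | x ∈ H}, S α y' → y = y' ∨ ZFSet.pair y y' ∈ {x | x ∈ d}) ∨
      ((∀ y' ∈ {x | x ∈ H}, ¬ S α y') ∧ y = ∅)) (by
      refine .or (.and hSd (.all (.imp (.subst₂ hC hSd (Tm.proj 0).init (.proj _))
        (.or (.eq (Tm.proj 1).init (.proj _)) (.pairPred hU hC (Tm.proj 1).init (.proj _))))))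
        (.and (.all (.not (.subst₂ hC hSd (Tm.proj 0).init (.proj _)))) (.isEmpty hU hC (.proj 1))))
    (by
      intro α hα
      by_cases hα' : ∃ y ∈ H, S α y
      · obtain ⟨y, hy, hSy, hmin⟩ := hle α hα hα'
        refine ⟨y, hy, Or.inl ⟨hSy, hmin⟩, ?_⟩
        rintro y' hy' (⟨h1, h2⟩ | ⟨h1, -⟩)
        · rcases h2 y hy hSy with h3 | h3
          · exact h3
          rcases hmin y' hy' h1 with h4 | h4
          · exact h4.symm
          exact (h.wellorder.asymm hy hy' h4 h3).elim
        · exact (h1 y hy hSy).elim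
      · push Not at hα'
        refine ⟨∅, h0, Or.inr ⟨hα', rfl⟩, ?_⟩
        rintro y' hy' (⟨h1, -⟩ | ⟨-, h1⟩)
        · exact (hα' y' hy' h1).elim
        · exact h1)
  obtain ⟨y, hy, hζy⟩ := hgf.2.exists hζ
  obtain ⟨y0, hy0, hPy0⟩ := hex
  rcases (hg' ζ hζ y hy).1 hζy with ⟨⟨z, hz, hPz⟩, -⟩ | ⟨h1, -⟩
  · refine ⟨y, mem_valuesAt.2 ⟨hy, g, hg, hgf.2, hζy⟩, ?_⟩
    -- The coordinates of `z` are values at ζ of the same functions, and so agree with the given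
    -- parameters.
    have : z = b := funext fun i => (hfun i).unique hζ (hz i) (hfb i)
    exact this ▸ hPz
  · exact (h1 y0 hy0 ⟨b, hfb, hPy0⟩).elim

end Hull

theorem IsTransitiveModel.injects_self {V : Set ZFSet.{u}} (hV : IsTransitiveModel V)
    {a b : ZFSet.{u}} (ha : a ∈ V) (hab : a ⊆ b) : Injects V a b := by
  refine Injects.mono (hV.injects ha ha (R := fun x y => x = y) (.eq (.proj 0) (.proj 1)) ?_ ?_)
    (fun _ => id) hab
  · exact fun x hx => ⟨x, hx, rfl, fun _ _ => Eq.symm⟩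
  · rintro x _ x' _ y _ rfl rfl; rfl

theorem IsOmega2.mem {V : Set ZFSet.{u}} (hV : IsTransitiveModel V) {w₁ w₂ : ZFSet.{u}}
    (h₁ : IsOmega1 V w₁) (h₂ : IsOmega2 V w₁ w₂) (hw : w₂ ∈ V) : w₁ ∈ w₂ := by
  rcases h₁.1.mem_or_subset h₂.1 with h | h
  · exact h
  · exact (h₂.2.1 (hV.injects_self hw h)).elim

theorem IsOmega1.omegaSet_mem {V : Set ZFSet.{u}} (hV : IsTransitiveModel V) {w₁ : ZFSet.{u}}
    (h₁ : IsOmega1 V w₁) (hw : w₁ ∈ V) : omegaSet ∈ w₁ := by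
  rcases isOrdinal_omegaSet.mem_or_subset h₁.1 with h | h
  · exact h
  · exact (h₁.2.1 (hV.injects_self hw h)).elim

theorem Dfn.finOp {U A C : Set ZFSet.{u}} (hU : PairClosed U) (hC : C ⊆ U) {n : ℕ}
    {s t : (Fin n → ZFSet.{u}) → ZFSet.{u}} (hω : omegaSet ∈ C) (hs : Tm C s) (ht : Tm C t) :
    Dfn U A C fun v => FinOp U (s v) (t v) := by
  have : Dfn U A C fun v => ∀ e ∈ U, e ⊆ t v → FinIn U e → ∃ y ∈ t v,
      ZFSet.pair e y ∈ s v ∧ ∀ y', ZFSet.pair e y' ∈ s v → y' = y := (.all (.imp (.isSub hU hC (.proj _) ht.init)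
    (.imp (.finIn hU hC hω (.proj _)) (.exMem hU hC ht.init (.and
      (.pairMem hU hC (Tm.proj _).init (.proj _) hs.init.init)
      (.allPair hU hC (Tm.proj _).init hs.init.init (.eq (.proj _) (Tm.proj _).init)))))))
  refine this.congr fun v _ => ?_
  refine forall₂_congr fun e _ => forall₂_congr fun _ _ => exists_congr fun y =>
    and_congr_right fun _ => ?_
  exact ⟨fun h => ⟨(h y).2 rfl, fun y' => (h y').1⟩, fun h y' => ⟨h.2 y', fun e => e ▸ h.1⟩⟩

theorem Dfn.closedIn {U A C : Set ZFSet.{u}} (hU : PairClosed U) (hC : C ⊆ U) {n : ℕ}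
    {s t : (Fin n → ZFSet.{u}) → ZFSet.{u}} (hω : omegaSet ∈ C) (hs : Tm C s) (ht : Tm C t) :
    Dfn U A C fun v => ClosedIn U (s v) (t v) :=
  .all (.imp (.isSub hU hC (.proj _) hs.init) (.imp (.finIn hU hC hω (.proj _))
    (.allPair hU hC (.proj _) ht.init (.mem (.proj _) hs.init.init))))

theorem Dfn.isOmega1 {U A C : Set ZFSet.{u}} (hU : PairClosed U) (hC : C ⊆ U) {n : ℕ}
    {s : (Fin n → ZFSet.{u}) → ZFSet.{u}} (hω : omegaSet ∈ C) (hs : Tm C s) :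
    Dfn U A C fun v => IsOmega1 U (s v) :=
  .and (.isOrdinal hU hC hs) (.and (.not (.injects hU hC hs (.const _ hω)))
    (.allMem hU hC hs (.injects hU hC (.proj _) (.const _ hω))))

theorem Dfn.isOmega2 {U A C : Set ZFSet.{u}} (hU : PairClosed U) (hC : C ⊆ U) {n : ℕ}
    {w₁ : ZFSet.{u}} {s : (Fin n → ZFSet.{u}) → ZFSet.{u}} (hw : w₁ ∈ C) (hs : Tm C s) :
    Dfn U A C fun v => IsOmega2 U w₁ (s v) :=
  .and (.isOrdinal hU hC hs) (.and (.not (.injects hU hC hs (.const _ hw)))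
    (.allMem hU hC hs (.injects hU hC (.proj _) (.const _ hw))))

/-! ### Countable ordinals and ordinals below ω₂ in elementary submodels -/

section

variable {V : Set ZFSet.{u}} {θ H d M w₁ w₂ : ZFSet.{u}}

theorem IsHier.isOmega1_iff (h : IsHier V θ H d) {w : ZFSet.{u}} (hw : w ∈ H) :
    IsOmega1 {x | x ∈ H} w ↔ IsOmega1 V w := by
  have hω := h.theta_subset h.omega_mem
  unfold IsOmega1
  rw [h.injects_iff hw hω]
  refine and_congr_right fun _ => and_congr_right fun _ => forall₂_congr fun x hx => ?_
  exact h.injects_iff (h.isTransitive w hw hx) hω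

theorem IsHier.isOmega2_iff (h : IsHier V θ H d) {w : ZFSet.{u}} (hw₁ : w₁ ∈ H) (hw : w ∈ H) :
    IsOmega2 {x | x ∈ H} w₁ w ↔ IsOmega2 V w₁ w := by
  unfold IsOmega2
  rw [h.injects_iff hw hw₁]
  refine and_congr_right fun _ => and_congr_right fun _ => forall₂_congr fun x hx => ?_
  exact h.injects_iff (h.isTransitive w hw hx) hw₁

theorem IsHier.finIn_iff (h : IsHier V θ H d) {x : ZFSet.{u}} (hx : x ∈ H) :
    FinIn {x | x ∈ H} x ↔ FinIn V x :=
  exists_congr fun _ => and_congr_right fun hn =>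
    h.injects_iff hx (h.isTransitive _ (h.theta_subset h.omega_mem) hn)

/-- The ordinals `ω`, `ω₁` and `ω₂` belong to each elementary submodel of `H_θ`. -/
theorem IsHier.cardinals_mem (h : IsHier V θ H d) (h₁ : IsOmega1 V w₁) (h₂ : IsOmega2 V w₁ w₂)
    (hw : w₂ ∈ θ) (hM : ElemSub M H {x | x ∈ d}) :
    ∅ ∈ M ∧ omegaSet ∈ M ∧ w₁ ∈ M ∧ w₂ ∈ M := by
  have hU := h.pairClosed
  have hC : {x | x ∈ M} ⊆ {x | x ∈ H} := fun x hx => hM.1 hx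
  have hwV := h.model.transitive _ h.theta_mem _ hw
  have hwH := h.theta_subset hw
  have h12 := h₂.mem h.model h₁ hwV
  have hw₁H := h.isTransitive _ hwH h12
  have hωH := h.theta_subset h.omega_mem
  have a0 : ∅ ∈ M := by
    obtain ⟨x, hx, rfl⟩ := hM.exists (P := fun x => x = ∅) (.isEmpty hU hC (.proj 0))
      ⟨∅, h.theta_subset h.empty_mem_theta, rfl⟩
    exact hx
  have a1 : omegaSet ∈ M := by
    obtain ⟨x, hx, rfl⟩ := hM.exists (P := fun x => x = omegaSet) (.eqOmega hU hC (.proj 0))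
      ⟨_, hωH, rfl⟩
    exact hx
  have a2 : w₁ ∈ M := by
    obtain ⟨x, hx, hx'⟩ := hM.exists (P := fun x => IsOmega1 {x | x ∈ H} x)
      (.isOmega1 hU hC a1 (.proj 0)) ⟨_, hw₁H, (h.isOmega1_iff hw₁H).2 h₁⟩
    rw [h.isOmega1_iff (hM.1 hx)] at hx'
    rwa [h₁.unique hx']
  have a3 : w₂ ∈ M := by
    obtain ⟨x, hx, hx'⟩ := hM.exists (P := fun x => IsOmega2 {x | x ∈ H} w₁ x)
      (.isOmega2 hU hC a2 (.proj 0)) ⟨_, hwH, (h.isOmega2_iff hw₁H hwH).2 h₂⟩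
    rw [h.isOmega2_iff hw₁H (hM.1 hx)] at hx'
    rwa [h₂.unique hx']
  exact ⟨a0, a1, a2, a3⟩

theorem ElemSub.insert_mem (hU : PairClosed {x | x ∈ H}) {A : Set ZFSet.{u}} (hM : ElemSub M H A)
    {x y : ZFSet.{u}} (hx : x ∈ M) (hy : y ∈ M) (hxy : insert x y ∈ H) : insert x y ∈ M := by
  have hC : {x | x ∈ M} ⊆ {x | x ∈ H} := fun x hx => hM.1 hx
  obtain ⟨z, hz, rfl⟩ := hM.exists (P := fun z => z = insert x y)
    (.eqInsert hU hC (.const x hx) (.const y hy) (.proj 0)) ⟨_, hxy, rfl⟩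
  exact hz

theorem IsHier.insert_mem (h : IsHier V θ H d) {x y : ZFSet.{u}} (hx : x ∈ H) (hy : y ∈ H) :
    insert x y ∈ H := by
  obtain ⟨c, hc, hct, hyc, a, ha, hca⟩ := h.exists_transitive_mem hy
  have hP := h.model.pairClosed
  have haV := h.model.transitive _ h.theta_mem _ ha
  have hyV := h.mem_class hy
  have hxV := h.mem_class hx
  obtain ⟨k, hk, k1, k2⟩ := hca
  refine h.mem_of_small (h.model.insert hxV hyV) ?_ ⟨insert a a, h.succ_mem_theta ha, ?_⟩
  · intro z hz
    rcases ZFSet.mem_insert_iff.1 hz with rfl | hz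
    · exact hx
    · exact h.isTransitive y hy hz
  · refine h.model.injects (h.model.insert hxV hyV) (h.model.insert haV haV)
      (R := fun z β => (z ∈ y ∧ ZFSet.pair z β ∈ k) ∨ (z ∉ y ∧ β = a))
      (.or (.and (.mem (.proj 0) (.const y hyV))
        (.pairMem hP le_rfl (.proj 0) (.proj 1) (.const k hk)))
        (.and (.not (.mem (.proj 0) (.const y hyV))) (.eq (.proj 1) (.const a haV)))) ?_ ?_
    · intro z hz
      by_cases hzy : z ∈ y
      · have hzc := hct y hyc hzy
        obtain ⟨β, hβ, hyβ⟩ := k1.exists hzc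
        refine ⟨β, ZFSet.mem_insert_of_mem _ hβ, Or.inl ⟨hzy, hyβ⟩, ?_⟩
        rintro β' - (⟨-, h'⟩ | ⟨h', -⟩)
        · exact k1.unique hzc h' hyβ
        · exact (h' hzy).elim
      · refine ⟨a, ZFSet.mem_insert _ _, Or.inr ⟨hzy, rfl⟩, ?_⟩
        rintro β' - (⟨h', -⟩ | ⟨-, h'⟩)
        · exact (hzy h').elim
        · exact h'
    · rintro z hz z' hz' β - (⟨h1, h2⟩ | ⟨h1, h2⟩) (⟨h3, h4⟩ | ⟨h3, h4⟩)
      · exact k2 z (hct y hyc h1) z' (hct y hyc h3) β h2 h4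
      · exact (ZFSet.mem_irrefl a (h4 ▸ k1.mem (hct y hyc h1) h2)).elim
      · exact (ZFSet.mem_irrefl a (h2 ▸ k1.mem (hct y hyc h3) h4)).elim
      · rw [(ZFSet.mem_insert_iff.1 hz).resolve_right h1,
          (ZFSet.mem_insert_iff.1 hz').resolve_right h3]

theorem IsHier.omega_subset (h : IsHier V θ H d) (hM : ElemSub M H {x | x ∈ d}) (h0 : ∅ ∈ M) :
    ∀ n ∈ (omegaSet : ZFSet.{u}), n ∈ M :=
  omegaSet_induction h0 fun _ _ hx =>
    hM.insert_mem h.pairClosed hx hx (h.insert_mem (hM.1 hx) (hM.1 hx))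

/-- The intersection of an elementary submodel with `ω₁` is transitive. -/
theorem IsHier.subset_of_mem_omega1 (h : IsHier V θ H d) (h₁ : IsOmega1 V w₁)
    (hM : ElemSub M H {x | x ∈ d}) (h0 : ∅ ∈ M) (hω : omegaSet ∈ M) {α : ZFSet.{u}}
    (hα : α ∈ w₁) (hαM : α ∈ M) : α ⊆ M := by
  have hU := h.pairClosed
  have hC : {x | x ∈ M} ⊆ {x | x ∈ H} := fun x hx => hM.1 hx
  -- Every β < α is definable in `M` from an injection of α into ω and the natural number assigned
  -- to β.
  obtain ⟨k, hk, k1, k2⟩ := hM.exists (P := fun k => MapInto k α omegaSet ∧ InjectiveOn k α)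
    (.and (.mapInto hU hC (.const α hαM) (.const _ hω) (.proj 0))
      (.injectiveOn hU hC (.const α hαM) (.proj 0)))
    ((h.injects_iff (hM.1 hαM) (hM.1 hω)).2 (h₁.2.2 α hα))
  intro β hβ
  obtain ⟨n, hn, hβn⟩ := k1.exists hβ
  have hnM := h.omega_subset hM h0 n hn
  obtain ⟨β', hβ', h1, h2⟩ := hM.exists (P := fun β => β ∈ α ∧ ZFSet.pair β n ∈ k)
    (.and (.mem (.proj 0) (.const α hαM))
      (.pairMem hU hC (.proj 0) (.const n hnM) (.const k hk)))
    ⟨β, h.isTransitive _ (hM.1 hαM) hβ, hβ, hβn⟩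
  rwa [k2 β hβ β' h1 n hβn h2]

/-- If `f(ζ) ∈ M` for each `f : ω₂ → ω₁` in `M`, and `ζ` is below some ordinal of `M ∩ ω₂`,
then `ζ ∈ M`. -/
theorem IsHier.mem_of_values (h : IsHier V θ H d) (h₁ : IsOmega1 V w₁) (h₂ : IsOmega2 V w₁ w₂)
    (hw : w₂ ∈ θ) (hM : ElemSub M H {x | x ∈ d}) {ζ β : ZFSet.{u}} (hζ : ζ ∈ w₂)
    (hf : ∀ f ∈ M, IsFun f w₂ w₁ → ∀ y, ZFSet.pair ζ y ∈ f → y ∈ M) (hβ : β ∈ w₂) (hβM : β ∈ M)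
    (hζβ : ζ ∈ β) : ζ ∈ M := by
  have hU := h.pairClosed
  have hC : {x | x ∈ M} ⊆ {x | x ∈ H} := fun x hx => hM.1 hx
  obtain ⟨h0, hω, hw₁M, hw₂M⟩ := h.cardinals_mem h₁ h₂ hw hM
  -- With an injection `k` of β into ω₁ in `M`, it is enough that k(ζ) ∈ M, since ζ can be recovered
  -- from it. This value comes from the hypothesis on ζ, once `k` is extended by ∅ to all of ω₂.
  obtain ⟨k, hk, k1, k2⟩ := hM.exists (P := fun k => MapInto k β w₁ ∧ InjectiveOn k β)
    (.and (.mapInto hU hC (.const β hβM) (.const _ hw₁M) (.proj 0))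
      (.injectiveOn hU hC (.const β hβM) (.proj 0)))
    ((h.injects_iff (hM.1 hβM) (hM.1 hw₁M)).2 (h₂.2.2 β hβ))
  have h0w : ∅ ∈ w₁ := by
    have := h₁.omegaSet_mem h.model (h.mem_class (hM.1 hw₁M))
    exact h₁.1.mem_trans empty_mem_omegaSet this
  have hw₁H := h.isTransitive _ (hM.1 hw₁M)
  obtain ⟨g, hg, hgf, hg'⟩ := h.exists_function hM hw₂M
    (P := fun α y => (α ∈ β ∧ ZFSet.pair α y ∈ k) ∨ (α ∉ β ∧ y = ∅))
    (.or (.and (.mem (.proj 0) (.const β hβM))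
      (.pairMem hU hC (.proj 0) (.proj 1) (.const k hk)))
      (.and (.not (.mem (.proj 0) (.const β hβM))) (.isEmpty hU hC (.proj 1)))) (by
    intro α _
    by_cases hα : α ∈ β
    · obtain ⟨y, hy, hαy⟩ := k1.exists hα
      refine ⟨y, hw₁H hy, Or.inl ⟨hα, hαy⟩, ?_⟩
      rintro y' - (⟨-, h'⟩ | ⟨h', -⟩)
      · exact k1.unique hα h' hαy
      · exact (h' hα).elim
    · refine ⟨∅, hM.1 h0, Or.inr ⟨hα, rfl⟩, ?_⟩
      rintro y' - (⟨h', -⟩ | ⟨-, h'⟩)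
      · exact (hα h').elim
      · exact h')
  have hgw : ∀ α ∈ w₂, ∀ y ∈ H, ZFSet.pair α y ∈ g → y ∈ w₁ := by
    intro α hα y hy hp
    rcases (hg' α hα y hy).1 hp with ⟨h1, h2⟩ | ⟨-, rfl⟩
    · exact k1.mem h1 h2
    · exact h0w
  have hgF : IsFun g w₂ w₁ := by
    refine ⟨fun p hp => ?_, fun α hα => ?_⟩
    · obtain ⟨α, hα, y, hy, rfl⟩ := hgf.1 p hp
      exact ⟨α, hα, y, hgw α hα y hy hp, rfl⟩
    · obtain ⟨y, hy, hy'⟩ := hgf.2 α hα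
      exact ⟨y, hgw α hα y hy ((hy' y).2 rfl), hy'⟩
  obtain ⟨i, hi, hζi⟩ := k1.exists hζβ
  have hiM := hf g hg hgF i ((hg' ζ hζ i (hw₁H hi)).2 (Or.inl ⟨hζβ, hζi⟩))
  obtain ⟨ζ', hζ', h1, h2⟩ := hM.exists (P := fun ζ => ζ ∈ β ∧ ZFSet.pair ζ i ∈ k)
    (.and (.mem (.proj 0) (.const β hβM))
      (.pairMem hU hC (.proj 0) (.const i hiM) (.const k hk)))
    ⟨ζ, h.isTransitive _ (hM.1 hβM) hζβ, hζβ, hζi⟩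
  rwa [k2 ζ hζβ ζ' h1 i hζi h2]

/-- If `f(ζ) ∈ M` for each `f : ω₂ → ω₁` in `M`, then the hull of `M ∪ {ζ}` has no new
countable ordinals. -/
theorem IsHier.mem_of_mem_valuesAt (h : IsHier V θ H d) (h₁ : IsOmega1 V w₁)
    (h₂ : IsOmega2 V w₁ w₂) (hw : w₂ ∈ θ) (hM : ElemSub M H {x | x ∈ d}) {ζ : ZFSet.{u}}
    (hζ : ζ ∈ w₂) (hf : ∀ f ∈ M, IsFun f w₂ w₁ → ∀ y, ZFSet.pair ζ y ∈ f → y ∈ M)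
    {y : ZFSet.{u}} (hy : y ∈ valuesAt H M w₂ ζ) (hyw : y ∈ w₁) : y ∈ M := by
  have hU := h.pairClosed
  have hC : {x | x ∈ M} ⊆ {x | x ∈ H} := fun x hx => hM.1 hx
  obtain ⟨h0, hω, hw₁M, hw₂M⟩ := h.cardinals_mem h₁ h₂ hw hM
  have h0w : ∅ ∈ w₁ := by
    have := h₁.omegaSet_mem h.model (h.mem_class (hM.1 hw₁M))
    exact h₁.1.mem_trans empty_mem_omegaSet this
  obtain ⟨hyH, f, hfM, hff, hζy⟩ := mem_valuesAt.1 hy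
  -- The function producing `y` may have values outside ω₁. Replacing these by ∅ gives a function ω₂
  -- → ω₁ in `M` with the same value at ζ.
  obtain ⟨g, hg, hgf, hg'⟩ := h.exists_function hM hw₂M
    (P := fun α y => (ZFSet.pair α y ∈ f ∧ y ∈ w₁) ∨
      ((∀ z, ZFSet.pair α z ∈ f → z ∉ w₁) ∧ y = ∅))
    (.or (.and (.pairMem hU hC (.proj 0) (.proj 1) (.const f hfM))
      (.mem (.proj 1) (.const _ hw₁M))) (.and (.allPair hU hC (.proj 0) (.const f hfM)
        (.not (.mem (.proj _) (.const _ hw₁M)))) (.isEmpty hU hC (.proj 1)))) (by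
    intro α hα
    obtain ⟨z, hz, hαz⟩ := hff.exists hα
    by_cases hzw : z ∈ w₁
    · refine ⟨z, hz, Or.inl ⟨hαz, hzw⟩, ?_⟩
      rintro y' - (⟨h', -⟩ | ⟨h', -⟩)
      · exact hff.unique hα h' hαz
      · exact (h' z hαz hzw).elim
    · refine ⟨∅, hM.1 h0, Or.inr ⟨fun z' hz' => ?_, rfl⟩, ?_⟩
      · rwa [hff.unique hα hz' hαz]
      · rintro y' - (⟨h', h''⟩ | ⟨-, h'⟩)
        · exact (hzw (hff.unique hα h' hαz ▸ h'')).elim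
        · exact h')
  have hgw : ∀ α ∈ w₂, ∀ y ∈ H, ZFSet.pair α y ∈ g → y ∈ w₁ := by
    intro α hα y hy hp
    rcases (hg' α hα y hy).1 hp with ⟨-, h2⟩ | ⟨-, rfl⟩
    · exact h2
    · exact h0w
  have hgF : IsFun g w₂ w₁ := by
    refine ⟨fun p hp => ?_, fun α hα => ?_⟩
    · obtain ⟨α, hα, y, hy, rfl⟩ := hgf.1 p hp
      exact ⟨α, hα, y, hgw α hα y hy hp, rfl⟩
    · obtain ⟨y, hy, hy'⟩ := hgf.2 α hα
      exact ⟨y, hgw α hα y hy ((hy' y).2 rfl), hy'⟩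
  exact hf g hg hgF y ((hg' ζ hζ y hyH).2 (Or.inl ⟨hζy, hyw⟩))

/-- If the set of all determined countable subsets of `K` is nonstationary, then every countable
elementary submodel of `H_θ` has an end extension as in Strong Chang's Conjecture. -/
theorem IsHier.exists_extension (h : IsHier V θ H d) (h₁ : IsOmega1 V w₁) (h₂ : IsOmega2 V w₁ w₂)
    (hw : w₂ ∈ θ) {K F : ZFSet.{u}} (hK : K ∈ H) (hF : F ∈ H) (hwK : w₂ ⊆ K)
    (hfun : ∀ f ∈ V, IsFun f w₂ w₁ → f ∈ K) (hop : FinOp V F K)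
    (hdet : ∀ x ∈ V, x ⊆ K → Injects V x omegaSet → ClosedIn V x F → ¬ Determined w₁ w₂ x)
    (hMV : M ∈ V) (hMc : Injects V M omegaSet) (hM : ElemSub M H {x | x ∈ d}) :
    ∃ M' ∈ V, ElemSub M' H {x | x ∈ d} ∧ M ⊆ M' ∧ (∀ x ∈ M, x ∈ w₁ → x ⊆ M) ∧
      (∀ x ∈ M', x ∈ w₁ → x ∈ M) ∧ ∃ ζ ∈ M', ζ ∈ w₂ ∧ ζ ∉ M ∧ ∀ β ∈ M, β ∈ w₂ → β ∈ ζ := by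
  have hU := h.pairClosed
  have hC : {x | x ∈ M} ⊆ {x | x ∈ H} := fun x hx => hM.1 hx
  obtain ⟨h0, hω, hw₁M, hw₂M⟩ := h.cardinals_mem h₁ h₂ hw hM
  have hωH := h.theta_subset h.omega_mem
  obtain ⟨ζ, hζ, hζM, hζf⟩ : ∃ ζ ∈ w₂, ζ ∉ M ∧
      ∀ f ∈ M, IsFun f w₂ w₁ → ∀ y, ZFSet.pair ζ y ∈ f → y ∈ M := by
    -- Neither `K` nor `F` has to be in `M`. The existence of such a pair is a statement about ω₁
    -- and ω₂ that holds in `H`, so `M` has its own pair.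
    obtain ⟨K', hK', hK'1, hK'2, hF'⟩ := hM.exists (P := fun K => w₂ ⊆ K ∧
        (∀ f ∈ {x | x ∈ H}, IsFun f w₂ w₁ → f ∈ K) ∧
        ∃ F ∈ {x | x ∈ H}, FinOp {x | x ∈ H} F K ∧
        ∀ x ∈ {x | x ∈ H}, x ⊆ K → Injects {x | x ∈ H} x omegaSet →
          ClosedIn {x | x ∈ H} x F → ¬ Determined w₁ w₂ x)
      (.and (.isSub hU hC (.const _ hw₂M) (.proj 0)) (.and
        (.all (.imp (.isFun hU hC (.const _ hw₂M) (.const _ hw₁M) (.proj _))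
          (.mem (.proj _) (Tm.proj 0).init)))
        (.ex (.and (.finOp hU hC hω (.proj _) (Tm.proj 0).init)
          (.all (.imp (.isSub hU hC (.proj _) (Tm.proj 0).init.init)
            (.imp (.injects hU hC (.proj _) (.const _ hω))
            (.imp (.closedIn hU hC hω (.proj _) (Tm.proj _).init)
            (.not (.determined hU hC hw₁M hw₂M (.proj _)))))))))))
      ⟨K, hK, hwK, fun f hf => hfun f (h.mem_class hf), F, hF,
        fun e he heK hef => hop e (h.mem_class he) heK ((h.finIn_iff he).1 hef),
        fun x hx hxK hxc hxF => hdet x (h.mem_class hx) hxK ((h.injects_iff hx hωH).1 hxc)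
          fun e he hex hef => hxF e (h.subset_mem hx he hex) hex
            ((h.finIn_iff (h.subset_mem hx he hex)).2 hef)⟩
    obtain ⟨F', hF'M, hF'1, hF'2⟩ := hM.exists (P := fun F => FinOp {x | x ∈ H} F K' ∧
        ∀ x ∈ {x | x ∈ H}, x ⊆ K' → Injects {x | x ∈ H} x omegaSet →
          ClosedIn {x | x ∈ H} x F → ¬ Determined w₁ w₂ x)
      (.and (.finOp hU hC hω (.proj 0) (.const _ hK'))
          (.all (.imp (.isSub hU hC (.proj _) (.const _ hK'))
            (.imp (.injects hU hC (.proj _) (.const _ hω))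
            (.imp (.closedIn hU hC hω (.proj _) (Tm.proj 0).init)
            (.not (.determined hU hC hw₁M hw₂M (.proj _)))))))) hF'
    have hxV : M ∩ K' ∈ V := by
      rw [← ZFSet.sep_mem]
      exact h.model.sep hMV (.mem (.proj 0) (.const _ (h.mem_class (hM.1 hK'))))
    have hxK' : M ∩ K' ⊆ K' := fun z hz => (ZFSet.mem_inter.1 hz).2
    have hxM : M ∩ K' ⊆ M := fun z hz => (ZFSet.mem_inter.1 hz).1
    have hxH := h.subset_mem (hM.1 hK') hxV hxK'
    have hcl : ClosedIn {x | x ∈ H} (M ∩ K') F' := by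
      intro e he hex hef y hy
      have heM : e ∈ M := mem_of_finite_subset (M := {x | x ∈ M}) h0
        (fun x hx y hy => hM.insert_mem hU hx hy (h.insert_mem (hM.1 hx) (hM.1 hy))) hef.finite
        fun y hy => hxM (hex hy)
      obtain ⟨z, hz, hz'⟩ := hF'1 e he (fun t ht => hxK' (hex ht)) hef
      obtain rfl := (hz' y).1 hy
      obtain ⟨y', hy', hy''⟩ := hM.exists (P := fun y => ZFSet.pair e y ∈ F')
        (.pairMem hU hC (.const _ heM) (.proj 0) (.const _ hF'M))
        ⟨y, h.isTransitive _ (hM.1 hK') hz, hy⟩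
      rw [(hz' y').1 hy''] at hy'
      exact ZFSet.mem_inter.2 ⟨hy', hz⟩
    have hnd := hF'2 _ hxH hxK'
      -- The set `M ∩ K'` is closed under the operation, hence not determined, and a failure of
      -- determinedness is exactly the required ζ.
      ((h.injects_iff hxH hωH).2 (hMc.mono hxM fun _ => id)) hcl
    unfold Determined at hnd
    push Not at hnd
    obtain ⟨ζ, hζ, hζf, hζx⟩ := hnd
    refine ⟨ζ, hζ, fun hζM => hζx (ZFSet.mem_inter.2 ⟨hζM, hK'1 hζ⟩), fun f hf hff y hy => ?_⟩
    exact hxM (hζf f (ZFSet.mem_inter.2 ⟨hf, hK'2 f (hM.1 hf) hff⟩) hff y hy)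
  have hw₂V := h.mem_class (hM.1 hw₂M)
  refine ⟨valuesAt H M w₂ ζ, h.valuesAt_mem_class hMV hw₂V (h.model.transitive _ hw₂V _ hζ),
    h.elemSub_valuesAt hM hw₂M hζ (hM.1 h0), h.subset_valuesAt hM hw₂M hζ,
    fun x hx hxw => h.subset_of_mem_omega1 h₁ hM h0 hω hxw hx,
    fun x hx hxw => h.mem_of_mem_valuesAt h₁ h₂ hw hM hζ hζf hx hxw,
    ζ, h.mem_valuesAt_self hM hw₂M hζ, hζ, hζM, fun β hβ hβw => ?_⟩
  rcases (h₂.1.mem hβw).mem_trichotomous (h₂.1.mem hζ) with h3 | h3 | h3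
  · exact h3
  · exact (hζM (h3 ▸ hβ)).elim
  -- An ordinal of `M ∩ ω₂` above ζ would put ζ into `M`; so ζ lies above all of `M ∩ ω₂`.
  · exact (hζM (h.mem_of_values h₁ h₂ hw hM hζ hζf hβw hβ h3)).elim

end

/-! ### Stationary sets from a failure of Strong Chang's Conjecture -/

section

variable {V : Set ZFSet.{u}} {w₁ w₂ : ZFSet.{u}}

/-- A failure of Strong Chang's Conjecture above any given ordinal. -/
theorem exists_counterexample (hV : IsTransitiveModel V) (hw₁ : w₁ ∈ V) (hw₂ : w₂ ∈ V)
    (h₁ : IsOmega1 V w₁) (h₂ : IsOmega2 V w₁ w₂) (hS : ¬ SCC V) {b : ZFSet.{u}} (hb : b ∈ V)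
    (hbo : b.IsOrdinal) :
    ∃ θ H d M, IsHier V θ H d ∧ b ∈ θ ∧ w₂ ∈ θ ∧ M ∈ V ∧ Injects V M omegaSet ∧
      ElemSub M H {x | x ∈ d} ∧
      ¬ ∃ M' ∈ V, ElemSub M' H {x | x ∈ d} ∧ M ⊆ M' ∧ (∀ x ∈ M, x ∈ w₁ → x ⊆ M) ∧
        (∀ x ∈ M', x ∈ w₁ → x ∈ M) ∧
        ∃ ζ ∈ M', ζ ∈ w₂ ∧ ζ ∉ M ∧ ∀ β ∈ M, β ∈ w₂ → β ∈ ζ := by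
  have hX := hV.pairClosed
  have hω := hV.omegaSet_mem
  -- The failure of SCC refutes every proposed threshold. The threshold max(b, ω₂) yields a
  -- counterexample θ above both.
  obtain ⟨θ₀, hθ₀, hθ₀o, hbθ, hwθ⟩ : ∃ θ₀ ∈ V, θ₀.IsOrdinal ∧ b ⊆ θ₀ ∧ w₂ ⊆ θ₀ := by
    rcases hbo.subset_total h₂.1 with h | h
    · exact ⟨w₂, hw₂, h₂.1, h, fun _ => id⟩
    · exact ⟨b, hb, hbo, fun _ => id, h⟩
  by_contra hcon
  refine hS ⟨θ₀, hθ₀, (sat_isOrd hX hθ₀).2 hθ₀o, fun θ hθ hθθ hreg H hH hHH d hd hdd M hM hMc hMe =>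
    ?_⟩
  rw [sat_isRegular hX hθ] at hreg
  rw [sat_isH hX hH hθ] at hHH
  rw [sat_ctbl hX hω hM] at hMc
  have hwo := WellorderIn.of_sat hX hH hdd
  have hmem : ∀ {c : ZFSet.{u}}, c.IsOrdinal → c ⊆ θ₀ → c ∈ θ := fun hc hcθ =>
    hc.mem_of_subset_of_mem hreg.1.1 hcθ hθθ
  have hw₂θ := hmem h₂.1 hwθ
  have h12 := h₂.mem hV h₁ hw₂
  have hωθ : omegaSet ∈ θ :=
    hreg.1.1.mem_trans (h₂.1.mem_trans (h₁.omegaSet_mem hV hw₁) h12) hw₂θ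
  by_contra hno
  refine hcon ⟨θ, H, d, M, ⟨hV, hθ, hH, hd, hωθ, hreg, hHH, hwo⟩, hmem hbo hbθ, hw₂θ, hM, hMc,
    hMe, ?_⟩
  rintro ⟨M', hM', hE, hsub, htr, heq, ζ, hζ, hζw, hζM, hβ⟩
  refine hno ⟨M', hM', hE, (sat_sqsub hX hω hM hM').2 ⟨hsub, w₁, hw₁, h₁, htr,
    fun x hx hxw y hy => hsub (htr x (heq x hx hxw) hxw hy),
    fun x hx => ⟨fun h => hsub h, fun h => heq x h hx⟩⟩, ?_, w₂, hw₂,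
    (sat_isOmega2 hX hω hw₂).2 ⟨w₁, hw₁, h₁, h₂⟩, ζ, hζ, hζw, fun β hβM hβw => Or.inl (hβ β hβM hβw)⟩
  rintro rfl
  exact hζM hζ

/-- If Strong Chang's Conjecture fails, then the determined countable subsets of some `K = H_θ`
form a stationary set. -/
theorem exists_stationary_determined (hV : IsTransitiveModel V) (hw₁ : w₁ ∈ V) (hw₂ : w₂ ∈ V)
    (h₁ : IsOmega1 V w₁) (h₂ : IsOmega2 V w₁ w₂) (hS : ¬ SCC V) :
    ∃ K ∈ V, ∃ S ∈ V, w₂ ⊆ K ∧ (∀ x ∈ K, {x} ∈ K) ∧ (∀ f ∈ V, IsFun f w₂ w₁ → f ∈ K) ∧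
      (∀ x, x ∈ S ↔ x ∈ V ∧ x ⊆ K ∧ Injects V x omegaSet ∧ Determined w₁ w₂ x) ∧
      StatIn V S K := by
  have hX := hV.pairClosed
  have hω := hV.omegaSet_mem
  -- Two counterexamples are taken. From the first only H_θ with its wellorder is kept, as the set
  -- `K`; an ordinal enumerating `K` then shows how far up the second must be for `K` to be an
  -- element of its H_θ'.
  obtain ⟨θ, K, d, -, h, -, hwθ, -⟩ :=
    exists_counterexample hV hw₁ hw₂ h₁ h₂ hS hw₂ h₂.1
  obtain ⟨b, hb, e, he, hbo, e1, e2, e3⟩ := hV.exists_enumeration h.wellorder h.order_mem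
    h.hier_mem (fun _ => id)
  obtain ⟨θ', H, d', M, h', hbθ, hwθ', hM, hMc, hME, hno⟩ :=
    exists_counterexample hV hw₁ hw₂ h₁ h₂ hS hb hbo
  have hKH : K ∈ H := by
    refine (h'.mem_iff K).2 ⟨h.hier_mem, K, h.hier_mem, h.isTransitive, fun _ => id, b, hbθ, ?_⟩
    refine hV.injects h.hier_mem hb (R := fun y γ => ZFSet.pair γ y ∈ e)
      (.pairMem hX le_rfl (.proj 1) (.proj 0) (.const e he)) ?_ ?_
    · intro y hy
      obtain ⟨γ, hγ, hγy⟩ := e3 y hy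
      exact ⟨γ, hγ, hγy, fun γ' hγ' h' => e2 γ' hγ' γ hγ y h' hγy⟩
    · intro x hx x' hx' y hy h1 h2
      exact e1.unique hy h1 h2
  have hwK := h.isTransitive _ (h.theta_subset hwθ)
  have hfK : ∀ f ∈ V, IsFun f w₂ w₁ → f ∈ K := by
    intro f hf hff
    have h12 := h₂.mem hV h₁ hw₂
    refine h.function_mem (h.theta_subset hwθ) (h.isTransitive _ (hwK h12)) hw₁ hf ?_
      fun x hx y y' => hff.2.unique hx
    intro p hp
    exact ZFSet.mem_prod.2 (hff.1 p hp)
  obtain ⟨p, hp, hp'⟩ := hV.exists_powerset h.hier_mem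
  have hSV : ZFSet.sep (fun x => Injects V x omegaSet ∧ Determined w₁ w₂ x) p ∈ V :=
    hV.sep hp (.and (.injects hX le_rfl (.proj 0) (.const _ hω))
      (.determined hX le_rfl hw₁ hw₂ (.proj 0)))
  have hSm : ∀ x, x ∈ ZFSet.sep (fun x => Injects V x omegaSet ∧ Determined w₁ w₂ x) p ↔
      x ∈ V ∧ x ⊆ K ∧ Injects V x omegaSet ∧ Determined w₁ w₂ x := by
    intro x
    rw [ZFSet.mem_sep, hp', and_assoc]
  refine ⟨K, h.hier_mem, _, hSV, hwK, fun x hx => h.pairClosed.singleton hx, hfK, hSm,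
    fun z hz => ⟨((hSm z).1 hz).2.1, ((hSm z).1 hz).2.2.1⟩, ?_⟩
  by_contra hcon
  push Not at hcon
  obtain ⟨F, hF, hop, hcl⟩ := hcon
  -- An operation on `K` may be any set with the right values. Its part inside `K` keeps all
  -- relevant pairs, as these are in `K`, and is an element of `H`.
  have hF'V : F ∩ K ∈ V := by
    rw [← ZFSet.sep_mem]
    exact hV.sep hF (.mem (.proj 0) (.const K h.hier_mem))
  refine hno (h'.exists_extension h₁ h₂ hwθ' hKH (h'.subset_mem hKH hF'V
    fun z hz => (ZFSet.mem_inter.1 hz).2) hwK hfK (F := F ∩ K) ?_ ?_ hM hMc hME)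
  · intro e he heK hef
    obtain ⟨y, hy, hy'⟩ := hop e he heK hef
    refine ⟨y, hy, fun y' => ?_⟩
    rw [ZFSet.mem_inter, hy']
    refine ⟨fun h => h.1, ?_⟩
    rintro rfl
    exact ⟨rfl, h.pairClosed.pair (h.finite_mem he heK hef) hy⟩
  · intro x hx hxK hxc hxF hxd
    refine hcl x ((hSm x).2 ⟨hx, hxK, hxc, hxd⟩) fun e he hex hef y hy => ?_
    have heK : e ⊆ K := fun t ht => hxK (hex ht)
    obtain ⟨y', hy', h''⟩ := hop e he heK hef
    obtain rfl := (h'' y).1 hy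
    exact hxF e he hex hef y (ZFSet.mem_inter.2
      ⟨hy, h.pairClosed.pair (h.finite_mem he heK hef) hy'⟩)

end

/-! ### Extensions of transitive models -/

/-- Strong Chang's Conjecture from an outer model. -/
theorem scc_of_outer_model {V W : Set ZFSet.{u}} (hV : IsTransitiveModel V)
    (hW : IsTransitiveModel W) (hVW : V ⊆ W) (hpres : SemistationaryPreserving V W)
    (hns : GroundModelNonstationary V W) : SCC V := by
  by_contra hS
  have hX := hV.pairClosed
  have hY := hW.pairClosed
  have hω := hV.omegaSet_mem
  have hω' := hW.omegaSet_mem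
  obtain ⟨w₂, hw₂, hw₂', B, hB, hB', hns⟩ := hns
  rw [sat_isOmega2 hX hω hw₂] at hw₂'
  obtain ⟨w₁, hw₁, h₁, h₂⟩ := hw₂'
  rw [sat_isCtblSubsets hX hω hB] at hB'
  rw [sat_stationary hY hω' (hVW hB) (hVW hw₂)] at hns
  obtain ⟨K, hK, S, hSV, hwK, -, hfK, hSm, hst⟩ :=
    exists_stationary_determined hV hw₁ hw₂ h₁ h₂ hS
  have h12 := h₂.mem hV h₁ hw₂
  have hss := hpres K hK S hSV ⟨w₁, hw₁, (sat_isOmega1 hX hω hw₁).2 h₁,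
    fun x hx => hwK (h₂.1.mem_trans hx h12)⟩ ((sat_stationary hX hω hSV hK).2 hst)
  have hKW := hVW hK
  rw [Fml.semistationary, sat_and, sat_ex] at hss
  obtain ⟨-, t, ht, hss⟩ := hss
  rw [sat_and, sat_all, sat_stationary hY hω' ht hKW] at hss
  obtain ⟨htm, -, htst⟩ := hss
  refine hns ⟨fun z hz => ?_, fun G hG hGop => ?_⟩
  · obtain ⟨h1, h2, h3⟩ := (hB' z).1 hz
    exact ⟨h2, h3.mono_class hVW⟩
  obtain ⟨p, hp, hp'⟩ := hW.exists_powerset hKW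
  -- the operation that combines `G` with evaluation of functions from `ω₂` to `ω₁`
  set E : ZFSet.{u} → ZFSet.{u} → Prop := fun e y =>
    ∃ f ∈ K, ∃ ζ ∈ w₂, e = {f, ζ} ∧ MapInto f w₂ w₁ ∧ ZFSet.pair ζ y ∈ f with hE
  have hEd : ∀ {n : ℕ} {s t : (Fin n → ZFSet.{u}) → ZFSet.{u}}, Tm W s → Tm W t →
      Dfn W ∅ W fun v => E (s v) (t v) := fun hs ht =>
    .exMem hY le_rfl (.const K hKW) (.exMem hY le_rfl (.const _ (hVW hw₂))
      (.and (.eqUPair hY le_rfl (Tm.proj _).init (.proj _) hs.init.init)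
        (.and (.mapInto hY le_rfl (.const _ (hVW hw₂)) (.const _ (hVW hw₁)) (Tm.proj _).init)
          (.pairMem hY le_rfl (.proj _) ht.init.init (Tm.proj _).init))))
  -- On subsets of ω₂ the operation is `G`; on other sets it evaluates f(ζ) at the unordered pair
  -- {f, ζ}; in the remaining cases it takes the value ∅.
  obtain ⟨F, hF, -, hF'⟩ := hW.exists_graph hp hKW (R := fun e y =>
      (e ⊆ w₂ ∧ ZFSet.pair e y ∈ G) ∨ (¬ e ⊆ w₂ ∧ E e y) ∨
        (¬ e ⊆ w₂ ∧ (∀ y' ∈ K, ¬ E e y') ∧ y = ∅))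
    (.or (.and (.isSub hY le_rfl (.proj 0) (.const _ (hVW hw₂)))
      (.pairMem hY le_rfl (.proj 0) (.proj 1) (.const G hG)))
      (.or (.and (.not (.isSub hY le_rfl (.proj 0) (.const _ (hVW hw₂)))) (hEd (.proj 0) (.proj 1)))
        (.and (.not (.isSub hY le_rfl (.proj 0) (.const _ (hVW hw₂))))
        (.and (.allMem hY le_rfl (.const K hKW) (.not (hEd (Tm.proj 0).init (.proj _))))
          (.isEmpty hY le_rfl (.proj 1))))))
  have h0 : ∅ ∈ w₂ := h₂.1.mem_trans (h₁.1.mem_trans empty_mem_omegaSet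
    (h₁.omegaSet_mem hV hw₁)) h12
  -- The pair {f, ζ} can be decoded: as it is not a subset of ω₂ and ζ ∈ ω₂, the function is its
  -- only element outside ω₂.
  have hEu : ∀ {e y y'}, ¬ e ⊆ w₂ → E e y → E e y' → y = y' := by
    rintro e y y' he ⟨f, -, ζ, hζ, rfl, hf, hy⟩ ⟨f', -, ζ', hζ', he', hf', hy'⟩
    have hfw : f ∉ w₂ := fun hfw => he fun z hz => by
      rcases ZFSet.mem_pair.1 hz with rfl | rfl
      · exact hfw
      · exact hζ
    have e1 : f = f' := by
      have : f ∈ ({f', ζ'} : ZFSet.{u}) := he' ▸ ZFSet.mem_pair.2 (Or.inl rfl)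
      rcases ZFSet.mem_pair.1 this with h | h
      · exact h
      · exact (hfw (h ▸ hζ')).elim
    subst e1
    have e2 : ζ = ζ' := by
      have : ζ' ∈ ({f, ζ} : ZFSet.{u}) := he' ▸ ZFSet.mem_pair.2 (Or.inr rfl)
      rcases ZFSet.mem_pair.1 this with h | h
      · exact (hfw (h ▸ hζ')).elim
      · exact h.symm
    subst e2
    exact hf.unique hζ hy hy'
  have hEw : ∀ {e y}, E e y → y ∈ w₁ := by
    rintro e y ⟨f, -, ζ, hζ, rfl, hf, hy⟩
    exact hf.mem hζ hy
  have hFop : FinOp W F K := by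
    intro e he heK hef
    have hep : e ∈ p := (hp' e).2 ⟨he, heK⟩
    by_cases hew : e ⊆ w₂
    · obtain ⟨y, hy, hy'⟩ := hGop e he hew hef
      refine ⟨y, hwK hy, fun y' => ?_⟩
      rw [hF']
      constructor
      · rintro ⟨-, -, ⟨-, h⟩ | ⟨h, -⟩ | ⟨h, -⟩⟩
        · exact (hy' y').1 h
        · exact (h hew).elim
        · exact (h hew).elim
      · rintro rfl
        exact ⟨hep, hwK hy, Or.inl ⟨hew, (hy' _).2 rfl⟩⟩
    · by_cases hex : ∃ y ∈ K, E e y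
      · obtain ⟨y, hy, hey⟩ := hex
        refine ⟨y, hy, fun y' => ?_⟩
        rw [hF']
        constructor
        · rintro ⟨-, -, ⟨h, -⟩ | ⟨-, h⟩ | ⟨-, h, -⟩⟩
          · exact (hew h).elim
          · exact hEu hew h hey
          · exact (h y hy hey).elim
        · rintro rfl
          exact ⟨hep, hy, Or.inr (Or.inl ⟨hew, hey⟩)⟩
      · push Not at hex
        refine ⟨∅, hwK h0, fun y' => ?_⟩
        rw [hF']
        constructor
        · rintro ⟨-, hy', ⟨h, -⟩ | ⟨-, h⟩ | ⟨-, -, h⟩⟩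
          · exact (hew h).elim
          · exact (hex y' hy' h).elim
          · exact h
        · rintro rfl
          exact ⟨hep, hwK h0, Or.inr (Or.inr ⟨hew, hex, rfl⟩)⟩
  obtain ⟨N, hN, hNF⟩ := htst F hF hFop
  have hNW := hW.transitive _ ht _ hN
  have hN' := (sat_iff.1 (htm N hNW)).1 hN
  rw [sat_and, sat_and, sat_sub hY hNW, sat_exIn hY (hVW hSV)] at hN'
  obtain ⟨hNK, -, m, hmS, hmN⟩ := hN'
  obtain ⟨hmV, hmK, hmc, hmd⟩ := (hSm m).1 hmS
  rw [sat_sqsub hY hω' (hVW hmV) hNW] at hmN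
  obtain ⟨hmN, w, hwW, hw, -, -, hwm⟩ := hmN
  -- The ω₁ of `V` may be collapsed in `W`, but only this inclusion is needed: `m` and `N` have the
  -- same ordinals below ω₁ of `W`, hence below ω₁ of `V`.
  have hw₁w : w₁ ⊆ w := by
    rcases hw.1.mem_or_subset h₁.1 with h | h
    · exact (hw.2.1 ((h₁.2.2 w h).mono_class hVW)).elim
    · exact h
  have hNm : ∀ ζ ∈ N, ζ ∈ w₂ → ζ ∈ m := by
    intro ζ hζN hζ
    refine hmd ζ hζ fun f hf hff y hy => ?_
    have hyw := hff.2.mem hζ hy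
    refine (hwm y (hw₁w hyw)).2 ?_
    have hfK := hmK hf
    have hζK := hwK hζ
    have he : ({f, ζ} : ZFSet.{u}) ∈ W := hY.upair _ (hVW (hV.transitive _ hK _ hfK)) _
      (hVW (hV.transitive _ hK _ hζK))
    refine hNF {f, ζ} he ?_ (IsHier.finIn_upair hW (hVW (hV.transitive _ hK _ hfK))
      (hVW (hV.transitive _ hK _ hζK))) y ((hF' _ _).2 ⟨(hp' _).2 ⟨he, ?_⟩,
        hwK (h₂.1.mem_trans hyw h12), Or.inr (Or.inl ⟨?_, f, hfK, ζ, hζ, rfl, hff.2, hy⟩)⟩)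
    · intro z hz
      rcases ZFSet.mem_pair.1 hz with rfl | rfl
      · exact hmN hf
      · exact hζN
    · intro z hz
      rcases ZFSet.mem_pair.1 hz with rfl | rfl
      · exact hfK
      · exact hζK
    -- A nonempty function is not an ordinal: it would have the element ∅, which is not a pair. So
    -- {f, ζ} is in the domain of evaluation and not in that of `G`.
    · intro hsub
      have hfw : f ∈ w₂ := hsub (ZFSet.mem_pair.2 (Or.inl rfl))
      have hfo := h₂.1.mem hfw
      have h0f : ∅ ∈ f := by
        rcases ZFSet.isOrdinal_empty.mem_or_subset hfo with h | h
        · exact h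
        · exact (ZFSet.notMem_empty _ (h hy)).elim
      obtain ⟨x, -, y, -, h⟩ := hff.1 ∅ h0f
      have : ({x} : ZFSet.{u}) ∈ (∅ : ZFSet.{u}) := by rw [h, ZFSet.pair]; simp
      exact ZFSet.notMem_empty _ this
  have hzV : m ∩ w₂ ∈ V := by
    rw [← ZFSet.sep_mem]
    exact hV.sep hmV (.mem (.proj 0) (.const _ hw₂))
  refine ⟨m ∩ w₂, (hB' _).2 ⟨hzV, fun z hz => (ZFSet.mem_inter.1 hz).2,
    hmc.mono (fun z hz => (ZFSet.mem_inter.1 hz).1) fun _ => id⟩, fun e he hem hef y hy => ?_⟩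
  have hew : e ⊆ w₂ := fun z hz => (ZFSet.mem_inter.1 (hem hz)).2
  obtain ⟨y', hy', h'⟩ := hGop e he hew hef
  obtain rfl := (h' y).1 hy
  have : y ∈ N := hNF e he (fun z hz => hmN (ZFSet.mem_inter.1 (hem hz)).1) hef y
    ((hF' _ _).2 ⟨(hp' e).2 ⟨he, fun z hz => hwK (hew hz)⟩, hwK hy', Or.inl ⟨hew, hy⟩⟩)
  exact ZFSet.mem_inter.2 ⟨hNm y this hy', hy'⟩

/-! ### The universe of sets as a transitive model -/

/-- This makes the results on transitive models, in particular the stationary set of determined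
sets, available for the universe in the forcing argument. -/
theorem isTransitiveModel_univ : IsTransitiveModel (Set.univ : Set ZFSet.{u}) where
  transitive := fun _ _ _ _ => trivial
  zfc :=
    { nonempty := ⟨⟨∅, trivial⟩⟩
      extensionality := fun x y h => Subtype.ext (ZFSet.ext fun z => h ⟨z, trivial⟩)
      foundation := fun x ⟨y, hy⟩ => by
        obtain ⟨z, hz, h⟩ := ZFSet.regularity x.1 fun h => ZFSet.notMem_empty y.1 (h ▸ hy)
        exact ⟨⟨z, trivial⟩, hz, fun w hw hwx =>
          ZFSet.notMem_empty w.1 (h ▸ ZFSet.mem_inter.2 ⟨hwx, hw⟩)⟩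
      pairing := fun x y => ⟨⟨{x.1, y.1}, trivial⟩, fun z => by
        rw [ZFSet.mem_pair, Subtype.ext_iff, Subtype.ext_iff]⟩
      union := fun x => ⟨⟨ZFSet.sUnion x.1, trivial⟩, fun z => by
        rw [ZFSet.mem_sUnion]
        exact ⟨fun ⟨y, h⟩ => ⟨⟨y, trivial⟩, h⟩, fun ⟨y, h⟩ => ⟨y.1, h⟩⟩⟩
      powerset := fun x => ⟨⟨ZFSet.powerset x.1, trivial⟩, fun z => by
        rw [ZFSet.mem_powerset]
        exact ⟨fun h w hw => h hw, fun h w hw => h ⟨w, trivial⟩ hw⟩⟩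
      infinity := ⟨⟨omegaSet, trivial⟩, ⟨⟨∅, trivial⟩, empty_mem_omegaSet,
        fun z => ZFSet.notMem_empty z.1⟩, fun x hx => ⟨⟨insert x.1 x.1, trivial⟩,
          insert_mem_omegaSet hx, fun z => by
            rw [ZFSet.mem_insert_iff, Subtype.ext_iff, or_comm]⟩⟩
      separation := fun D _ a => ⟨⟨ZFSet.sep (fun x => ⟨x, trivial⟩ ∈ D) a.1, trivial⟩, fun x => by
        rw [ZFSet.mem_sep]⟩
      replacement := fun R _ a h => by
        choose f hf hf' using h
        refine ⟨⟨ZFSet.range fun x : {x // x ∈ a.1} => (f ⟨x.1, trivial⟩ x.2).1, trivial⟩,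
          fun y => ?_⟩
        rw [ZFSet.mem_range]
        constructor
        · rintro ⟨x, hx⟩
          refine ⟨⟨x.1, trivial⟩, x.2, ?_⟩
          rw [← show f ⟨x.1, trivial⟩ x.2 = y from Subtype.ext hx]
          exact hf _ _
        · rintro ⟨x, hx, hxy⟩
          exact ⟨⟨x.1, hx⟩, (congrArg Subtype.val (hf' x hx y hxy)).symm⟩
      choice := fun x hne hdis => by
        choose f hf using hne
        refine ⟨⟨ZFSet.range fun y : {y // y ∈ x.1} => (f ⟨y.1, trivial⟩ y.2).1, trivial⟩,
          fun y hy => ⟨f y hy, ⟨ZFSet.mem_range.2 ⟨⟨y.1, hy⟩, rfl⟩, hf y hy⟩, ?_⟩⟩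
        rintro z ⟨hz, hzy⟩
        obtain ⟨y', h'⟩ := ZFSet.mem_range.1 hz
        have e : f ⟨y'.1, trivial⟩ y'.2 = z := Subtype.ext h'
        subst e
        have := hdis ⟨y'.1, trivial⟩ y y'.2 hy ⟨_, hf _ _, hzy⟩
        subst this
        rfl }

theorem exists_zfset_of_small (X : Set ZFSet.{u}) [Small.{u} X] : ∃ M : ZFSet.{u}, ∀ y, y ∈ M ↔ y ∈ X :=
  ⟨ZFSet.range (Subtype.val : X → ZFSet.{u}), fun y => by simp⟩

theorem exists_graph_univ (a b : ZFSet.{u}) (R : ZFSet.{u} → ZFSet.{u} → Prop) :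
    ∃ f, f ⊆ ZFSet.prod a b ∧ ∀ x y, ZFSet.pair x y ∈ f ↔ x ∈ a ∧ y ∈ b ∧ R x y := by
  refine ⟨ZFSet.sep (fun p => ∃ x y, p = ZFSet.pair x y ∧ R x y) (ZFSet.prod a b),
    fun p hp => (ZFSet.mem_sep.1 hp).1, fun x y => ?_⟩
  rw [ZFSet.mem_sep, ZFSet.pair_mem_prod, and_assoc]
  refine and_congr_right fun _ => and_congr_right fun _ => ⟨?_, fun h => ⟨x, y, rfl, h⟩⟩
  rintro ⟨x', y', h, h'⟩
  obtain ⟨rfl, rfl⟩ := ZFSet.pair_inj.1 h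
  exact h'

theorem injects_univ_iff {a b : ZFSet.{u}} :
    Injects Set.univ a b ↔ Nonempty ({x // x ∈ a} ↪ {y // y ∈ b}) := by
  constructor
  · rintro ⟨f, -, h1, h2⟩
    choose g hg hg' using h1
    refine ⟨⟨fun x => ⟨g x.1 x.2, hg _ _⟩, fun x x' h => Subtype.ext ?_⟩⟩
    have h : g x.1 x.2 = g x'.1 x'.2 := congrArg Subtype.val h
    exact h2 x.1 x.2 x'.1 x'.2 _ ((hg' _ _ _).2 rfl) ((hg' _ _ _).2 h)
  · rintro ⟨g⟩
    obtain ⟨f, -, hf⟩ := exists_graph_univ a b fun x y => ∃ hx : x ∈ a, y = (g ⟨x, hx⟩).1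
    refine ⟨f, trivial, fun x hx => ⟨(g ⟨x, hx⟩).1, (g ⟨x, hx⟩).2, fun y' => ?_⟩, ?_⟩
    · rw [hf]
      constructor
      · rintro ⟨-, -, _, h⟩
        exact h
      · rintro rfl
        exact ⟨hx, (g ⟨x, hx⟩).2, hx, rfl⟩
    · intro x hx x' hx' y h h'
      obtain ⟨-, -, h1, rfl⟩ := (hf _ _).1 h
      obtain ⟨-, -, h1', h2'⟩ := (hf _ _).1 h'
      exact congrArg Subtype.val (g.injective (Subtype.ext h2'))

/-- The elements of `ω` correspond to the natural numbers. -/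
noncomputable def natEquivOmegaSet : ℕ ≃ {x : ZFSet.{u} // x ∈ (omegaSet : ZFSet.{u})} :=
  Equiv.ofBijective (fun n => ⟨(n : Ordinal).toZFSet, mem_omegaSet.2 ⟨n, rfl⟩⟩)
    ⟨fun m n h => by
      have := Ordinal.toZFSet_injective (congrArg Subtype.val h)
      exact_mod_cast this,
    fun ⟨x, hx⟩ => by
      obtain ⟨n, rfl⟩ := mem_omegaSet.1 hx
      exact ⟨n, rfl⟩⟩

theorem injects_omegaSet_iff {x : ZFSet.{u}} :
    Injects Set.univ x omegaSet ↔ {y | y ∈ x}.Countable := by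
  rw [injects_univ_iff]
  constructor
  · rintro ⟨g⟩
    exact ⟨_, (g.trans natEquivOmegaSet.symm.toEmbedding).injective⟩
  · rintro ⟨g, hg⟩
    exact ⟨(⟨g, hg⟩ : {y // y ∈ x} ↪ ℕ).trans natEquivOmegaSet.toEmbedding⟩

theorem finIn_univ {x : ZFSet.{u}} (hx : {y | y ∈ x}.Finite) : FinIn Set.univ x := by
  have : Finite {y // y ∈ x} := hx.to_subtype
  obtain ⟨n, ⟨e⟩⟩ := Finite.exists_equiv_fin {y // y ∈ x}
  refine ⟨(n : Ordinal).toZFSet, mem_omegaSet.2 ⟨n, rfl⟩, injects_univ_iff.2 ⟨⟨fun y =>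
    ⟨((e y : ℕ) : Ordinal).toZFSet, Ordinal.toZFSet_mem_toZFSet_iff.2 ?_⟩, fun y y' h => ?_⟩⟩⟩
  · exact_mod_cast (e y).2
  · have := Ordinal.toZFSet_injective (congrArg Subtype.val h)
    exact e.injective (Fin.ext (by exact_mod_cast this))

theorem exists_injects_ordinal (c : ZFSet.{u}) :
    ∃ b : ZFSet.{u}, b.IsOrdinal ∧ Injects Set.univ c b := by
  refine ⟨c.card.ord.toZFSet, ZFSet.isOrdinal_toZFSet _, injects_univ_iff.2 ?_⟩
  have h := (Ordinal.card_toZFSet c.card.ord).trans (Cardinal.card_ord _)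
  have h' := ZFSet.cardinalMk_coe_sort (x := c)
  rw [← h, ← ZFSet.cardinalMk_coe_sort] at h'
  exact ⟨(Classical.choice (Cardinal.eq.1 h')).toEmbedding⟩

/-! ### The forcing relation -/

namespace Poset

variable {Q : Poset.{u}}

theorem le.trans {p q r : ZFSet.{u}} (h : Q.le p q) (h' : Q.le q r) : Q.le p r :=
  Q.trans _ _ _ h h'

theorem le.left_mem {p q : ZFSet.{u}} (h : Q.le p q) : p ∈ Q.carrier :=
  (ZFSet.pair_mem_prod.1 (Q.rel_subset h)).1

theorem le.right_mem {p q : ZFSet.{u}} (h : Q.le p q) : q ∈ Q.carrier :=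
  (ZFSet.pair_mem_prod.1 (Q.rel_subset h)).2

theorem le.refl_left {p q : ZFSet.{u}} (h : Q.le p q) : Q.le p p := Q.refl _ h.left_mem

theorem forcesEq_iff {σ τ p : ZFSet.{u}} : Q.ForcesEq σ τ p ↔
    (∀ π s, ZFSet.pair π s ∈ σ → ∀ q, Q.le q p → Q.le q s →
      ∃ r, Q.le r q ∧ ∃ ρ t, ZFSet.pair ρ t ∈ τ ∧ Q.le r t ∧ Q.ForcesEq π ρ r) ∧
    (∀ ρ t, ZFSet.pair ρ t ∈ τ → ∀ q, Q.le q p → Q.le q t →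
      ∃ r, Q.le r q ∧ ∃ π s, ZFSet.pair π s ∈ σ ∧ Q.le r s ∧ Q.ForcesEq π ρ r) := by
  rw [ForcesEq]
  simp only [exists_prop]

/-- The recursive definition descends only along its first argument, so symmetry is not built in. It
follows by induction on the rank of that argument, the two clauses changing places. -/
theorem ForcesEq.symm {σ τ p : ZFSet.{u}} (h : Q.ForcesEq σ τ p) : Q.ForcesEq τ σ p := by
  have key : ∀ o : Ordinal.{u}, ∀ σ τ p : ZFSet.{u}, σ.rank = o →
      (Q.ForcesEq σ τ p ↔ Q.ForcesEq τ σ p) := by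
    intro o
    induction o using WellFoundedLT.induction with
    | _ o ih =>
      rintro σ τ p rfl
      rw [forcesEq_iff, forcesEq_iff, and_comm]
      have e : ∀ {π s}, ZFSet.pair π s ∈ σ → ∀ {ρ r}, Q.ForcesEq π ρ r ↔ Q.ForcesEq ρ π r :=
        fun h _ _ => ih _ (rank_lt_of_pair_mem h) _ _ _ rfl
      constructor
      · rintro ⟨h1, h2⟩
        refine ⟨fun ρ t hρ q hq hqt => ?_, fun π s hπ q hq hqs => ?_⟩
        · obtain ⟨r, hr, π, s, hπ, hrs, h⟩ := h1 ρ t hρ q hq hqt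
          exact ⟨r, hr, π, s, hπ, hrs, (e hπ).1 h⟩
        · obtain ⟨r, hr, ρ, t, hρ, hrt, h⟩ := h2 π s hπ q hq hqs
          exact ⟨r, hr, ρ, t, hρ, hrt, (e hπ).1 h⟩
      · rintro ⟨h1, h2⟩
        refine ⟨fun ρ t hρ q hq hqt => ?_, fun π s hπ q hq hqs => ?_⟩
        · obtain ⟨r, hr, π, s, hπ, hrs, h⟩ := h1 ρ t hρ q hq hqt
          exact ⟨r, hr, π, s, hπ, hrs, (e hπ).2 h⟩
        · obtain ⟨r, hr, ρ, t, hρ, hrt, h⟩ := h2 π s hπ q hq hqs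
          exact ⟨r, hr, ρ, t, hρ, hrt, (e hπ).2 h⟩
  exact (key _ _ _ _ rfl).1 h

theorem Forces.mono {p q : ZFSet.{u}} (hqp : Q.le q p) :
    ∀ {a : Fml ZFSet.{u}}, Q.Forces p a → Q.Forces q a
  | .mem _ _, h => fun r hr => h r (hr.trans hqp)
  | .eq _ _, h => by
    rw [Forces, forcesEq_iff] at h ⊢
    exact ⟨fun π s hπ r hr => h.1 π s hπ r (hr.trans hqp),
      fun ρ t hρ r hr => h.2 ρ t hρ r (hr.trans hqp)⟩
  | .neg _, h => fun r hr => h r (hr.trans hqp)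
  | .and _ _, h => ⟨Forces.mono hqp h.1, Forces.mono hqp h.2⟩
  | .all _, h => fun τ hτ => Forces.mono hqp (h τ hτ)

/-- A formula that is forced densely often below `p` is forced by `p`. -/
theorem Forces.of_dense {p : ZFSet.{u}} :
    ∀ {a : Fml ZFSet.{u}}, (∀ q, Q.le q p → ∃ r, Q.le r q ∧ Q.Forces r a) → Q.Forces p a
  | .mem _ _, h => fun q hq => by
    obtain ⟨r, hr, h⟩ := h q hq
    obtain ⟨r', hr', h⟩ := h r hr.refl_left
    exact ⟨r', hr'.trans hr, h⟩
  | .eq _ _, h => by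
    rw [Forces, forcesEq_iff]
    refine ⟨fun π s hπ q hq hqs => ?_, fun ρ t hρ q hq hqt => ?_⟩
    · obtain ⟨r, hr, h⟩ := h q hq
      rw [Forces, forcesEq_iff] at h
      obtain ⟨r', hr', h⟩ := h.1 π s hπ r hr.refl_left (hr.trans hqs)
      exact ⟨r', hr'.trans hr, h⟩
    · obtain ⟨r, hr, h⟩ := h q hq
      rw [Forces, forcesEq_iff] at h
      obtain ⟨r', hr', h⟩ := h.2 ρ t hρ r hr.refl_left (hr.trans hqt)
      exact ⟨r', hr'.trans hr, h⟩
  | .neg _, h => fun q hq hqa => by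
    obtain ⟨r, hr, h⟩ := h q hq
    exact h r hr.refl_left (hqa.mono hr)
  | .and _ _, h => ⟨Forces.of_dense fun q hq => (h q hq).imp fun _ h => ⟨h.1, h.2.1⟩,
      Forces.of_dense fun q hq => (h q hq).imp fun _ h => ⟨h.1, h.2.2⟩⟩
  | .all _, h => fun τ hτ =>
      Forces.of_dense fun q hq => (h q hq).imp fun _ h => ⟨h.1, h.2 τ hτ⟩

theorem exists_forces_neg {p : ZFSet.{u}} {a : Fml ZFSet.{u}} (h : ¬ Q.Forces p a) :
    ∃ q, Q.le q p ∧ Q.Forces q (.neg a) := by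
  by_contra hcon
  push Not at hcon
  refine h (Forces.of_dense fun q hq => ?_)
  have := hcon q hq
  rw [Forces] at this
  push Not at this
  exact this

theorem exists_forces_of_not_neg {p : ZFSet.{u}} {a : Fml ZFSet.{u}}
    (h : ¬ Q.Forces p (.neg a)) : ∃ q, Q.le q p ∧ Q.Forces q a := by
  rw [Forces] at h
  push Not at h
  exact h

theorem exists_decides {p : ZFSet.{u}} (hp : p ∈ Q.carrier) (a : Fml ZFSet.{u}) :
    ∃ q, Q.le q p ∧ (Q.Forces q a ∨ Q.Forces q (.neg a)) := by
  by_cases h : Q.Forces p a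
  · exact ⟨p, Q.refl p hp, Or.inl h⟩
  · obtain ⟨q, hq, h⟩ := exists_forces_neg h
    exact ⟨q, hq, Or.inr h⟩

/-- `w` is a witness for the decision that `r` makes on a formula. -/
def Witnesses (Q : Poset.{u}) (r w : ZFSet.{u}) : Fml ZFSet.{u} → Prop
  | .mem σ τ => Q.Forces r (.mem σ τ) → ∃ t, ZFSet.pair w t ∈ τ ∧ Q.le r t ∧ Q.ForcesEq σ w r
  | .eq σ τ => Q.Forces r (.neg (.eq σ τ)) → ∃ s, Q.le r s ∧
      (ZFSet.pair w s ∈ σ ∧ Q.Forces r (.neg (.mem w τ)) ∨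
        ZFSet.pair w s ∈ τ ∧ Q.Forces r (.neg (.mem w σ)))
  | .neg _ => True
  | .and _ _ => True
  | .all f => Q.Forces r (.neg (.all f)) → Q.IsName w ∧ Q.Forces r (.neg (f w))

/-- Below any condition a formula can be decided, and a further extension fixes a name for the
decision: an element of the second name that equals the first, an element that separates two unequal
names, or a counterexample to a universal statement. -/
theorem exists_decides_witnesses {p : ZFSet.{u}} (hp : p ∈ Q.carrier) (a : Fml ZFSet.{u}) :
    ∃ r w, Q.le r p ∧ (Q.Forces r a ∨ Q.Forces r (.neg a)) ∧ Q.Witnesses r w a := by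
  obtain ⟨q, hq, hd⟩ := exists_decides hp a
  have hqq := hq.refl_left
  cases a with
  | mem σ τ =>
    rcases hd with hd | hd
    · obtain ⟨r, hr, ρ, t, h1, h2, h3⟩ := hd q hqq
      exact ⟨r, ρ, hr.trans hq, Or.inl (hd.mono hr), fun _ => ⟨t, h1, h2, h3⟩⟩
    · exact ⟨q, ∅, hq, Or.inr hd, fun h => (hd q hqq h).elim⟩
  | eq σ τ =>
    rcases hd with hd | hd
    · exact ⟨q, ∅, hq, Or.inl hd, fun h => (h q hqq hd).elim⟩
    · have h := hd q hqq
      rw [Forces, forcesEq_iff, not_and_or] at h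
      push Not at h
      rcases h with ⟨π, s, hπ, r, hr, hrs, h⟩ | ⟨ρ, t, hρ, r, hr, hrt, h⟩
      · refine ⟨r, π, hr.trans hq, Or.inr (hd.mono hr), fun _ => ⟨s, hrs, Or.inl ⟨hπ, ?_⟩⟩⟩
        intro r' hr' hm
        obtain ⟨r'', hr'', ρ, t, h1, h2, h3⟩ := hm r' hr'.refl_left
        exact h r'' (hr''.trans hr') ρ t h1 h2 h3
      · refine ⟨r, ρ, hr.trans hq, Or.inr (hd.mono hr), fun _ => ⟨t, hrt, Or.inr ⟨hρ, ?_⟩⟩⟩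
        intro r' hr' hm
        obtain ⟨r'', hr'', π, s, h1, h2, h3⟩ := hm r' hr'.refl_left
        exact h r'' (hr''.trans hr') π s h1 h2 h3.symm
  | neg a => exact ⟨q, ∅, hq, hd, trivial⟩
  | and a b => exact ⟨q, ∅, hq, hd, trivial⟩
  | all f =>
    rcases hd with hd | hd
    · exact ⟨q, ∅, hq, Or.inl hd, fun h => (h q hqq hd).elim⟩
    · have h := hd q hqq
      rw [Forces] at h
      push Not at h
      obtain ⟨τ, hτ, h⟩ := h
      obtain ⟨r, hr, h⟩ := exists_forces_neg h
      exact ⟨r, τ, hr.trans hq, Or.inr (hd.mono hr), fun _ => ⟨hτ, h⟩⟩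

end Poset

/-! ### Countable closures -/

/-- The least set that contains `X` and is closed under the operations `op i`. -/
def opHull {α : Type v} {ι : Type*} (op : ι → List α → α) (X : Set α) : Set α :=
  ⋂₀ {C | X ⊆ C ∧ ∀ i l, (∀ a ∈ l, a ∈ C) → op i l ∈ C}

section OpHull

variable {α : Type v} {ι : Type*} {op : ι → List α → α} {X Y : Set α}

theorem subset_opHull : X ⊆ opHull op X := fun _ hx _ hC => hC.1 hx

theorem op_mem_opHull (i : ι) {l : List α} (hl : ∀ a ∈ l, a ∈ opHull op X) :
    op i l ∈ opHull op X := fun C hC => hC.2 i l fun a ha => hl a ha C hC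

theorem opHull_subset {C : Set α} (hX : X ⊆ C) (hC : ∀ i l, (∀ a ∈ l, a ∈ C) → op i l ∈ C) :
    opHull op X ⊆ C := fun _ h => h C ⟨hX, hC⟩

theorem opHull_mono (h : X ⊆ Y) : opHull op X ⊆ opHull op Y :=
  opHull_subset (h.trans subset_opHull) fun i _ hl => op_mem_opHull i hl

/-- The hull is contained in the union of countably many countable stages; a finite list of elements
of the union already lies in one stage. -/
theorem countable_opHull [Countable ι] (hX : X.Countable) : (opHull op X).Countable := by
  let C : ℕ → Set α := fun n => n.rec X fun _ C => C ∪ ⋃ i, op i '' {l | ∀ a ∈ l, a ∈ C}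
  have hC : ∀ n, (C n).Countable := by
    intro n
    induction n with
    | zero => exact hX
    | succ n ih =>
      have : Countable {a // a ∈ C n} := ih.to_subtype
      have hl : {l : List α | ∀ a ∈ l, a ∈ C n}.Countable := by
        have := @List.countable _ this
        refine Set.Countable.mono ?_ (Set.countable_range (List.map (Subtype.val : {a // a ∈ C n} → α)))
        intro l hl
        exact ⟨l.attach.map fun a => ⟨a.1, hl _ a.2⟩, by simp⟩
      exact ih.union (Set.countable_iUnion fun i => hl.image _)
  have hmono : Monotone C := monotone_nat_of_le_succ fun n => Set.subset_union_left
  refine (Set.countable_iUnion hC).mono (opHull_subset (Set.subset_iUnion C 0) fun i l hl => ?_)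
  have : ∃ n, ∀ a ∈ l, a ∈ C n := by
    clear * - hl hmono
    induction l with
    | nil => exact ⟨0, by simp⟩
    | cons a l ih =>
      obtain ⟨n, hn⟩ := ih fun b hb => hl b (List.mem_cons_of_mem _ hb)
      obtain ⟨m, hm⟩ := Set.mem_iUnion.1 (hl a List.mem_cons_self)
      refine ⟨max m n, fun b hb => ?_⟩
      rcases List.mem_cons.1 hb with rfl | hb
      · exact hmono (le_max_left _ _) hm
      · exact hmono (le_max_right _ _) (hn b hb)
  obtain ⟨n, hn⟩ := this
  exact Set.mem_iUnion.2 ⟨n + 1, Or.inr (Set.mem_iUnion.2 ⟨i, l, hn, rfl⟩)⟩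

/-- The closure operator `opHull` is finitary. -/
theorem exists_finite_of_mem_opHull {a : α} (ha : a ∈ opHull op X) :
    ∃ e, e ⊆ X ∧ e.Finite ∧ a ∈ opHull op e := by
  refine opHull_subset (C := {a | ∃ e, e ⊆ X ∧ e.Finite ∧ a ∈ opHull op e})
    (fun a ha => ⟨{a}, by simpa using ha, Set.finite_singleton a, subset_opHull rfl⟩)
    (fun i l hl => ?_) ha
  have : ∃ e, e ⊆ X ∧ e.Finite ∧ ∀ a ∈ l, a ∈ opHull op e := by
    clear ha
    induction l with
    | nil => exact ⟨∅, by simp⟩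
    | cons a l ih =>
      obtain ⟨e, h1, h2, h3⟩ := ih fun b hb => hl b (List.mem_cons_of_mem _ hb)
      obtain ⟨e', h1', h2', h3'⟩ := hl a List.mem_cons_self
      refine ⟨e ∪ e', Set.union_subset h1 h1', h2.union h2', fun b hb => ?_⟩
      rcases List.mem_cons.1 hb with rfl | hb
      · exact opHull_mono Set.subset_union_right h3'
      · exact opHull_mono Set.subset_union_left (h3 b hb)
  obtain ⟨e, h1, h2, h3⟩ := this
  exact ⟨e, h1, h2, op_mem_opHull i h3⟩

end OpHull

/-! ### Generic filters for countable sets of names and formulas -/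

namespace Poset

/-- `G` is a filter that decides the formulas in `Φ`, with witnesses in `A`. -/
structure Generic (Q : Poset.{u}) (A : Set ZFSet.{u}) (Φ : Set (Fml ZFSet.{u}))
    (G : Set ZFSet.{u}) : Prop where
  nonempty : G.Nonempty
  subset : ∀ p ∈ G, p ∈ Q.carrier
  up : ∀ p ∈ G, ∀ q, Q.le p q → q ∈ G
  directed : ∀ p ∈ G, ∀ q ∈ G, ∃ r ∈ G, Q.le r p ∧ Q.le r q
  mem_mem : ∀ σ ∈ A, ∀ τ ∈ A, .mem σ τ ∈ Φ
  eq_mem : ∀ σ ∈ A, ∀ τ ∈ A, .eq σ τ ∈ Φ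
  of_neg : ∀ a, .neg a ∈ Φ → a ∈ Φ
  of_and : ∀ a b, .and a b ∈ Φ → a ∈ Φ ∧ b ∈ Φ
  of_all : ∀ f, .all f ∈ Φ → ∀ τ ∈ A, f τ ∈ Φ
  decides : ∀ a ∈ Φ, ∃ r ∈ G, ∃ w ∈ A, (Q.Forces r a ∨ Q.Forces r (.neg a)) ∧ Q.Witnesses r w a

section Existence

variable (Q : Poset.{u})

open Classical in
/-- Closure operations for the construction of a generic filter. -/
noncomputable def genericOp :
    Fin 6 → List (ZFSet.{u} ⊕ Fml ZFSet.{u}) → ZFSet.{u} ⊕ Fml ZFSet.{u}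
  | 0, [.inl p, .inr a] =>
    .inl (if h : p ∈ Q.carrier then (exists_decides_witnesses h a).choose else ∅)
  | 1, [.inl p, .inr a] =>
    .inl (if h : p ∈ Q.carrier then (exists_decides_witnesses h a).choose_spec.choose else ∅)
  | 2, [.inl σ, .inl τ] => .inr (.mem σ τ)
  | 3, [.inl σ, .inl τ] => .inr (.eq σ τ)
  | 4, [.inr (.neg a)] => .inr a
  | 4, [.inr (.and a _)] => .inr a
  | 4, [.inr (.all f), .inl τ] => .inr (f τ)
  | 5, [.inr (.and _ b)] => .inr b
  | _, l => l.headD (.inl ∅)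

/-- The construction of Rasiowa and Sikorski. Names, conditions and formulas are first closed off
together into a countable set containing a deciding extension and a witness for each formula in it;
a descending sequence through an enumeration of the formulas then generates the filter. -/
theorem exists_generic {p : ZFSet.{u}} (hp : p ∈ Q.carrier) {ι : Type*} [Countable ι]
    (op : ι → List (ZFSet.{u} ⊕ Fml ZFSet.{u}) → ZFSet.{u} ⊕ Fml ZFSet.{u})
    {X : Set (ZFSet.{u} ⊕ Fml ZFSet.{u})} (hX : X.Countable) :
    ∃ (Y : Set (ZFSet.{u} ⊕ Fml ZFSet.{u})) (G : Set ZFSet.{u}), X ⊆ Y ∧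
      (∀ i l, (∀ a ∈ l, a ∈ Y) → op i l ∈ Y) ∧ p ∈ G ∧
      Q.Generic (Sum.inl ⁻¹' Y) (Sum.inr ⁻¹' Y) G := by
  set Y := opHull (Sum.elim op Q.genericOp) (insert (.inl p) X) with hYdef
  have hY : Y.Countable := countable_opHull (hX.insert _)
  have hop : ∀ i l, (∀ a ∈ l, a ∈ Y) → Q.genericOp i l ∈ Y := fun i l hl =>
    op_mem_opHull (op := Sum.elim op Q.genericOp) (.inr i) hl
  have hpY : .inl p ∈ Y := subset_opHull (Set.mem_insert _ _)
  have two : ∀ {a b}, a ∈ Y → b ∈ Y → ∀ c ∈ [a, b], c ∈ Y := by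
    intro a b ha hb c hc
    rcases List.mem_cons.1 hc with rfl | hc
    · exact ha
    · exact List.mem_singleton.1 hc ▸ hb
  have one : ∀ {a}, a ∈ Y → ∀ c ∈ [a], c ∈ Y := by
    intro a ha c hc
    exact List.mem_singleton.1 hc ▸ ha
  have hmm : ∀ σ τ, .inl σ ∈ Y → .inl τ ∈ Y → .inr (.mem σ τ) ∈ Y :=
    fun σ τ hσ hτ => hop 2 _ (two hσ hτ)
  have hstep : ∀ q a, q ∈ Q.carrier → .inl q ∈ Y → .inr a ∈ Y → ∃ r w, .inl r ∈ Y ∧ .inl w ∈ Y ∧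
      Q.le r q ∧ (Q.Forces r a ∨ Q.Forces r (.neg a)) ∧ Q.Witnesses r w a := by
    intro q a hq hqY ha
    have h0 := hop 0 _ (two hqY ha)
    have h1 := hop 1 _ (two hqY ha)
    simp only [genericOp, hq, dif_pos] at h0 h1
    exact ⟨_, _, h0, h1, (exists_decides_witnesses hq a).choose_spec.choose_spec⟩
  obtain ⟨e, he⟩ := (hY.preimage Sum.inr_injective).exists_eq_range ⟨_, hmm p p hpY hpY⟩
  have heY : ∀ n, .inr (e n) ∈ Y := fun n => by
    have : e n ∈ Sum.inr ⁻¹' Y := he ▸ Set.mem_range_self n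
    exact this
  choose! st w hst hw hle hdec hwit using hstep
  -- Each step decides the next formula and stays in the countable set.
  let s : ℕ → ZFSet.{u} := fun n => n.rec p fun n q => st q (e n)
  have hs : ∀ n, s n ∈ Q.carrier ∧ .inl (s n) ∈ Y := by
    intro n
    induction n with
    | zero => exact ⟨hp, hpY⟩
    | succ n ih => exact ⟨(hle _ _ ih.1 ih.2 (heY n)).left_mem, hst _ _ ih.1 ih.2 (heY n)⟩
  have hsle : ∀ m n, m ≤ n → Q.le (s n) (s m) := by
    intro m n hmn
    induction hmn with
    | refl => exact Q.refl _ (hs m).1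
    | step _ ih => exact (hle _ _ (hs _).1 (hs _).2 (heY _)).trans ih
  refine ⟨Y, {q | ∃ n, Q.le (s n) q}, (Set.subset_insert _ _).trans subset_opHull,
    fun i l hl => op_mem_opHull (op := Sum.elim op Q.genericOp) (.inl i) hl, ⟨0, Q.refl p hp⟩,
    ⟨⟨p, 0, Q.refl p hp⟩, ?_, ?_, ?_, fun σ hσ τ hτ => hmm σ τ hσ hτ, fun σ hσ τ hτ => hop 3 _ (two hσ hτ),
      fun a ha => hop 4 _ (one ha), fun a b ha => ⟨hop 4 _ (one ha), hop 5 _ (one ha)⟩,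
      fun f hf τ hτ => hop 4 _ (two hf hτ), ?_⟩⟩
  · rintro q ⟨n, hn⟩
    exact hn.right_mem
  · rintro q ⟨n, hn⟩ r hr
    exact ⟨n, hn.trans hr⟩
  · rintro q ⟨n, hn⟩ r ⟨m, hm⟩
    exact ⟨s (max n m), ⟨_, Q.refl _ (hs _).1⟩, (hsle _ _ (le_max_left n m)).trans hn,
      (hsle _ _ (le_max_right n m)).trans hm⟩
  · intro a ha
    rw [he] at ha
    obtain ⟨n, rfl⟩ := ha
    exact ⟨s (n + 1), ⟨n + 1, Q.refl _ (hs (n + 1)).1⟩, w (s n) (e n), hw _ _ (hs n).1 (hs n).2 (heY n),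
      hdec _ _ (hs n).1 (hs n).2 (heY n), hwit _ _ (hs n).1 (hs n).2 (heY n)⟩

end Existence

/-! ### Truth along a generic filter -/

namespace Generic

variable {Q : Poset.{u}} {A : Set ZFSet.{u}} {Φ : Set (Fml ZFSet.{u})} {G : Set ZFSet.{u}}

variable (Q G) in
/-- The formula `a` is forced by some condition in `G`. -/
def Holds (a : Fml ZFSet.{u}) : Prop := ∃ r ∈ G, Q.Forces r a

theorem not_holds_neg (hG : Q.Generic A Φ G) {a : Fml ZFSet.{u}} (h : Holds Q G a) : ¬ Holds Q G (.neg a) := by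
  rintro ⟨q, hq, h'⟩
  obtain ⟨p, hp, h⟩ := h
  obtain ⟨r, hr, hrp, hrq⟩ := hG.directed p hp q hq
  exact h' r hrq (h.mono hrp)

theorem holds_neg (hG : Q.Generic A Φ G) {a : Fml ZFSet.{u}} (ha : a ∈ Φ) :
    Holds Q G (.neg a) ↔ ¬ Holds Q G a := by
  refine ⟨fun h h' => hG.not_holds_neg h' h, fun h => ?_⟩
  obtain ⟨r, hr, w, hw, h' | h', -⟩ := hG.decides a ha
  · exact (h ⟨r, hr, h'⟩).elim
  · exact ⟨r, hr, h'⟩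

theorem holds_and (hG : Q.Generic A Φ G) {a b : Fml ZFSet.{u}} :
    Holds Q G (.and a b) ↔ Holds Q G a ∧ Holds Q G b := by
  constructor
  · rintro ⟨r, hr, h⟩
    exact ⟨⟨r, hr, h.1⟩, ⟨r, hr, h.2⟩⟩
  · rintro ⟨⟨p, hp, h⟩, ⟨q, hq, h'⟩⟩
    obtain ⟨r, hr, hrp, hrq⟩ := hG.directed p hp q hq
    exact ⟨r, hr, h.mono hrp, h'.mono hrq⟩

/-- If the filter decided the universal statement negatively, the witness in `A` would name a
counterexample. So quantifying over the names in `A` is enough. -/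
theorem holds_all (hG : Q.Generic A Φ G) {f : ZFSet.{u} → Fml ZFSet.{u}} (hf : .all f ∈ Φ) :
    Holds Q G (.all f) ↔ ∀ τ ∈ A, Q.IsName τ → Holds Q G (f τ) := by
  constructor
  · rintro ⟨r, hr, h⟩ τ - hτ
    exact ⟨r, hr, h τ hτ⟩
  · intro h
    obtain ⟨r, hr, w, hw, h' | h', hwit⟩ := hG.decides _ hf
    · exact ⟨r, hr, h'⟩
    · obtain ⟨h1, h2⟩ := hwit h'
      exact (hG.not_holds_neg (h w hw h1) ⟨r, hr, h2⟩).elim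

theorem holds_mem (hG : Q.Generic A Φ G) {σ τ : ZFSet.{u}} (hσ : σ ∈ A) (hτ : τ ∈ A) :
    Holds Q G (.mem σ τ) ↔
      ∃ ρ ∈ A, ∃ t ∈ G, ZFSet.pair ρ t ∈ τ ∧ Holds Q G (.eq σ ρ) := by
  constructor
  · intro h
    obtain ⟨r, hr, w, hw, h' | h', hwit⟩ := hG.decides _ (hG.mem_mem σ hσ τ hτ)
    · obtain ⟨t, h1, h2, h3⟩ := hwit h'
      exact ⟨w, hw, t, hG.up r hr t h2, h1, r, hr, h3⟩
    · exact (hG.not_holds_neg h ⟨r, hr, h'⟩).elim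
  · rintro ⟨ρ, hρ, t, ht, h1, q, hq, h2⟩
    obtain ⟨r, hr, hrt, hrq⟩ := hG.directed t ht q hq
    exact ⟨r, hr, fun r' hr' => ⟨r', hr'.refl_left, ρ, t, h1, hr'.trans hrt,
      Forces.mono (a := .eq σ ρ) (hr'.trans hrq) h2⟩⟩

theorem holds_eq_symm {σ τ : ZFSet.{u}} (h : Holds Q G (.eq σ τ)) : Holds Q G (.eq τ σ) := by
  obtain ⟨r, hr, h⟩ := h
  exact ⟨r, hr, ForcesEq.symm h⟩

/-- If inequality is decided, the witness is an element of one name forced not to be in the other,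
which the two inclusions rule out. -/
theorem holds_eq (hG : Q.Generic A Φ G) {σ τ : ZFSet.{u}} (hσ : σ ∈ A) (hτ : τ ∈ A) :
    Holds Q G (.eq σ τ) ↔
      (∀ π ∈ A, ∀ s ∈ G, ZFSet.pair π s ∈ σ → Holds Q G (.mem π τ)) ∧
      (∀ ρ ∈ A, ∀ t ∈ G, ZFSet.pair ρ t ∈ τ → Holds Q G (.mem ρ σ)) := by
  have key : ∀ {σ τ : ZFSet.{u}}, Holds Q G (.eq σ τ) →
      ∀ π, ∀ s ∈ G, ZFSet.pair π s ∈ σ → Holds Q G (.mem π τ) := by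
    rintro σ τ ⟨q, hq, h⟩ π s hs hπ
    obtain ⟨r, hr, hrs, hrq⟩ := hG.directed s hs q hq
    exact ⟨r, hr, fun r' hr' => (forcesEq_iff.1 h).1 π s hπ r' (hr'.trans hrq) (hr'.trans hrs)⟩
  constructor
  · exact fun h => ⟨fun π _ => key h π, fun ρ _ => key (holds_eq_symm h) ρ⟩
  · rintro ⟨h1, h2⟩
    obtain ⟨r, hr, w, hw, h' | h', hwit⟩ := hG.decides _ (hG.eq_mem σ hσ τ hτ)
    · exact ⟨r, hr, h'⟩
    · obtain ⟨s, hrs, ⟨h3, h4⟩ | ⟨h3, h4⟩⟩ := hwit h'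
      · exact (hG.not_holds_neg (h1 w hw s (hG.up r hr s hrs) h3) ⟨r, hr, h4⟩).elim
      · exact (hG.not_holds_neg (h2 w hw s (hG.up r hr s hrs) h3) ⟨r, hr, h4⟩).elim

end Generic

/-! ### Interpretation of names -/

theorem fst_mem_sUnion {x y τ : ZFSet.{u}} (h : ZFSet.pair x y ∈ τ) :
    x ∈ ZFSet.sUnion (ZFSet.sUnion τ) :=
  ZFSet.mem_sUnion.2 ⟨{x}, ZFSet.mem_sUnion.2 ⟨_, h, by simp [ZFSet.pair]⟩, by simp⟩

/-- The interpretation of the name `τ` by the filter `G`, restricted to the names in `A`. -/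
noncomputable def val (A G : Set ZFSet.{u}) (τ : ZFSet.{u}) : ZFSet.{u} :=
  ZFSet.range fun ρ : {ρ // ρ ∈ ZFSet.sep (fun ρ => ρ ∈ A ∧ ∃ t ∈ G, ZFSet.pair ρ t ∈ τ)
    (ZFSet.sUnion (ZFSet.sUnion τ))} => val A G ρ.1
termination_by τ.rank
decreasing_by
  obtain ⟨-, -, t, -, ht⟩ := ZFSet.mem_sep.1 ρ.2
  exact rank_lt_of_pair_mem ht

section Val

variable {Q : Poset.{u}} {A : Set ZFSet.{u}} {Φ : Set (Fml ZFSet.{u})} {G : Set ZFSet.{u}}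

theorem mem_val {τ y : ZFSet.{u}} :
    y ∈ val A G τ ↔ ∃ ρ ∈ A, ∃ t ∈ G, ZFSet.pair ρ t ∈ τ ∧ val A G ρ = y := by
  rw [val, ZFSet.mem_range]
  constructor
  · rintro ⟨⟨ρ, hρ⟩, rfl⟩
    obtain ⟨-, hA, t, ht, h⟩ := ZFSet.mem_sep.1 hρ
    exact ⟨ρ, hA, t, ht, h, rfl⟩
  · rintro ⟨ρ, hρ, t, ht, h, rfl⟩
    exact ⟨⟨ρ, ZFSet.mem_sep.2 ⟨fst_mem_sUnion h, hρ, t, ht, h⟩⟩, rfl⟩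

/-- Induction on the rank of the first name. Membership statements about elements of either name
reduce to equalities whose first or second member has smaller rank; symmetry brings the smaller one
to the front. -/
theorem Generic.holds_eq_iff (hG : Q.Generic A Φ G) : ∀ {σ τ : ZFSet.{u}}, σ ∈ A → τ ∈ A →
    (Generic.Holds Q G (.eq σ τ) ↔ val A G σ = val A G τ) := by
  have key : ∀ o : Ordinal.{u}, ∀ σ τ : ZFSet.{u}, σ.rank = o → σ ∈ A → τ ∈ A →
      (Generic.Holds Q G (.eq σ τ) ↔ val A G σ = val A G τ) := by
    intro o
    induction o using WellFoundedLT.induction with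
    | _ o ih =>
      rintro σ τ rfl hσ hτ
      rw [hG.holds_eq hσ hτ]
      have e1 : ∀ π ∈ A, ∀ s, ZFSet.pair π s ∈ σ →
          (Generic.Holds Q G (.mem π τ) ↔ val A G π ∈ val A G τ) := by
        intro π hπ s hs
        rw [hG.holds_mem hπ hτ, mem_val]
        refine exists_congr fun ρ => and_congr_right fun hρ => exists_congr fun t =>
          and_congr_right fun ht => and_congr_right fun h => ?_
        rw [ih _ (rank_lt_of_pair_mem hs) π ρ rfl hπ hρ, eq_comm]
      have e2 : ∀ ρ ∈ A, (Generic.Holds Q G (.mem ρ σ) ↔ val A G ρ ∈ val A G σ) := by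
        intro ρ hρ
        rw [hG.holds_mem hρ hσ, mem_val]
        refine exists_congr fun π => and_congr_right fun hπ => exists_congr fun t =>
          and_congr_right fun ht => and_congr_right fun h => ?_
        rw [← ih _ (rank_lt_of_pair_mem h) π ρ rfl hπ hρ]
        exact ⟨Generic.holds_eq_symm, Generic.holds_eq_symm⟩
      constructor
      · rintro ⟨h1, h2⟩
        ext y
        rw [mem_val, mem_val]
        constructor
        · rintro ⟨π, hπ, s, hs, h, rfl⟩
          exact mem_val.1 ((e1 π hπ s h).1 (h1 π hπ s hs h))
        · rintro ⟨ρ, hρ, t, ht, h, rfl⟩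
          exact mem_val.1 ((e2 ρ hρ).1 (h2 ρ hρ t ht h))
      · intro h
        refine ⟨fun π hπ s hs h' => (e1 π hπ s h').2 ?_, fun ρ hρ t ht h' => (e2 ρ hρ).2 ?_⟩
        · rw [← h]
          exact mem_val.2 ⟨π, hπ, s, hs, h', rfl⟩
        · rw [h]
          exact mem_val.2 ⟨ρ, hρ, t, ht, h', rfl⟩
  exact fun {σ τ} hσ hτ => key _ σ τ rfl hσ hτ

theorem Generic.holds_mem_iff (hG : Q.Generic A Φ G) {σ τ : ZFSet.{u}} (hσ : σ ∈ A) (hτ : τ ∈ A) :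
    Generic.Holds Q G (.mem σ τ) ↔ val A G σ ∈ val A G τ := by
  rw [hG.holds_mem hσ hτ, mem_val]
  refine exists_congr fun ρ => and_congr_right fun hρ => exists_congr fun t =>
    and_congr_right fun ht => and_congr_right fun h => ?_
  rw [hG.holds_eq_iff hσ hρ, eq_comm]

/-- The interpretations of the names in `A`. -/
def extension (Q : Poset.{u}) (A G : Set ZFSet.{u}) : Set ZFSet.{u} :=
  {x | ∃ τ ∈ A, Q.IsName τ ∧ val A G τ = x}

/-- `φ'` arises from `φ` by interpreting all names. -/
inductive Interprets (Q : Poset.{u}) (A G : Set ZFSet.{u}) :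
    Fml ZFSet.{u} → Fml ZFSet.{u} → Prop
  | mem {σ τ x y : ZFSet.{u}} : σ ∈ A → τ ∈ A → val A G σ = x → val A G τ = y →
      Interprets Q A G (.mem σ τ) (.mem x y)
  | eq {σ τ x y : ZFSet.{u}} : σ ∈ A → τ ∈ A → val A G σ = x → val A G τ = y →
      Interprets Q A G (.eq σ τ) (.eq x y)
  | neg {a a' : Fml ZFSet.{u}} : Interprets Q A G a a' → Interprets Q A G (.neg a) (.neg a')
  | and {a a' b b' : Fml ZFSet.{u}} : Interprets Q A G a a' → Interprets Q A G b b' →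
      Interprets Q A G (.and a b) (.and a' b')
  | all {f f' : ZFSet.{u} → Fml ZFSet.{u}} :
      (∀ τ ∈ A, ∀ x, val A G τ = x → Interprets Q A G (f τ) (f' x)) →
      Interprets Q A G (.all f) (.all f')

/-- The truth lemma. -/
theorem Interprets.holds_iff (hG : Q.Generic A Φ G) {a a' : Fml ZFSet.{u}}
    (h : Interprets Q A G a a') (ha : a ∈ Φ) :
    Generic.Holds Q G a ↔ Sat (extension Q A G) a' := by
  induction h with
  | mem h1 h2 e1 e2 => subst e1 e2; exact hG.holds_mem_iff h1 h2
  | eq h1 h2 e1 e2 => subst e1 e2; exact hG.holds_eq_iff h1 h2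
  | neg _ ih =>
    have := hG.of_neg _ ha
    rw [hG.holds_neg this, ih this]; rfl
  | and _ _ ih1 ih2 =>
    have := hG.of_and _ _ ha
    rw [hG.holds_and, ih1 this.1, ih2 this.2]; rfl
  | all _ ih =>
    rw [hG.holds_all ha]
    constructor
    · rintro h _ ⟨τ, hτ, hτn, rfl⟩
      exact (ih τ hτ _ rfl (hG.of_all _ ha τ hτ)).1 (h τ hτ hτn)
    · intro h τ hτ hτn
      exact (ih τ hτ _ rfl (hG.of_all _ ha τ hτ)).2 (h _ ⟨τ, hτ, hτn, rfl⟩)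

end Val

end Poset

/-! ### Generic models with canonical names -/

namespace Poset

section Check

variable {Q : Poset.{u}}

theorem mem_check {x z : ZFSet.{u}} :
    z ∈ Q.check x ↔ ∃ y ∈ x, ∃ p ∈ Q.carrier, z = ZFSet.pair (Q.check y) p := by
  rw [check, ZFSet.mem_range]
  constructor
  · rintro ⟨⟨y, p⟩, rfl⟩
    exact ⟨y.1, y.2, p.1, p.2, rfl⟩
  · rintro ⟨y, hy, p, hp, rfl⟩
    exact ⟨⟨⟨y, hy⟩, ⟨p, hp⟩⟩, rfl⟩

theorem isName_check (x : ZFSet.{u}) : Q.IsName (Q.check x) := by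
  induction x using ZFSet.inductionOn with
  | _ x ih =>
    refine .intro _ (fun z hz => ?_) fun σ p h => ?_
    · obtain ⟨y, -, p, hp, rfl⟩ := mem_check.1 hz
      exact ⟨_, p, hp, rfl⟩
    · obtain ⟨y, hy, p', -, h⟩ := mem_check.1 h
      obtain ⟨rfl, rfl⟩ := ZFSet.pair_inj.1 h
      exact ih y hy

theorem check_injective {p : ZFSet.{u}} (hp : p ∈ Q.carrier) : Function.Injective Q.check := by
  intro x
  induction x using ZFSet.inductionOn with
  | _ x ih =>
    intro y hxy
    ext z
    constructor
    · intro hz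
      have := mem_check.2 ⟨z, hz, p, hp, rfl⟩
      rw [hxy] at this
      obtain ⟨z', hz', p', -, h⟩ := mem_check.1 this
      rwa [ih z hz (ZFSet.pair_inj.1 h).1]
    · intro hz
      have := mem_check.2 ⟨z, hz, p, hp, rfl⟩
      rw [← hxy] at this
      obtain ⟨z', hz', p', -, h⟩ := mem_check.1 this
      rwa [← ih z' hz' (ZFSet.pair_inj.1 h).1.symm]

variable (Q) in
/-- A name for the unordered pair of two names. -/
noncomputable def upairName (σ τ : ZFSet.{u}) : ZFSet.{u} :=
  ZFSet.prod {σ, τ} Q.carrier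

theorem isName_upairName {σ τ : ZFSet.{u}} (hσ : Q.IsName σ) (hτ : Q.IsName τ) :
    Q.IsName (Q.upairName σ τ) := by
  refine .intro _ (fun z hz => ?_) fun ρ p h => ?_
  · obtain ⟨ρ, -, p, hp, rfl⟩ := ZFSet.mem_prod.1 hz
    exact ⟨ρ, p, hp, rfl⟩
  · rcases ZFSet.mem_pair.1 (ZFSet.pair_mem_prod.1 h).1 with rfl | rfl
    · exact hσ
    · exact hτ

theorem isName_extName (M : ZFSet.{u}) : Q.IsName (Q.extName M) := by
  refine .intro _ (fun z hz => ?_) fun ρ p h => ?_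
  · obtain ⟨ρ, -, p, hp, rfl⟩ := ZFSet.mem_prod.1 (ZFSet.mem_sep.1 hz).1
    exact ⟨ρ, p, hp, rfl⟩
  · obtain ⟨τ, p', h', hτ⟩ := (ZFSet.mem_sep.1 h).2
    obtain ⟨rfl, rfl⟩ := ZFSet.pair_inj.1 h'
    exact hτ

end Check

/-- `ξ` belongs to the value of `F` at `σ`. -/
def valueFml {X : Type v} (F σ ξ : X) : Fml X := .ex fun y => Fml.pairMem σ y F ⋏ ξ ∈ᶠ y

/-- Closure properties that make the interpretations of the names in `A` a useful model. -/
structure World (Q : Poset.{u}) (A : Set ZFSet.{u}) (Φ : Set (Fml ZFSet.{u}))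
    (G : Set ZFSet.{u}) : Prop extends Q.Generic A Φ G where
  check_mem_iff : ∀ x, Q.check x ∈ A ↔ x ∈ A
  omega_mem : omegaSet ∈ A
  nat_mem : ∀ n ∈ (omegaSet : ZFSet.{u}), n ∈ A
  separates : ∀ x ∈ A, ∀ y ∈ A, x ≠ y → ∃ z ∈ A, ¬ (z ∈ x ↔ z ∈ y)
  upair : ∀ x ∈ A, ∀ y ∈ A, ({x, y} : ZFSet) ∈ A
  of_pair : ∀ x y, ZFSet.pair x y ∈ A → x ∈ A ∧ y ∈ A
  value : ∀ f ∈ A, ∀ x ∈ A, ∀ y, ZFSet.pair x y ∈ f → ∃ y ∈ A, ZFSet.pair x y ∈ f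
  injection : ∀ a ∈ A, ∀ b ∈ A, Injects Set.univ a b →
    ∃ f ∈ A, f ⊆ ZFSet.prod a b ∧ MapInto f a b ∧ InjectiveOn f a
  upairName : ∀ σ ∈ A, ∀ τ ∈ A, Q.upairName σ τ ∈ A
  valueFml : ∀ F ∈ A, ∀ σ ∈ A, ∀ ξ ∈ A, valueFml F σ ξ ∈ Φ

/-- Closure operations for the construction of a generic model. -/
noncomputable def worldOp (Q : Poset.{u}) :
    Fin 10 → List (ZFSet.{u} ⊕ Fml ZFSet.{u}) → ZFSet.{u} ⊕ Fml ZFSet.{u}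
  | 0, [.inl x] => .inl (Q.check x)
  | 1, [.inl x] => .inl (Classical.epsilon fun y => Q.check y = x)
  | 2, [.inl x, .inl y] => .inl (Classical.epsilon fun z => ¬ (z ∈ x ↔ z ∈ y))
  | 3, [.inl x, .inl y] => .inl {x, y}
  | 4, [.inl x] => .inl (Classical.epsilon fun y => ∃ z, x = ZFSet.pair y z)
  | 5, [.inl x] => .inl (Classical.epsilon fun z => ∃ y, x = ZFSet.pair y z)
  | 6, [.inl f, .inl x] => .inl (Classical.epsilon fun y => ZFSet.pair x y ∈ f)
  | 7, [.inl a, .inl b] =>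
    .inl (Classical.epsilon fun f => f ⊆ ZFSet.prod a b ∧ MapInto f a b ∧ InjectiveOn f a)
  | 8, [.inl x, .inl y] => .inl (Q.upairName x y)
  | 9, [.inl F, .inl σ, .inl ξ] => .inr (valueFml F σ ξ)
  | _, l => l.headD (.inl ∅)

/-- The generic construction with additional operations. Existential closure properties are obtained
by adding one chosen witness for each instance, so the closure remains countable. -/
theorem exists_world (Q : Poset.{u}) {p : ZFSet.{u}} (hp : p ∈ Q.carrier) {X : Set ZFSet.{u}}
    (hX : X.Countable) {Ψ : Set (Fml ZFSet.{u})} (hΨ : Ψ.Countable) :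
    ∃ A Φ G, Q.World A Φ G ∧ X ⊆ A ∧ Ψ ⊆ Φ ∧ p ∈ G := by
  have hω : {x : ZFSet.{u} | x ∈ (omegaSet : ZFSet.{u})}.Countable :=
    injects_omegaSet_iff.1 (injects_univ_iff.2 ⟨.refl _⟩)
  obtain ⟨Y, G, hXY, hop, hpG, hG⟩ := exists_generic Q hp Q.worldOp
    (((hX.union (hω.insert omegaSet)).image Sum.inl).union (hΨ.image Sum.inr))
  have one : ∀ {x}, .inl x ∈ Y → ∀ c ∈ [Sum.inl x], c ∈ Y := by simp
  have two : ∀ {x y}, .inl x ∈ Y → .inl y ∈ Y → ∀ c ∈ [Sum.inl x, Sum.inl y], c ∈ Y := by simp_all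
  refine ⟨Sum.inl ⁻¹' Y, Sum.inr ⁻¹' Y, G, ⟨hG, ?_, ?_, ?_, ?_, ?_, ?_, ?_, ?_, ?_, ?_⟩, ?_, ?_, hpG⟩
  · refine fun x => ⟨fun h => ?_, fun h => hop 0 _ (one h)⟩
    have h' := hop 1 _ (one h)
    have e := Classical.epsilon_spec (p := fun y => Q.check y = Q.check x) ⟨x, rfl⟩
    -- The choice returns `x` itself, because canonical names are injective.
    change Sum.inl (Classical.epsilon fun y => Q.check y = Q.check x) ∈ Y at h'
    rwa [check_injective hp e] at h'
  · exact hXY (Or.inl ⟨_, Or.inr (Set.mem_insert _ _), rfl⟩)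
  · exact fun n hn => hXY (Or.inl ⟨_, Or.inr (Set.mem_insert_of_mem _ hn), rfl⟩)
  · intro x hx y hy hxy
    refine ⟨_, hop 2 _ (two hx hy), Classical.epsilon_spec (p := fun z => ¬ (z ∈ x ↔ z ∈ y)) ?_⟩
    by_contra hcon
    push Not at hcon
    exact hxy (ZFSet.ext fun z => (hcon z))
  · exact fun x hx y hy => hop 3 _ (two hx hy)
  · intro x y h
    have h4 := hop 4 _ (one h)
    have h5 := hop 5 _ (one h)
    change Sum.inl (Classical.epsilon fun y' => ∃ z, ZFSet.pair x y = ZFSet.pair y' z) ∈ Y at h4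
    change Sum.inl (Classical.epsilon fun z => ∃ y', ZFSet.pair x y = ZFSet.pair y' z) ∈ Y at h5
    obtain ⟨_, e4⟩ := Classical.epsilon_spec
      (p := fun y' => ∃ z, ZFSet.pair x y = ZFSet.pair y' z) ⟨x, y, rfl⟩
    obtain ⟨_, e5⟩ := Classical.epsilon_spec
      (p := fun z => ∃ y', ZFSet.pair x y = ZFSet.pair y' z) ⟨y, x, rfl⟩
    rw [← (ZFSet.pair_inj.1 e4).1] at h4
    rw [← (ZFSet.pair_inj.1 e5).2] at h5
    exact ⟨h4, h5⟩
  · exact fun f hf x hx y hy => ⟨_, hop 6 _ (two hf hx),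
      Classical.epsilon_spec (p := fun y => ZFSet.pair x y ∈ f) ⟨y, hy⟩⟩
  · intro a ha b hb hab
    refine ⟨_, hop 7 _ (two ha hb), Classical.epsilon_spec
      (p := fun f => f ⊆ ZFSet.prod a b ∧ MapInto f a b ∧ InjectiveOn f a) ?_⟩
    obtain ⟨f, -, h1, h2⟩ := hab
    obtain ⟨f', h3, h4⟩ := exists_graph_univ a b fun x y => ZFSet.pair x y ∈ f
    refine ⟨f', h3, fun x hx => ?_, fun x hx x' hx' y hy hy' =>
      h2 x hx x' hx' y ((h4 _ _).1 hy).2.2 ((h4 _ _).1 hy').2.2⟩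
    obtain ⟨y, hy, h⟩ := h1 x hx
    refine ⟨y, hy, fun y' => ?_⟩
    rw [h4, h]
    exact ⟨fun h => h.2.2, fun e => ⟨hx, e ▸ hy, e⟩⟩
  · exact fun σ hσ τ hτ => hop 8 _ (two hσ hτ)
  · refine fun F hF σ hσ ξ hξ => hop 9 [.inl F, .inl σ, .inl ξ] ?_
    simp only [List.mem_cons, List.not_mem_nil, or_false]
    rintro c (rfl | rfl | rfl)
    exacts [hF, hσ, hξ]
  · exact fun x hx => hXY (Or.inl ⟨x, Or.inl hx, rfl⟩)
  · exact fun a ha => hXY (Or.inr ⟨a, ha, rfl⟩)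

/-! ### Ground model sets inside a generic model -/

namespace World

variable {Q : Poset.{u}} {A : Set ZFSet.{u}} {Φ : Set (Fml ZFSet.{u})} {G : Set ZFSet.{u}}

variable (Q A G) in
/-- The interpretation of the canonical name of `x`. -/
noncomputable def bar (x : ZFSet.{u}) : ZFSet.{u} := val A G (Q.check x)

/-- The map `bar` is the transitive collapse of `A`: only the elements of `x` that lie in `A` are
retained. -/
theorem mem_bar (hW : Q.World A Φ G) {x z : ZFSet.{u}} :
    z ∈ bar Q A G x ↔ ∃ y ∈ A, y ∈ x ∧ bar Q A G y = z := by
  rw [bar, mem_val]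
  constructor
  · rintro ⟨ρ, hρ, t, ht, h, rfl⟩
    obtain ⟨y, hy, p, hp, h⟩ := mem_check.1 h
    obtain ⟨rfl, rfl⟩ := ZFSet.pair_inj.1 h
    exact ⟨y, (hW.check_mem_iff y).1 hρ, hy, rfl⟩
  · rintro ⟨y, hy, hyx, rfl⟩
    obtain ⟨t, ht⟩ := hW.nonempty
    exact ⟨_, (hW.check_mem_iff y).2 hy, t, ht, mem_check.2 ⟨y, hyx, t, hW.subset t ht, rfl⟩, rfl⟩

theorem bar_mem (hW : Q.World A Φ G) {x : ZFSet.{u}} (hx : x ∈ A) :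
    bar Q A G x ∈ extension Q A G :=
  ⟨_, (hW.check_mem_iff x).2 hx, isName_check x, rfl⟩

theorem bar_mem_bar (hW : Q.World A Φ G) {x y : ZFSet.{u}} (hx : x ∈ A) (h : x ∈ y) :
    bar Q A G x ∈ bar Q A G y := hW.mem_bar.2 ⟨x, hx, h, rfl⟩

/-- The usual argument for collapsing maps: two distinct elements of `A` are told apart by an
element of `A`, to which the induction hypothesis applies. -/
theorem bar_injOn (hW : Q.World A Φ G) :
    ∀ x ∈ A, ∀ y ∈ A, bar Q A G x = bar Q A G y → x = y := by
  intro x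
  induction x using ZFSet.inductionOn with
  | _ x ih =>
    intro hx y hy h
    by_contra hxy
    obtain ⟨z, hz, hzxy⟩ := hW.separates x hx y hy hxy
    by_cases hzx : z ∈ x
    · have := hW.bar_mem_bar hz hzx
      rw [h] at this
      obtain ⟨z', hz', hz'y, e⟩ := hW.mem_bar.1 this
      rw [← ih z hzx hz z' hz' e.symm] at hz'y
      exact hzxy ⟨fun _ => hz'y, fun _ => hzx⟩
    · have hzy : z ∈ y := by tauto
      have := hW.bar_mem_bar hz hzy
      rw [← h] at this
      obtain ⟨z', hz', hz'x, e⟩ := hW.mem_bar.1 this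
      rw [ih z' hz'x hz' z hz e] at hz'x
      exact hzx hz'x

theorem bar_mem_bar_iff (hW : Q.World A Φ G) {x y : ZFSet.{u}} (hx : x ∈ A) :
    bar Q A G x ∈ bar Q A G y ↔ x ∈ y := by
  refine ⟨fun h => ?_, hW.bar_mem_bar hx⟩
  obtain ⟨z, hz, hzy, e⟩ := hW.mem_bar.1 h
  rwa [← hW.bar_injOn z hz x hx e]

theorem bar_subset_bar (hW : Q.World A Φ G) {x y : ZFSet.{u}} (h : x ⊆ y) :
    bar Q A G x ⊆ bar Q A G y := by
  intro z hz
  obtain ⟨t, ht, htx, rfl⟩ := hW.mem_bar.1 hz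
  exact hW.bar_mem_bar ht (h htx)

theorem pairClosed (hW : Q.World A Φ G) : PairClosed (extension Q A G) where
  trans := by
    rintro _ ⟨τ, hτ, hτn, rfl⟩ y hy
    obtain ⟨ρ, hρ, t, ht, h, rfl⟩ := mem_val.1 hy
    cases hτn with
    | intro _ h1 h2 => exact ⟨ρ, hρ, h2 ρ t h, rfl⟩
  upair := by
    rintro _ ⟨σ, hσ, hσn, rfl⟩ _ ⟨τ, hτ, hτn, rfl⟩
    refine ⟨_, hW.upairName σ hσ τ hτ, isName_upairName hσn hτn, ?_⟩
    obtain ⟨p, hp⟩ := hW.nonempty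
    ext z
    rw [mem_val, ZFSet.mem_pair]
    constructor
    · rintro ⟨ρ, hρ, t, ht, h, rfl⟩
      rcases ZFSet.mem_pair.1 (ZFSet.pair_mem_prod.1 h).1 with rfl | rfl
      · exact Or.inl rfl
      · exact Or.inr rfl
    · rintro (rfl | rfl)
      · exact ⟨σ, hσ, p, hp, ZFSet.pair_mem_prod.2 ⟨by simp, hW.subset p hp⟩, rfl⟩
      · exact ⟨τ, hτ, p, hp, ZFSet.pair_mem_prod.2 ⟨by simp, hW.subset p hp⟩, rfl⟩

theorem bar_upair (hW : Q.World A Φ G) {x y : ZFSet.{u}} (hx : x ∈ A) (hy : y ∈ A) :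
    bar Q A G {x, y} = {bar Q A G x, bar Q A G y} := by
  ext z
  rw [hW.mem_bar, ZFSet.mem_pair]
  constructor
  · rintro ⟨t, -, ht, rfl⟩
    rcases ZFSet.mem_pair.1 ht with rfl | rfl
    · exact Or.inl rfl
    · exact Or.inr rfl
  · rintro (rfl | rfl)
    · exact ⟨x, hx, by simp, rfl⟩
    · exact ⟨y, hy, by simp, rfl⟩

theorem bar_pair (hW : Q.World A Φ G) {x y : ZFSet.{u}} (hx : x ∈ A) (hy : y ∈ A) :
    bar Q A G (ZFSet.pair x y) = ZFSet.pair (bar Q A G x) (bar Q A G y) := by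
  have h := hW.upair x hx x hx
  have e := hW.bar_upair hx hx
  rw [ZFSet.pair_eq_singleton] at h e
  rw [ZFSet.pair_eq_singleton] at e
  rw [ZFSet.pair, hW.bar_upair h (hW.upair x hx y hy), hW.bar_upair hx hy, e, ZFSet.pair]

theorem pair_mem (hW : Q.World A Φ G) {x y : ZFSet.{u}} (hx : x ∈ A) (hy : y ∈ A) :
    ZFSet.pair x y ∈ A := by
  have h := hW.upair x hx x hx
  rw [ZFSet.pair_eq_singleton] at h
  exact hW.upair _ h _ (hW.upair x hx y hy)

/-- All natural numbers are in `A`, so nothing is lost in the collapse below ω. Hence finiteness and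
countability refer to the true ω. -/
theorem bar_omegaSet (hW : Q.World A Φ G) : bar Q A G omegaSet = omegaSet := by
  have key : ∀ x : ZFSet.{u}, x ⊆ omegaSet → bar Q A G x = x := by
    intro x
    induction x using ZFSet.inductionOn with
    | _ x ih =>
      intro hx
      have e : ∀ y ∈ x, bar Q A G y = y := fun y hy =>
        ih y hy (isOrdinal_omegaSet.subset_of_mem (hx hy))
      ext z
      rw [hW.mem_bar]
      constructor
      · rintro ⟨y, -, hy, rfl⟩
        rwa [e y hy]
      · intro hz
        exact ⟨z, hW.nat_mem z (hx hz), hz, e z hz⟩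
  exact key _ fun _ => id

theorem omegaSet_mem (hW : Q.World A Φ G) : omegaSet ∈ extension Q A G := by
  have := hW.bar_mem hW.omega_mem
  rwa [hW.bar_omegaSet] at this

theorem pair_mem_bar_iff (hW : Q.World A Φ G) {f x y' : ZFSet.{u}}
    (hf : ∀ p ∈ f, ∃ x y, p = ZFSet.pair x y) (hx : x ∈ A) :
    ZFSet.pair (bar Q A G x) y' ∈ bar Q A G f ↔
      ∃ y ∈ A, ZFSet.pair x y ∈ f ∧ bar Q A G y = y' := by
  rw [hW.mem_bar]
  constructor
  · rintro ⟨p, hp, hpf, h⟩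
    obtain ⟨x', y, rfl⟩ := hf p hpf
    obtain ⟨hx', hy⟩ := hW.of_pair _ _ hp
    rw [hW.bar_pair hx' hy] at h
    obtain ⟨h1, h2⟩ := ZFSet.pair_inj.1 h
    obtain rfl := hW.bar_injOn x' hx' x hx h1
    exact ⟨y, hy, hpf, h2⟩
  · rintro ⟨y, hy, h, rfl⟩
    exact ⟨_, hW.pair_mem hx hy, h, hW.bar_pair hx hy⟩

theorem mapInto_bar (hW : Q.World A Φ G) {f a b : ZFSet.{u}} (hfA : f ∈ A)
    (hf : ∀ p ∈ f, ∃ x y, p = ZFSet.pair x y) (h : MapInto f a b) :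
    MapInto (bar Q A G f) (bar Q A G a) (bar Q A G b) := by
  intro _ hx'
  obtain ⟨x, hxA, hx, rfl⟩ := hW.mem_bar.1 hx'
  obtain ⟨y, -, hxy⟩ := h.exists hx
  obtain ⟨y, hyA, hxy⟩ := hW.value f hfA x hxA y hxy
  refine ⟨_, hW.bar_mem_bar hyA (h.mem hx hxy), fun y' => ?_⟩
  rw [hW.pair_mem_bar_iff hf hxA]
  constructor
  · rintro ⟨z, hz, hxz, rfl⟩
    rw [h.unique hx hxz hxy]
  · rintro rfl
    exact ⟨y, hyA, hxy, rfl⟩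

/-- Some injection of `a` into `b` is an element of `A`, and its collapse is an injection of the
collapsed sets. In this way ground model countability survives. -/
theorem injects_bar (hW : Q.World A Φ G) {a b : ZFSet.{u}} (ha : a ∈ A) (hb : b ∈ A)
    (h : Injects Set.univ a b) : Injects (extension Q A G) (bar Q A G a) (bar Q A G b) := by
  obtain ⟨f, hf, hfs, h1, h2⟩ := hW.injection a ha b hb h
  have hfr : ∀ p ∈ f, ∃ x y, p = ZFSet.pair x y := by
    intro p hp
    obtain ⟨x, -, y, -, h⟩ := ZFSet.mem_prod.1 (hfs hp)
    exact ⟨x, y, h⟩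
  refine ⟨_, hW.bar_mem hf, hW.mapInto_bar hf hfr h1, fun _ m _ m' z hz hz' => ?_⟩
  obtain ⟨x, hxA, hx, rfl⟩ := hW.mem_bar.1 m
  obtain ⟨x', hxA', hx', rfl⟩ := hW.mem_bar.1 m'
  obtain ⟨y, hy, hxy, e⟩ := (hW.pair_mem_bar_iff hfr hxA).1 hz
  obtain ⟨y', hy', hxy', e'⟩ := (hW.pair_mem_bar_iff hfr hxA').1 hz'
  obtain rfl := hW.bar_injOn y hy y' hy' (e.trans e'.symm)
  rw [h2 x hx x' hx' y hxy hxy']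

end World

end Poset

/-! ### Lifting stationary sets to elementary submodels -/

theorem exists_mem_of_ne_empty {x : ZFSet.{u}} (h : x ≠ ∅) : ∃ y, y ∈ x := by
  by_contra hcon
  push Not at hcon
  exact h ((ZFSet.eq_empty x).2 hcon)

/-! ### Skolem functions for set structures -/

section Skolem

open FirstOrder Cardinal

theorem countable_formulas {α : Type v} [IsEmpty α] :
    Countable (Σ n, expLang.BoundedFormula α n) := by
  have hF : IsEmpty (Σ n, expLang.Functions n) := ⟨fun f => nomatch f.2⟩
  have hR : Countable (Σ n, expLang.Relations n) := by
    refine (show Function.Injective (Sigma.fst : (Σ n, expLang.Relations n) → ℕ) from ?_).countable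
    rintro ⟨n, r⟩ ⟨m, s⟩ h
    cases r <;> cases s <;> first | rfl | simp at h
  have hL : Countable expLang.Symbols :=
    inferInstanceAs (Countable ((Σ n, expLang.Functions n) ⊕ Σ n, expLang.Relations n))
  rw [← mk_le_aleph0_iff]
  refine Language.BoundedFormula.card_le.trans ?_
  have : expLang.card ≤ ℵ₀ := mk_le_aleph0_iff.2 hL
  simpa using this

/-- Skolem functions. -/
theorem exists_skolem (H : ZFSet.{u}) (A : Set ZFSet.{u}) (hH : H ≠ ∅) :
    ∃ (ι : Type (u + 1)) (_ : Countable ι) (op : ι → List ZFSet.{u} → ZFSet.{u}),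
      (∀ i l, op i l ∈ H) ∧
      ∀ M : ZFSet.{u}, M ⊆ H → (∀ i l, (∀ a ∈ l, a ∈ M) → op i l ∈ M) → ElemSub M H A := by
  classical
  obtain ⟨c, hc⟩ := exists_mem_of_ne_empty hH
  let ι := Σ n, expLang.BoundedFormula {x : ZFSet.{u} // x ∈ (∅ : Set ZFSet.{u})} n
  have : IsEmpty {x : ZFSet.{u} // x ∈ (∅ : Set ZFSet.{u})} := ⟨fun x => x.2⟩
  let := expStructure H A
  -- The parameters followed by the proposed witness are read off as the tuple of free variables.
  -- Without a witness, the Skolem function returns a fixed element of `H`.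
  let R : ι → List ZFSet.{u} → ZFSet.{u} → Prop := fun i l y =>
    ∃ xs : Fin i.1 → {x : ZFSet.{u} // x ∈ H},
      (∀ k, (xs k).1 = (l ++ [y]).getD k ∅) ∧ i.2.Realize (fun c => (c.2 : False).elim) xs
  let op : ι → List ZFSet.{u} → ZFSet.{u} := fun i l =>
    if h : ∃ y ∈ H, R i l y then h.choose else c
  refine ⟨ι, countable_formulas, op, fun i l => ?_, fun M hMH hM => ElemSub.of_exists hMH ?_⟩
  · by_cases h : ∃ y ∈ H, R i l y
    · simp only [op, h, dif_pos]
      exact h.choose_spec.1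
    · simp only [op, h, dif_neg, not_false_eq_true]
      exact hc
  · rintro n P hP a ha ⟨y, hy, hPy⟩
    obtain ⟨φ, hφ⟩ := StrictDfn.exists_formula (L := expLang) (inst := expStructure H A)
      (U := {x | x ∈ H}) (Set.empty_subset _)
      ExpRel.mem (fun x y => Iff.rfl) (Or.inl ⟨ExpRel.pred, fun x => Iff.rfl⟩) hP
    have hval : (fun c : {x : ZFSet.{u} // x ∈ (∅ : Set ZFSet.{u})} =>
      ((c.2 : False).elim : {x : ZFSet.{u} // x ∈ H})) =
        fun c => ⟨c.1, Set.empty_subset {x | x ∈ H} c.2⟩ := funext fun c => (c.2 : False).elim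
    have hget : ∀ (z : ZFSet.{u}) (k : Fin (n + 1)),
        (List.ofFn a ++ [z]).getD k ∅ = (Fin.snoc a z : Fin (n + 1) → ZFSet.{u}) k := by
      intro z k
      refine Fin.lastCases ?_ (fun k => ?_) k
      · simp [List.getD_eq_getElem?_getD]
      · simp [List.getD_eq_getElem?_getD]
    have hR : ∀ z, R ⟨n + 1, φ⟩ (List.ofFn a) z → P (Fin.snoc a z) := by
      rintro z ⟨xs, h1, h2⟩
      rw [hval] at h2
      have h3 := (hφ xs).1 h2
      have : (fun i => (xs i).1) = (Fin.snoc a z : Fin (n + 1) → ZFSet.{u}) :=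
        funext fun k => (h1 k).trans (hget z k)
      rwa [this] at h3
    have hex : ∃ z ∈ H, R ⟨n + 1, φ⟩ (List.ofFn a) z := by
      refine ⟨y, hy, Fin.snoc (fun i => ⟨a i, hMH (ha i)⟩) ⟨y, hy⟩, fun k => ?_, ?_⟩
      · rw [hget]
        refine Fin.lastCases ?_ (fun k => ?_) k <;> simp
      · rw [hval, hφ]
        convert hPy using 1
        funext k
        refine Fin.lastCases ?_ (fun k => ?_) k <;> simp
    refine ⟨op ⟨n + 1, φ⟩ (List.ofFn a), hM _ _ fun b hb => ?_, hR _ ?_⟩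
    · obtain ⟨i, rfl⟩ := List.mem_ofFn.1 hb
      exact ha i
    · have : op ⟨n + 1, φ⟩ (List.ofFn a) = hex.choose := dif_pos hex
      rw [this]
      exact hex.choose_spec.2

end Skolem

/-! ### Closing members of a stationary set under countably many operations -/

section Kueker

/-- `e` and `n` are coded by `e ∪ {t}`, where the rank of `t` is the maximal rank of
elements of `e` plus `n + 1`. -/
def Codes (e' e : ZFSet.{u}) (n : ℕ) : Prop :=
  ∃ t, e' = insert t e ∧ (∀ a ∈ e, a.rank + (n + 1 : ℕ) ≤ t.rank) ∧
    ∃ a ∈ e, a.rank + (n + 1 : ℕ) = t.rank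

theorem rank_lt_of_add_le {a t : ZFSet.{u}} {n : ℕ} (h : a.rank + (n + 1 : ℕ) ≤ t.rank) :
    a.rank < t.rank := by
  refine lt_of_lt_of_le ?_ h
  exact lt_add_of_pos_right _ (by exact_mod_cast Nat.succ_pos n)

/-- The added point is the element of largest rank, and the excess of its rank over the other ranks
gives the number. -/
theorem Codes.unique {e' e₁ e₂ : ZFSet.{u}} {n₁ n₂ : ℕ} (h₁ : Codes e' e₁ n₁)
    (h₂ : Codes e' e₂ n₂) : e₁ = e₂ ∧ n₁ = n₂ := by
  obtain ⟨t₁, rfl, le₁, a₁, ha₁, eq₁⟩ := h₁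
  obtain ⟨t₂, h, le₂, a₂, ha₂, eq₂⟩ := h₂
  have key : t₁ = t₂ := by
    have m₁ : t₁ ∈ insert t₂ e₂ := h ▸ ZFSet.mem_insert _ _
    have m₂ : t₂ ∈ insert t₁ e₁ := h ▸ ZFSet.mem_insert _ _
    rcases ZFSet.mem_insert_iff.1 m₁ with m₁ | m₁
    · exact m₁
    rcases ZFSet.mem_insert_iff.1 m₂ with m₂ | m₂
    · exact m₂.symm
    exact (lt_asymm (rank_lt_of_add_le (le₂ _ m₁)) (rank_lt_of_add_le (le₁ _ m₂))).elim
  subst key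
  have n₁' : t₁ ∉ e₁ := fun h => lt_irrefl _ (rank_lt_of_add_le (le₁ _ h))
  have n₂' : t₁ ∉ e₂ := fun h => lt_irrefl _ (rank_lt_of_add_le (le₂ _ h))
  have e : e₁ = e₂ := by
    ext z
    have hz : z ∈ insert t₁ e₁ ↔ z ∈ insert t₁ e₂ := by rw [h]
    rw [ZFSet.mem_insert_iff, ZFSet.mem_insert_iff] at hz
    constructor
    · intro hz'
      rcases hz.1 (Or.inr hz') with rfl | h
      · exact (n₁' hz').elim
      · exact h
    · intro hz'
      rcases hz.2 (Or.inr hz') with rfl | h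
      · exact (n₂' hz').elim
      · exact h
  subst e
  refine ⟨rfl, ?_⟩
  have l₁ := (le₁ _ ha₂).trans eq₂.ge
  have l₂ := (le₂ _ ha₁).trans eq₁.ge
  rw [add_le_add_iff_left, Nat.cast_le] at l₁ l₂
  omega

/-- Passing to the singleton raises the rank by one. Starting from an element of maximal rank, n + 1
such steps give the point to be added. -/
theorem exists_codes {x e : ZFSet.{u}} (hx : ∀ a ∈ x, {a} ∈ x) (he : {y | y ∈ e}.Finite)
    (hne : e ≠ ∅) (hex : e ⊆ x) (n : ℕ) :
    ∃ e' : ZFSet.{u}, {y | y ∈ e'}.Finite ∧ e' ⊆ x ∧ Codes e' e n := by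
  obtain ⟨a, ha, hmax⟩ := he.exists_maximalFor ZFSet.rank _ (exists_mem_of_ne_empty hne)
  have : ∀ m : ℕ, ∃ t ∈ x, t.rank = a.rank + m := by
    intro m
    induction m with
    | zero => exact ⟨a, hex ha, by simp⟩
    | succ m ih =>
      obtain ⟨t, ht, e⟩ := ih
      refine ⟨{t}, hx t ht, ?_⟩
      rw [ZFSet.rank_singleton, e, Order.succ_eq_add_one, Nat.cast_succ, add_assoc]
  obtain ⟨t, ht, htr⟩ := this (n + 1)
  refine ⟨insert t e, ?_, ?_, t, rfl, fun b hb => ?_, a, ha, htr.symm⟩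
  · refine (he.insert t).subset fun y hy => ?_
    exact ZFSet.mem_insert_iff.1 hy
  · intro y hy
    rcases ZFSet.mem_insert_iff.1 hy with rfl | hy
    · exact ht
    · exact hex hy
  · rw [htr]
    have : b.rank ≤ a.rank := (le_total b.rank a.rank).elim id fun h => hmax hb h
    gcongr

/-- Stationary sets are closed under countably many finitary operations. -/
theorem StatIn.exists_closed {S K : ZFSet.{u}} (hst : StatIn Set.univ S K)
    (hK : ∀ a ∈ K, {a} ∈ K) {c : ZFSet.{u}} (hc : c ∈ K) {h : ℕ → ZFSet.{u} → ZFSet.{u}}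
    (hh : ∀ n e, h n e ∈ K) :
    ∃ x ∈ S, c ∈ x ∧ ∀ n e, {y | y ∈ e}.Finite → e ≠ ∅ → e ⊆ x → h n e ∈ x := by
  classical
  -- One operation does three things: on codes it carries out the coded operation, on other
  -- singletons it returns the argument, which closes sets under a ↦ {a} and makes codes available,
  -- and at ∅ it returns `c`.
  let F : ZFSet.{u} → ZFSet.{u} := fun e' =>
    if H : ∃ e n, Codes e' e n then h H.choose_spec.choose H.choose
    else if H : ∃ a ∈ K, e' = {a} then {H.choose} else c
  have hFK : ∀ e, F e ∈ K := by
    intro e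
    simp only [F]
    split_ifs with h1 h2
    · exact hh _ _
    · exact hK _ h2.choose_spec.1
    · exact hc
  have hF1 : ∀ {e' e n}, Codes e' e n → F e' = h n e := by
    intro e' e n hco
    have H : ∃ e n, Codes e' e n := ⟨e, n, hco⟩
    simp only [F, H, dif_pos]
    obtain ⟨e1, e2⟩ := H.choose_spec.choose_spec.unique hco
    rw [e2, e1]
  have hF2 : ∀ {a}, a ∈ K → F {a} = {a} := by
    intro a ha
    have h1 : ¬ ∃ e n, Codes {a} e n := by
      rintro ⟨e, n, t, e1, e2, b, hb, -⟩
      have hbt : b ∈ insert t e := ZFSet.mem_insert_iff.2 (Or.inr hb)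
      have htt : t ∈ insert t e := ZFSet.mem_insert _ _
      rw [← e1, ZFSet.mem_singleton] at hbt htt
      have := rank_lt_of_add_le (e2 b hb)
      rw [hbt, htt] at this
      exact lt_irrefl _ this
    have h2 : ∃ b ∈ K, ({a} : ZFSet.{u}) = {b} := ⟨a, ha, rfl⟩
    simp only [F, h1, h2, dif_neg, dif_pos, not_false_eq_true]
    exact h2.choose_spec.2.symm
  have hF3 : F ∅ = c := by
    have h1 : ¬ ∃ e n, Codes ∅ e n := by
      rintro ⟨e, n, t, e1, -⟩
      exact ZFSet.notMem_empty t (e1 ▸ ZFSet.mem_insert t e)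
    have h2 : ¬ ∃ a ∈ K, (∅ : ZFSet.{u}) = {a} := by
      rintro ⟨a, -, e⟩
      exact ZFSet.notMem_empty a (e ▸ ZFSet.mem_singleton.2 rfl)
    exact (dif_neg h1).trans (dif_neg h2)
  obtain ⟨f, -, hf⟩ := exists_graph_univ (ZFSet.powerset K) K fun e y => y = F e
  have hfe : ∀ {e y}, e ⊆ K → (ZFSet.pair e y ∈ f ↔ y = F e) := by
    intro e y he
    rw [hf, ZFSet.mem_powerset]
    exact ⟨fun h => h.2.2, fun h => ⟨he, h ▸ hFK e, h⟩⟩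
  obtain ⟨x, hxS, hx⟩ := hst.2 f trivial fun e _ he _ => ⟨F e, hFK e, fun y' => hfe he⟩
  have hxK := (hst.1 x hxS).1
  have hcl : ∀ {e}, {y | y ∈ e}.Finite → e ⊆ x → F e ∈ x := fun {e} hfin he =>
    hx e trivial he (finIn_univ hfin) _ ((hfe fun y hy => hxK (he hy)).2 rfl)
  refine ⟨x, hxS, ?_, fun n e hfin hne hex => ?_⟩
  · rw [← hF3]
    exact hcl (by simp) fun y hy => (ZFSet.notMem_empty y hy).elim
  · have hsing : ∀ a ∈ x, {a} ∈ x := by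
      intro a ha
      rw [← hF2 (hxK ha)]
      refine hcl (by simp) fun y hy => ?_
      rw [ZFSet.mem_singleton.1 hy]
      exact ha
    obtain ⟨e', h1, h2, h3⟩ := exists_codes hsing hfin hne hex n
    rw [← hF1 h3]
    exact hcl h1 h2

/-- `M` is the closure of some x ∈ S under Skolem functions and the given operations. The point is
that M ∩ K = x. To ensure it, `x` is chosen closed under maps that list, for each finite set e ⊆ K,
all elements of `K` in the closure of `e`. -/
theorem StatIn.exists_elemSub {S K H : ZFSet.{u}} {A : Set ZFSet.{u}}
    (hst : StatIn Set.univ S K) (hK : ∀ a ∈ K, {a} ∈ K) (hKH : K ⊆ H) {c : ZFSet.{u}}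
    (hc : c ∈ K) {ι : Type (u + 1)} [Countable ι] (op : ι → List ZFSet.{u} → ZFSet.{u})
    (hop : ∀ i l, (∀ a ∈ l, a ∈ H) → op i l ∈ H) :
    ∃ M, {x | x ∈ M}.Countable ∧ ElemSub M H A ∧
      (∀ i l, (∀ a ∈ l, a ∈ M) → op i l ∈ M) ∧ M ∩ K ∈ S := by
  obtain ⟨κ, _, sk, hsk, hElem⟩ := exists_skolem H A fun h => ZFSet.notMem_empty c (h ▸ hKH hc)
  let all : ι ⊕ κ → List ZFSet.{u} → ZFSet.{u} := Sum.elim op sk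
  have hall : ∀ {X : Set ZFSet.{u}}, X ⊆ {x | x ∈ K} → opHull all X ⊆ {x | x ∈ H} := by
    intro X hX
    refine opHull_subset (fun x hx => hKH (hX hx)) fun i l hl => ?_
    rcases i with i | i
    · exact hop i l hl
    · exact hsk i l
  have hex : ∀ e : ZFSet.{u}, ∃ g : ℕ → ZFSet.{u}, (∀ n, g n ∈ K) ∧
      ({y | y ∈ e}.Finite → e ≠ ∅ → e ⊆ K →
        ∀ y, y ∈ opHull all {y | y ∈ e} → y ∈ K → ∃ n, g n = y) := by
    intro e
    by_cases he : {y | y ∈ e}.Finite ∧ e ≠ ∅ ∧ e ⊆ K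
    · obtain ⟨he1, he2, he3⟩ := he
      obtain ⟨b, hb⟩ := exists_mem_of_ne_empty he2
      have hcount : (opHull all {y | y ∈ e} ∩ {y | y ∈ K}).Countable :=
        (countable_opHull he1.countable).mono Set.inter_subset_left
      obtain ⟨g, hg⟩ := hcount.exists_eq_range ⟨b, subset_opHull hb, he3 hb⟩
      refine ⟨g, fun n => ?_, fun _ _ _ y hy hyK => ?_⟩
      · have : g n ∈ opHull all {y | y ∈ e} ∩ {y | y ∈ K} := hg ▸ Set.mem_range_self n
        exact this.2
      · have : y ∈ opHull all {y | y ∈ e} ∩ {y | y ∈ K} := ⟨hy, hyK⟩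
        rw [hg] at this
        exact this
    · exact ⟨fun _ => c, fun _ => hc, fun h1 h2 h3 => (he ⟨h1, h2, h3⟩).elim⟩
  choose g hg hg' using hex
  obtain ⟨x, hxS, hcx, hx⟩ := hst.exists_closed hK hc (h := fun n e => g e n) fun n e => hg e n
  obtain ⟨hxK, hxc⟩ := hst.1 x hxS
  have hMc : (opHull all {y | y ∈ x}).Countable :=
    countable_opHull (injects_omegaSet_iff.1 hxc)
  have := hMc.to_subtype
  obtain ⟨M, hM⟩ := exists_zfset_of_small (opHull all {y | y ∈ x})
  have hMset : {y | y ∈ M} = opHull all {y | y ∈ x} := Set.ext hM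
  have hcl : ∀ i l, (∀ a ∈ l, a ∈ M) → all i l ∈ M := fun i l hl =>
    (hM _).2 (op_mem_opHull i fun a ha => (hM a).1 (hl a ha))
  refine ⟨M, hMset ▸ hMc, hElem M (fun y hy => hall (fun z hz => hxK hz) ((hM y).1 hy))
    fun i l hl => hcl (.inr i) l hl, fun i l hl => hcl (.inl i) l hl, ?_⟩
  have : M ∩ K = x := by
    ext y
    rw [ZFSet.mem_inter, hM]
    refine ⟨fun ⟨hy, hyK⟩ => ?_, fun hy => ⟨subset_opHull hy, hxK hy⟩⟩
    -- Only nonempty finite sets can be coded, so `c` is added to the support of `y`.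
    obtain ⟨e, he1, he2, he3⟩ := exists_finite_of_mem_opHull hy
    have := (he2.insert c).countable.to_subtype
    obtain ⟨e', he'⟩ := exists_zfset_of_small (insert c e)
    have hset : {y | y ∈ e'} = insert c e := Set.ext he'
    have hsub : e' ⊆ x := by
      intro z hz
      rcases (he' z).1 hz with rfl | hz
      · exact hcx
      · exact he1 hz
    have hne : e' ≠ ∅ := by
      rintro rfl
      exact ZFSet.notMem_empty c ((he' c).2 (Set.mem_insert _ _))
    have hfin : {y | y ∈ e'}.Finite := hset ▸ he2.insert c
    obtain ⟨n, rfl⟩ := hg' e' hfin hne (fun z hz => hxK (hsub hz)) y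
      (opHull_mono (hset ▸ Set.subset_insert c e) he3) hyK
    exact hx n e' hfin hne hsub
  rwa [this]

end Kueker

namespace Poset

/-! ### Interpretation of set-theoretic formulas -/

/-- `x` is the interpretation of the name `σ ∈ A`. -/
def Denotes (A G : Set ZFSet.{u}) (σ x : ZFSet.{u}) : Prop := σ ∈ A ∧ val A G σ = x

namespace Interprets

variable {Q : Poset.{u}} {A G : Set ZFSet.{u}} {a a' b b' : Fml ZFSet.{u}}
  {f f' : ZFSet.{u} → Fml ZFSet.{u}} {σ τ ρ x y z : ZFSet.{u}}

/-- As quantifiers are functions on names, nothing general says that a formula treats names with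
equal interpretations alike. This is checked for each notion used, starting with the atoms. -/
theorem mem' (h : Denotes A G σ x) (h' : Denotes A G τ y) :
    Interprets Q A G (.mem σ τ) (.mem x y) := .mem h.1 h'.1 h.2 h'.2

theorem eq' (h : Denotes A G σ x) (h' : Denotes A G τ y) :
    Interprets Q A G (.eq σ τ) (.eq x y) := .eq h.1 h'.1 h.2 h'.2

theorem all' (h : ∀ {τ x}, Denotes A G τ x → Interprets Q A G (f τ) (f' x)) :
    Interprets Q A G (.all f) (.all f') := .all fun _ hτ _ e => h ⟨hτ, e⟩

theorem ex (h : ∀ {τ x}, Denotes A G τ x → Interprets Q A G (f τ) (f' x)) :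
    Interprets Q A G (.ex f) (.ex f') := (all' fun hd => (h hd).neg).neg

theorem or (h : Interprets Q A G a a') (h' : Interprets Q A G b b') :
    Interprets Q A G (.or a b) (.or a' b') := (h.neg.and h'.neg).neg

theorem imp (h : Interprets Q A G a a') (h' : Interprets Q A G b b') :
    Interprets Q A G (.imp a b) (.imp a' b') := (h.and h'.neg).neg

theorem iff (h : Interprets Q A G a a') (h' : Interprets Q A G b b') :
    Interprets Q A G (.iff a b) (.iff a' b') := (h.imp h').and (h'.imp h)

theorem allIn (hs : Denotes A G σ x)
    (h : ∀ {τ y}, Denotes A G τ y → Interprets Q A G (f τ) (f' y)) :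
    Interprets Q A G (.allIn σ f) (.allIn x f') := all' fun hd => (mem' hd hs).imp (h hd)

theorem exIn (hs : Denotes A G σ x)
    (h : ∀ {τ y}, Denotes A G τ y → Interprets Q A G (f τ) (f' y)) :
    Interprets Q A G (.exIn σ f) (.exIn x f') := ex fun hd => (mem' hd hs).and (h hd)

theorem sub (h : Denotes A G σ x) (h' : Denotes A G τ y) :
    Interprets Q A G (.sub σ τ) (.sub x y) := allIn h fun hd => mem' hd h'

theorem isUPair (h : Denotes A G ρ z) (h₁ : Denotes A G σ x) (h₂ : Denotes A G τ y) :
    Interprets Q A G (.isUPair ρ σ τ) (.isUPair z x y) :=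
  all' fun hd => (mem' hd h).iff ((eq' hd h₁).or (eq' hd h₂))

theorem isPair (h : Denotes A G ρ z) (h₁ : Denotes A G σ x) (h₂ : Denotes A G τ y) :
    Interprets Q A G (.isPair ρ σ τ) (.isPair z x y) :=
  ex fun k₁ => ex fun k₂ => (isUPair k₁ h₁ h₁).and ((isUPair k₂ h₁ h₂).and (isUPair h k₁ k₂))

theorem pairMem (h₁ : Denotes A G σ x) (h₂ : Denotes A G τ y) (h : Denotes A G ρ z) :
    Interprets Q A G (.pairMem σ τ ρ) (.pairMem x y z) :=
  ex fun hd => (isPair hd h₁ h₂).and (mem' hd h)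

theorem isMap (h : Denotes A G ρ z) (h₁ : Denotes A G σ x) (h₂ : Denotes A G τ y) :
    Interprets Q A G (.isMap ρ σ τ) (.isMap z x y) :=
  allIn h₁ fun k₁ => exIn h₂ fun k₂ => all' fun k₃ => (pairMem k₁ k₃ h).iff (eq' k₃ k₂)

theorem injects (h₁ : Denotes A G σ x) (h₂ : Denotes A G τ y) :
    Interprets Q A G (.injects σ τ) (.injects x y) :=
  ex fun h => (isMap h h₁ h₂).and (allIn h₁ fun k₁ => allIn h₁ fun k₂ => all' fun k =>
    ((pairMem k₁ k h).and (pairMem k₂ k h)).imp (eq' k₁ k₂))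

theorem transSet (h : Denotes A G σ x) : Interprets Q A G (.transSet σ) (.transSet x) :=
  allIn h fun k => sub k h

theorem isOrd (h : Denotes A G σ x) : Interprets Q A G (.isOrd σ) (.isOrd x) :=
  (transSet h).and (allIn h transSet)

theorem isEmpty (h : Denotes A G σ x) : Interprets Q A G (.isEmpty σ) (.isEmpty x) :=
  all' fun k => (mem' k h).neg

theorem isSucc (h : Denotes A G σ x) (h' : Denotes A G τ y) :
    Interprets Q A G (.isSucc σ τ) (.isSucc x y) :=
  all' fun k => (mem' k h).iff ((mem' k h').or (eq' k h'))

theorem isLimit (h : Denotes A G σ x) : Interprets Q A G (.isLimit σ) (.isLimit x) :=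
  (isOrd h).and ((isEmpty h).neg.and (allIn h fun k => exIn h fun k' => mem' k k'))

theorem isOmega (h : Denotes A G σ x) : Interprets Q A G (.isOmega σ) (.isOmega x) :=
  (isLimit h).and (allIn h fun k => (isEmpty k).or (ex fun k' => isSucc k k'))

theorem ctbl (h : Denotes A G σ x) : Interprets Q A G (.ctbl σ) (.ctbl x) :=
  ex fun k => (isOmega k).and (injects h k)

theorem fin (h : Denotes A G σ x) : Interprets Q A G (.fin σ) (.fin x) :=
  ex fun k => (isOmega k).and (exIn k fun k' => injects h k')

theorem isOmega1 (h : Denotes A G σ x) : Interprets Q A G (.isOmega1 σ) (.isOmega1 x) :=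
  (isOrd h).and ((ctbl h).neg.and (allIn h ctbl))

theorem isFinOp (h : Denotes A G σ x) (h' : Denotes A G τ y) :
    Interprets Q A G (.isFinOp σ τ) (.isFinOp x y) :=
  all' fun k => ((sub k h').and (fin k)).imp
    (exIn h' fun k₁ => all' fun k₂ => (pairMem k k₂ h).iff (eq' k₂ k₁))

theorem closedUnder (h : Denotes A G σ x) (h' : Denotes A G τ y) :
    Interprets Q A G (.closedUnder σ τ) (.closedUnder x y) :=
  all' fun k => ((sub k h).and (fin k)).imp (all' fun k₁ => (pairMem k k₁ h').imp (mem' k₁ h))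

theorem sqsub (h : Denotes A G σ x) (h' : Denotes A G τ y) :
    Interprets Q A G (.sqsub σ τ) (.sqsub x y) :=
  (sub h h').and (ex fun k => (isOmega1 k).and
    ((allIn h fun k₁ => (mem' k₁ k).imp (sub k₁ h)).and
      ((allIn h' fun k₁ => (mem' k₁ k).imp (sub k₁ h')).and
        (allIn k fun k₁ => (mem' k₁ h).iff (mem' k₁ h')))))

theorem valueFml (h : Denotes A G ρ z) (h₁ : Denotes A G σ x) (h₂ : Denotes A G τ y) :
    Interprets Q A G (valueFml ρ σ τ) (valueFml z x y) :=
  ex fun k => (pairMem h₁ k h).and (mem' h₂ k)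

end Interprets

/-! ### Names for the values of named functions -/

section ValueName

variable {Q : Poset.{u}} {A : Set ZFSet.{u}} {Φ : Set (Fml ZFSet.{u})} {G : Set ZFSet.{u}}

/-- A name for the value of `F` at `σ`, provided that it is a subset of `w`. -/
noncomputable def valueName (Q : Poset.{u}) (w F σ : ZFSet.{u}) : ZFSet.{u} :=
  ZFSet.sep (fun z => ∃ ξ s, z = ZFSet.pair (Q.check ξ) s ∧
    Q.Forces s (Poset.valueFml F σ (Q.check ξ)))
    (ZFSet.prod (ZFSet.range fun ξ : {x // x ∈ w} => Q.check ξ.1) Q.carrier)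

theorem isName_valueName (w F σ : ZFSet.{u}) : Q.IsName (Q.valueName w F σ) := by
  refine .intro _ (fun z hz => ?_) fun ρ p h => ?_
  · obtain ⟨ρ, -, p, hp, rfl⟩ := ZFSet.mem_prod.1 (ZFSet.mem_sep.1 hz).1
    exact ⟨ρ, p, hp, rfl⟩
  · obtain ⟨ξ, s, h', -⟩ := (ZFSet.mem_sep.1 h).2
    obtain ⟨rfl, rfl⟩ := ZFSet.pair_inj.1 h'
    exact isName_check ξ

namespace World

theorem denotes_check (hW : Q.World A Φ G) {x : ZFSet.{u}} (hx : x ∈ A) :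
    Denotes A G (Q.check x) (bar Q A G x) := ⟨(hW.check_mem_iff x).2 hx, rfl⟩

theorem sat_of_forces (hW : Q.World A Φ G) {a a' : Fml ZFSet.{u}} (h : Interprets Q A G a a')
    (ha : a ∈ Φ) {p : ZFSet.{u}} (hp : p ∈ G) (hf : Q.Forces p a) : Sat (extension Q A G) a' :=
  (h.holds_iff hW.toGeneric ha).1 ⟨p, hp, hf⟩

/-- The name collects the canonical names of those elements of `w` that are forced to belong to the
value. It suffices that the value is a subset of `w`, as holds for ordinals below ω₂ with w = ω₂. -/
theorem val_valueName (hW : Q.World A Φ G) {w F σ Y : ZFSet.{u}} (hF : F ∈ A) (hσ : σ ∈ A)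
    (hσn : Q.IsName σ) (hY : Y ∈ extension Q A G)
    (h : ∀ v, ZFSet.pair (val A G σ) v ∈ val A G F ↔ v = Y) (hYw : Y ⊆ bar Q A G w) :
    val A G (Q.valueName w F σ) = Y := by
  have hX := hW.pairClosed
  have key : ∀ ξ ∈ A, Generic.Holds Q G (Poset.valueFml F σ (Q.check ξ)) ↔ bar Q A G ξ ∈ Y := by
    intro ξ hξ
    rw [(Interprets.valueFml (Q := Q) ⟨hF, rfl⟩ ⟨hσ, rfl⟩ (hW.denotes_check hξ)).holds_iff
      hW.toGeneric (hW.valueFml F hF σ hσ _ ((hW.check_mem_iff ξ).2 hξ)), Poset.valueFml, sat_ex]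
    constructor
    · rintro ⟨v, hv, h'⟩
      rw [sat_and, sat_pairMem hX ⟨σ, hσ, hσn, rfl⟩ hv, h] at h'
      exact h'.1 ▸ h'.2
    · intro h'
      refine ⟨Y, hY, ?_⟩
      rw [sat_and, sat_pairMem hX ⟨σ, hσ, hσn, rfl⟩ hY, h]
      exact ⟨rfl, h'⟩
  ext x
  rw [mem_val]
  constructor
  · rintro ⟨ρ, hρ, t, ht, h', rfl⟩
    obtain ⟨ξ, s, h', hs⟩ := (ZFSet.mem_sep.1 h').2
    obtain ⟨rfl, rfl⟩ := ZFSet.pair_inj.1 h'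
    exact (key ξ ((hW.check_mem_iff ξ).1 hρ)).1 ⟨t, ht, hs⟩
  · intro hx
    obtain ⟨ξ, hξ, hξw, rfl⟩ := hW.mem_bar.1 (hYw hx)
    obtain ⟨s, hs, hf⟩ := (key ξ hξ).2 hx
    exact ⟨_, (hW.check_mem_iff ξ).2 hξ, s, hs, ZFSet.mem_sep.2 ⟨ZFSet.pair_mem_prod.2
      ⟨ZFSet.mem_range.2 ⟨⟨ξ, hξw⟩, rfl⟩, hW.subset s hs⟩, ξ, s, rfl, hf⟩, rfl⟩

theorem val_mem_extName (hW : Q.World A Φ G) {M τ : ZFSet.{u}} (hτ : τ ∈ A) (hτM : τ ∈ M)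
    (hτn : Q.IsName τ) : val A G τ ∈ val A G (Q.extName M) := by
  obtain ⟨p, hp⟩ := hW.nonempty
  exact mem_val.2 ⟨τ, hτ, p, hp, ZFSet.mem_sep.2
    ⟨ZFSet.pair_mem_prod.2 ⟨hτM, hW.subset p hp⟩, τ, p, rfl, hτn⟩, rfl⟩

/-- The interpretation of an ordinal is an ordinal. -/
theorem isOrdinal_bar (hW : Q.World A Φ G) {x : ZFSet.{u}} (hx : x.IsOrdinal) :
    (bar Q A G x).IsOrdinal := by
  have ht : ∀ {y : ZFSet.{u}}, y.IsTransitive → (bar Q A G y).IsTransitive := by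
    intro y hy z hz
    obtain ⟨t, ht, hty, rfl⟩ := hW.mem_bar.1 hz
    exact hW.bar_subset_bar (hy t hty)
  rw [ZFSet.isOrdinal_iff_forall_mem_isTransitive]
  refine ⟨ht hx.isTransitive, fun z hz => ?_⟩
  obtain ⟨t, -, htx, rfl⟩ := hW.mem_bar.1 hz
  exact ht (hx.mem htx).isTransitive

end World

end ValueName

/-! ### Semiproper forcing -/

variable {Q : Poset.{u}} {w₁ w₂ B : ZFSet.{u}}

/-- Ground model countable subsets remain countable subsets. -/
theorem forces_countable_subsets (hB : ∀ z ∈ B, z ⊆ w₂ ∧ Injects Set.univ z omegaSet)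
    (p : ZFSet.{u}) : Q.Forces p (.allIn (Q.check B)
      fun z => Fml.sub z (Q.check w₂) ⋏ Fml.ctbl z) := by
  intro x hx
  by_contra hcon
  obtain ⟨q, hq, hf⟩ := exists_forces_of_not_neg hcon
  obtain ⟨A, Φ, G, hW, hX, hΨ, hqG⟩ := Q.exists_world hq.left_mem (X := {x, B, w₂})
    (by simp) (Set.countable_singleton ((.mem x (Q.check B)) ⋏
      ∼ᶠ (Fml.sub x (Q.check w₂) ⋏ Fml.ctbl x)))
  have hxA : x ∈ A := hX (by simp)
  have hBA : B ∈ A := hX (by simp)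
  have hwA : w₂ ∈ A := hX (by simp)
  have hd : Denotes A G x (val A G x) := ⟨hxA, rfl⟩
  have hPC := hW.pairClosed
  have hs := hW.sat_of_forces ((Interprets.mem' hd (hW.denotes_check hBA)).and
    ((Interprets.sub hd (hW.denotes_check hwA)).and (Interprets.ctbl hd)).neg) (hΨ rfl) hqG hf
  rw [sat_and, sat_mem, sat_neg, sat_and, sat_sub hPC ⟨x, hxA, hx, rfl⟩,
    sat_ctbl hPC hW.omegaSet_mem ⟨x, hxA, hx, rfl⟩] at hs
  obtain ⟨z, hz, hzB, e⟩ := hW.mem_bar.1 hs.1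
  rw [← e] at hs
  refine hs.2 ⟨hW.bar_subset_bar (hB z hzB).1, ?_⟩
  have := hW.injects_bar hz hW.omega_mem (hB z hzB).2
  rwa [hW.bar_omegaSet] at this

/-- That the ground model sets are countable subsets is always forced, so a failure of stationarity
can only come from some operation under which none of them is closed. -/
theorem exists_forces_not_closed (hB : ∀ z ∈ B, z ⊆ w₂ ∧ Injects Set.univ z omegaSet)
    {p : ZFSet.{u}} (h : ¬ Q.Forces p (.stationary (Q.check B) (Q.check w₂))) :
    ∃ F q, Q.IsName F ∧ q ∈ Q.carrier ∧ Q.Forces q (.isFinOp F (Q.check w₂)) ∧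
      Q.Forces q (.neg (.exIn (Q.check B) fun z => .closedUnder z F)) := by
  have h' : ¬ ∀ F, Q.IsName F → Q.Forces p (.imp (.isFinOp F (Q.check w₂))
      (.exIn (Q.check B) fun z => .closedUnder z F)) :=
    fun h' => h ⟨forces_countable_subsets hB p, h'⟩
  push Not at h'
  obtain ⟨F, hF, h'⟩ := h'
  obtain ⟨q, hq, h'⟩ := exists_forces_of_not_neg h'
  exact ⟨F, q, hF, hq.left_mem, h'.1, h'.2⟩

/-- The argument for outer models with M[G] in place of N. A value ζ < ω₂ of `F` at a finite subset
of M ∩ ω₂ has a name in `M`, and so has f(ζ) for each f : ω₂ → ω₁ in `M`. If M ⊑ M[G], then f(ζ) ∈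
M, and determinedness gives ζ ∈ M. So M ∩ ω₂, an element of `B`, is closed under `F`, contrary to
what `r` forces. -/
theorem not_forces_sqsub (h₁ : IsOmega1 Set.univ w₁)
    (h12 : w₁ ⊆ w₂) (hw₂ : w₂.IsOrdinal)
    (hB : ∀ z, z ⊆ w₂ → Injects Set.univ z omegaSet → z ∈ B) {F M K r : ZFSet.{u}}
    (hF : Q.IsName F) (hr : r ∈ Q.carrier)
    (hr1 : Q.Forces r (.isFinOp F (Q.check w₂)))
    (hr2 : Q.Forces r (.neg (.exIn (Q.check B) fun z => .closedUnder z F)))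
    (hMc : {x | x ∈ M}.Countable) (h0 : ∅ ∈ M) (hins : ∀ x ∈ M, ∀ y ∈ M, insert x y ∈ M)
    (hv1 : ∀ e ∈ M, Q.valueName w₂ F (Q.check e) ∈ M)
    (hv2 : ∀ f ∈ M, ∀ τ ∈ M, Q.valueName w₂ (Q.check f) τ ∈ M)
    (hK : w₂ ⊆ K) (hdet : Determined w₁ w₂ (M ∩ K)) :
    ¬ Q.Forces r (.sqsub (Q.check M) (Q.extName M)) := by
  intro hr3
  set z := M ∩ w₂ with hz
  obtain ⟨A, Φ, G, hW, hX, hΨ, hrG⟩ := Q.exists_world hr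
    (X := {x | x ∈ M} ∪ {F, M, Q.extName M, w₁, w₂, B, z})
    (hMc.union (Set.toFinite _).countable)
    (Ψ := {.isFinOp F (Q.check w₂), .neg (.exIn (Q.check B) fun z => .closedUnder z F),
      .sqsub (Q.check M) (Q.extName M)}) (Set.toFinite _).countable
  have hMA : ∀ x ∈ M, x ∈ A := fun x hx => hX (Or.inl hx)
  have hFA : F ∈ A := hX (by simp)
  have hMA' : M ∈ A := hX (by simp)
  have hEA : Q.extName M ∈ A := hX (by simp)
  have hw₁A : w₁ ∈ A := hX (by simp)
  have hw₂A : w₂ ∈ A := hX (by simp)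
  have hBA : B ∈ A := hX (by simp)
  have hzA : z ∈ A := hX (by simp)
  have hPC := hW.pairClosed
  have hω := hW.omegaSet_mem
  have hFd : Denotes A G F (val A G F) := ⟨hFA, rfl⟩
  have hFN : val A G F ∈ extension Q A G := ⟨F, hFA, hF, rfl⟩
  -- the model satisfies the forced formulas
  have s1 := hW.sat_of_forces (Interprets.isFinOp hFd (hW.denotes_check hw₂A))
    (hΨ (by simp)) hrG hr1
  have s2 := hW.sat_of_forces (Interprets.exIn (hW.denotes_check hBA)
    fun k => Interprets.closedUnder k hFd).neg (hΨ (by simp)) hrG hr2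
  have s3 := hW.sat_of_forces (Interprets.sqsub (hW.denotes_check hMA')
    ⟨hEA, rfl⟩) (hΨ (by simp)) hrG hr3
  rw [sat_isFinOp hPC hω hFN (hW.bar_mem hw₂A)] at s1
  rw [sat_neg, sat_exIn hPC (hW.bar_mem hBA)] at s2
  rw [sat_sqsub hPC hω (hW.bar_mem hMA') ⟨_, hEA, isName_extName M, rfl⟩] at s3
  obtain ⟨-, w, hwN, hw, -, -, hwM⟩ := s3
  -- `ω₁` of the ground model is contained in `ω₁` of the model
  have hw₁w : World.bar Q A G w₁ ⊆ w := by
    rcases hw.1.mem_or_subset (hW.isOrdinal_bar h₁.1) with h | h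
    · obtain ⟨α, hα, hαw, rfl⟩ := hW.mem_bar.1 h
      have := hW.injects_bar hα hW.omega_mem (h₁.2.2 α hαw)
      rw [hW.bar_omegaSet] at this
      exact (hw.2.1 this).elim
    · exact h
  have hzM : ∀ {t}, t ∈ z → t ∈ M := fun ht => (ZFSet.mem_inter.1 ht).1
  have hzw : z ⊆ w₂ := fun t ht => (ZFSet.mem_inter.1 ht).2
  have hzB : z ∈ B := hB z hzw (injects_omegaSet_iff.2 (hMc.mono fun t ht => hzM ht))
  refine s2 ⟨_, hW.bar_mem_bar hzA hzB, (sat_closedUnder hPC hω hFN).2 fun e he hez hef y hy => ?_⟩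
  -- `e` is the interpretation of an element of `M`
  set e₀ := ZFSet.sep (fun t => World.bar Q A G t ∈ e) z with he₀
  have he₀fin : {t | t ∈ e₀}.Finite := by
    refine Set.Finite.of_injOn (f := World.bar Q A G) (t := {t | t ∈ e})
      (fun t ht => (ZFSet.mem_sep.1 ht).2) ?_ hef.finite
    intro s hs t ht hst
    exact hW.bar_injOn s (hMA s (hzM (ZFSet.mem_sep.1 hs).1)) t
      (hMA t (hzM (ZFSet.mem_sep.1 ht).1)) hst
  have he₀M : e₀ ∈ M := mem_of_finite_subset (M := {x | x ∈ M}) h0 hins he₀fin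
    fun t ht => hzM (ZFSet.mem_sep.1 ht).1
  have hbe : World.bar Q A G e₀ = e := by
    ext t
    rw [hW.mem_bar]
    constructor
    · rintro ⟨s, -, hs, rfl⟩
      exact (ZFSet.mem_sep.1 hs).2
    · intro ht
      obtain ⟨s, hs, hsz, rfl⟩ := hW.mem_bar.1 (hez ht)
      exact ⟨s, hs, ZFSet.mem_sep.2 ⟨hsz, ht⟩, rfl⟩
  obtain ⟨y', hy', hyu⟩ := s1 e he (fun t ht => hW.bar_subset_bar hzw (hez ht)) hef
  obtain rfl := (hyu y).1 hy
  obtain ⟨ζ, hζA, hζ, rfl⟩ := hW.mem_bar.1 hy'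
  -- the name for the value of `F` at `e`
  set τ := Q.valueName w₂ F (Q.check e₀) with hτ
  have hτM : τ ∈ M := hv1 e₀ he₀M
  have hτv : val A G τ = World.bar Q A G ζ := by
    refine hW.val_valueName hFA ((hW.check_mem_iff e₀).2 (hMA e₀ he₀M)) (isName_check e₀)
      (hW.bar_mem hζA) (fun v => ?_) (hW.bar_subset_bar (hw₂.subset_of_mem hζ))
    change ZFSet.pair (World.bar Q A G e₀) v ∈ _ ↔ _
    rw [hbe, hyu]
  have hζx : ζ ∈ M ∩ K := by
    refine hdet ζ hζ fun f hf hff η hη => ?_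
    have hfM := (ZFSet.mem_inter.1 hf).1
    have hηw := hff.2.mem hζ hη
    obtain ⟨η', hη'A, hη'⟩ := hW.value f (hMA f hfM) ζ hζA η hη
    obtain rfl := hff.2.unique hζ hη' hη
    have hfr : ∀ p ∈ f, ∃ x y, p = ZFSet.pair x y := fun p hp => by
      obtain ⟨x, -, y, -, h⟩ := hff.1 p hp
      exact ⟨x, y, h⟩
    have hv : val A G (Q.valueName w₂ (Q.check f) τ) = World.bar Q A G η' := by
      refine hW.val_valueName ((hW.check_mem_iff f).2 (hMA f hfM)) (hMA τ hτM)
        (isName_valueName _ _ _) (hW.bar_mem hη'A) (fun v => ?_)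
        (hW.bar_subset_bar (hw₂.subset_of_mem (h12 hηw)))
      change ZFSet.pair _ v ∈ World.bar Q A G f ↔ _
      rw [hτv, hW.pair_mem_bar_iff hfr hζA]
      constructor
      · rintro ⟨y, -, hy, rfl⟩
        rw [hff.2.unique hζ hy hη]
      · rintro rfl
        exact ⟨η', hη'A, hη, rfl⟩
    have hmE := hW.val_mem_extName (hMA _ (hv2 f hfM τ hτM)) (hv2 f hfM τ hτM)
      (isName_valueName _ _ _)
    -- The value f(ζ) is in M[G] and below ω₁, so M ⊑ M[G] puts it into the interpretation of `M`,
    -- and the collapse reflects membership back to `M`.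
    rw [hv, ← hwM _ (hw₁w (hW.bar_mem_bar hη'A hηw)), hW.bar_mem_bar_iff hη'A] at hmE
    exact ZFSet.mem_inter.2 ⟨hmE, hK (h12 hηw)⟩
  exact hW.bar_mem_bar hζA (ZFSet.mem_inter.2 ⟨(ZFSet.mem_inter.1 hζx).1, hζ⟩)

/-- Strong Chang's Conjecture from a nonreasonable semiproper poset. -/
theorem Semiproper.scc (hQ : Q.Semiproper) (hw₂ : Sat Set.univ (.isOmega2 w₂))
    (hns : ¬ Q.ReasonableAt w₂) : SCC (Set.univ : Set ZFSet.{u}) := by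
  by_contra hS
  have hV := isTransitiveModel_univ.{u}
  have hX := hV.pairClosed
  have hω := hV.omegaSet_mem
  rw [sat_isOmega2 hX hω trivial] at hw₂
  obtain ⟨w₁, -, h₁, h₂⟩ := hw₂
  have h12 := h₂.mem hV h₁ trivial
  rw [ReasonableAt] at hns
  push Not at hns
  obtain ⟨B, hB, p, -, hns⟩ := hns
  rw [sat_isCtblSubsets hX hω trivial] at hB
  obtain ⟨F, q, hF, hq, hq1, hq2⟩ := exists_forces_not_closed
    (fun z hz => ((hB z).1 hz).2) hns
  obtain ⟨K, -, S, -, hwK, hK, -, hSm, hst⟩ :=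
    exists_stationary_determined hV trivial trivial h₁ h₂ hS
  obtain ⟨θ₀, hθ₀, hsp⟩ := hQ
  rw [sat_isOrd hX trivial] at hθ₀
  -- a sufficiently large `H_θ`
  set D : ZFSet.{u} := ZFSet.prod (ZFSet.range fun ξ : {x // x ∈ w₂} => Q.check ξ.1) Q.carrier
  -- The three sets lie in V_o, a transitive set that injects into `b`. So they belong to H_θ for
  -- every regular θ above `b`.
  let o : Ordinal.{u} := Order.succ (({K, D, Q.carrier} : ZFSet.{u}).rank)
  obtain ⟨b, hb, hVb⟩ := exists_injects_ordinal (ZFSet.vonNeumann o)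
  obtain ⟨b', hb', hθb, hbb⟩ : ∃ b' : ZFSet.{u}, b'.IsOrdinal ∧ θ₀ ⊆ b' ∧ b ⊆ b' := by
    rcases hθ₀.subset_total hb with h | h
    · exact ⟨b, hb, h, fun _ => id⟩
    · exact ⟨θ₀, hθ₀, fun _ => id, h⟩
  -- The failure of SCC is used here only as a source of regular θ above a given ordinal for which
  -- H_θ has a wellorder.
  obtain ⟨θ, H, d, -, hH, hbθ, -⟩ := exists_counterexample hV trivial trivial h₁ h₂ hS
    (b := b') trivial hb'
  have hmem : ∀ x, x ∈ ({K, D, Q.carrier} : ZFSet.{u}) → x ∈ H := by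
    intro x hx
    refine (hH.mem_iff x).2 ⟨trivial, ZFSet.vonNeumann o, trivial,
      ZFSet.isTransitive_vonNeumann o, ?_, b', hbθ, hVb.mono (fun _ => id) hbb⟩
    refine ZFSet.isTransitive_vonNeumann o x (ZFSet.mem_vonNeumann.2 ?_)
    exact (ZFSet.rank_lt_of_mem hx).trans (Order.lt_succ _)
  have hKH : K ∈ H := hmem K (by simp)
  have hDH : D ∈ H := hmem D (by simp)
  have hqH : q ∈ H := hH.isTransitive _ (hmem Q.carrier (by simp)) hq
  have h0H : ∅ ∈ H := hH.subset_mem hKH trivial fun y hy => (ZFSet.notMem_empty y hy).elim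
  have hvH : ∀ F σ, Q.valueName w₂ F σ ∈ H := fun F σ =>
    hH.subset_mem hDH trivial fun y hy => (ZFSet.mem_sep.1 hy).1
  -- The closure needed of `M`: names for values of `F` and of ground model functions, finite
  -- subsets built up from ∅, and the condition `q`.
  let op : ULift.{u + 1} (Fin 5) → List ZFSet.{u} → ZFSet.{u} := fun i l => match i.down, l with
    | 0, [e] => Q.valueName w₂ F (Q.check e)
    | 1, [f, τ] => Q.valueName w₂ (Q.check f) τ
    | 2, [x, y] => insert x y
    | 3, [] => q
    | _, _ => ∅
  obtain ⟨M, hMc, hME, hMop, hMS⟩ := hst.exists_elemSub (A := {ZFSet.pair Q.carrier Q.rel}) hK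
    (hH.isTransitive K hKH) (hwK h12) op (by
      rintro ⟨i⟩ l hl
      simp only [op]
      split
      · exact hvH _ _
      · exact hvH _ _
      · exact hH.insert_mem (hl _ (by simp)) (hl _ (by simp))
      · exact hqH
      · exact h0H)
  have hqM : q ∈ M := hMop ⟨3⟩ [] (by simp)
  obtain ⟨r, hr, hrf⟩ := hsp θ (hθ₀.mem_of_subset_of_mem hH.regular.1.1 hθb hbθ)
    ((sat_isRegular hX trivial).2 hH.regular) H ((sat_isH hX trivial trivial).2 hH.mem_iff) M
    ((sat_ctbl hX hω trivial).2 (injects_omegaSet_iff.2 hMc)) hME q hqM hq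
  exact not_forces_sqsub h₁ (h₂.1.subset_of_mem h12) h₂.1
    (fun z hz hzc => (hB z).2 ⟨trivial, hz, hzc⟩) hF hr.left_mem (hq1.mono hr) (hq2.mono hr) hMc
    (hMop ⟨4⟩ [] (by simp)) (fun x hx y hy => hMop ⟨2⟩ [x, y] (by simp [hx, hy]))
    (fun e he => hMop ⟨0⟩ [e] (by simp [he])) (fun f hf τ hτ => hMop ⟨1⟩ [f, τ] (by simp [hf, hτ]))
    hwK ((hSm _).1 hMS).2.2.2 hrf

end Poset

end ChangConj

theorem mainTheorem1 :
    (∀ V W : Set ZFSet.{u}, ChangConj.IsTransitiveModel V → ChangConj.IsTransitiveModel W →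
      V ⊆ W → ChangConj.SemistationaryPreserving V W →
      ChangConj.GroundModelNonstationary V W → ChangConj.SCC V) ∧
    ((∃ (Q : ChangConj.Poset.{u}) (ω₂ : ZFSet.{u}),
        ChangConj.Sat Set.univ (ChangConj.Fml.isOmega2 ω₂) ∧
        Q.Semiproper ∧ ¬ Q.ReasonableAt ω₂) →
      ChangConj.SCC (Set.univ : Set ZFSet.{u})) :=
  ⟨fun _ _ hV hW hVW h1 h2 => ChangConj.scc_of_outer_model hV hW hVW h1 h2,
    fun ⟨_, _, hω₂, hQ, hns⟩ => hQ.scc hω₂ hns⟩
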